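/- **Definitions.** For distributions $p,q$ on $[n]$ let $d_{\mathrm{TV}}(p,q)=\frac12\sum_i|p_i-q_i|$. A randomized algorithm $M$ on $\mathbb N^n$ (the input $D$ gives the number of occurrences of each symbol) is $(\varepsilon,\delta)$-differentially private if $\Pr[M(D)\in S]\le e^{\varepsilon}\Pr[M(D')\in S]+\delta$ for all sets $S$ of outputs and all $D,D'\in\mathbb N^n$ with $\|D-D'\|_1\le 1$. An algorithm for $(\alpha,\beta_{\rm I},\beta_{\rm II})$-identity testing against $q$ outputs "$p=q$" with probability at least $1-\beta_{\rm I}$ on samples from $p=q$, and outputs "$p\ne q$" with probability at least $1-\beta_{\rm II}$ on samples from any $p$ with $d_{\mathrm{TV}}(p,q)\ge\alpha$. Put $$B(n,\alpha,\varepsilon)=\max\left\{\frac{\sqrt n}{\alpha^2},\ \frac{\sqrt n}{\alpha^{3/2}\varepsilon},\ \frac{n^{1/3}}{\alpha^{5/3}\varepsilon^{2/3}}\right\}.$$ *Priv'IT* with parameters $\varepsilon,\alpha,m,q$ is the following algorithm on counts $N\in\mathbb N^n$. Let $c_1=1/4$, $c_2=3/40$, $\mathcal A=\{i: q_i\ge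 c_1\alpha/n\}$, $\tau=\frac{2}{c_2\varepsilon}\log\frac{1}{1-(1-c_2)^{1/|\mathcal A|}}$, and let $Y_i$ $(i\in\mathcal A)$ be independent Laplace variables of mean $0$ and scale $2/(c_2\varepsilon)$. If $|Y_i|\ge\tau$ for some $i\in\mathcal A$, output "$p\neq q$" or "$p=q$" with probability $1/2$ each. Otherwise, if $|N_i+Y_i-mq_i|\ge\tau+\max\{4\sqrt{mq_i\log n},\log n\}$ for some $i\in\mathcal A$, output "$p\ne q$". Otherwise let $T$ be the point of $[0,1]$ closest to $\frac{2}{m\alpha^2}\sum_{i\in\mathcal A}\frac{(N_i-mq_i)^2-N_i}{mq_i}$, and output "$p\neq q$" with probability $T$ and "$p=q$" with probability $1-T$. **Theorem.** There are universal constants $C>0$ and $k\in\mathbb N$ such that the following two statements hold for every $n\ge1$, every distribution $q$ on $[n]$, and all $\varepsilon>0$, $\alpha\in(0,1]$. 1. For all $\beta_{\rm I},\beta_{\rm II}\in(0,1)$, with $\beta=\min(\beta_{\rm I},\beta_{\rm II})$, and every integer $m\ge C\,(1+\log n)^k\,B(n,\alpha,\varepsilon)\,\log(1/\beta)$, there is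 an $(\varepsilon,0)$-differentially private algorithm for $(\alpha,\beta_{\rm I},\beta_{\rm II})$-identity testing against $q$ that uses $m$ independent samples from $p$. In short, $m=\tilde O\left(B(n,\alpha,\varepsilon)\log(1/\beta)\right)$ samples suffice. 2. If $n\ge2$, then for every integer $m\ge C\,(1+\log n)^k\,B(n,\alpha,\varepsilon)$ the algorithm Priv'IT with parameters $\varepsilon,\alpha,m,q$ is $(\varepsilon,0)$-differentially private and, run on the counts of $\mathrm{Poisson}(m)$ independent samples from $p$, is an algorithm for $(\alpha,1/3,1/3)$-identity testing against $q$. -/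

import Mathlib

open MeasureTheory

noncomputable section

namespace PrivIT

/-! ### Identity testing and differential privacy -/

/-- The two possible outputs of an identity tester: `equal` is the answer "`p = q`" and
`different` is the answer "`p ≠ q`". -/
inductive Verdict where
  | equal
  | different
  deriving DecidableEq

instance : Fintype Verdict :=
  ⟨{.equal, .different}, fun v => by cases v <;> simp⟩

/-- The total variation distance of two distributions on `[n]`. -/
def tvDist {n : ℕ} (p q : PMF (Fin n)) : ℝ :=
  (1 / 2) * ∑ i, |(p i).toReal - (q i).toReal|

/-- A randomized algorithm with domain `ℕⁿ` (the dataset is given by the number of occurrences of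
each symbol) and outputs in `R`: it maps a dataset to the law of its output. -/
abbrev Mechanism (n : ℕ) (R : Type) : Type := (Fin n → ℕ) → PMF R

/-- `(ε, δ)`-differential privacy. Neighbouring datasets are those at `ℓ¹`-distance at most `1`. -/
def DifferentiallyPrivate {n : ℕ} {R : Type} (M : Mechanism n R) (ε δ : ℝ) : Prop :=
  ∀ D D' : Fin n → ℕ, ∑ i, |(D i : ℤ) - (D' i : ℤ)| ≤ 1 → ∀ S : Set R,
    (M D).toOuterMeasure S ≤
      ENNReal.ofReal (Real.exp ε) * (M D').toOuterMeasure S + ENNReal.ofReal δ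

theorem sum_prod_pmf {n : ℕ} (p : PMF (Fin n)) (m : ℕ) :
    ∑ x : Fin m → Fin n, ∏ j, p (x j) = 1 := by
  have h : ∑ i, p i = 1 := by rw [← tsum_fintype (L := .unconditional _)]; exact p.tsum_coe
  rw [← Fintype.piFinset_univ, ← Finset.prod_univ_sum (fun _ => Finset.univ) (fun _ i => p i)]
  simp [h]

/-- The law of `m` independent samples from `p`. -/
def iidSamples {n : ℕ} (p : PMF (Fin n)) (m : ℕ) : PMF (Fin m → Fin n) :=
  PMF.ofFintype (fun x => ∏ j, p (x j)) (sum_prod_pmf p m)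

/-- The number of occurrences of each symbol in a sequence of samples. -/
def counts {n m : ℕ} (x : Fin m → Fin n) (i : Fin n) : ℕ :=
  (Finset.univ.filter fun j => x j = i).card

/-- The law of the output of `M` run on exactly `m` independent samples from `p`. -/
def outputLaw {n : ℕ} {R : Type} (M : Mechanism n R) (p : PMF (Fin n)) (m : ℕ) : PMF R :=
  (iidSamples p m).bind fun x => M (counts x)

/-- The law of the output of `M` run on `K` independent samples from `p`, where `K` is an
independent Poisson variable of mean `m`. -/
def poissonOutputLaw {n : ℕ} {R : Type} (M : Mechanism n R) (p : PMF (Fin n)) (m : ℕ) : PMF R :=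
  ((ProbabilityTheory.poissonMeasure (m : NNReal)).toPMF).bind fun K => outputLaw M p K

/-- The guarantees of `(α, β₁, β₂)`-identity testing against `q`, for an algorithm whose output has
the law `out p` when it is run on samples from `p`. -/
def TestsIdentity {n : ℕ} (out : PMF (Fin n) → PMF Verdict) (q : PMF (Fin n))
    (α β₁ β₂ : ℝ) : Prop :=
  1 - β₁ ≤ (out q Verdict.equal).toReal ∧
    ∀ p : PMF (Fin n), α ≤ tvDist p q → 1 - β₂ ≤ (out p Verdict.different).toReal

/-- `max {√n / α², √n / (α^{3/2} ε), n^{1/3} / (α^{5/3} ε^{2/3})}`. -/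
def sampleBound (n : ℕ) (α ε : ℝ) : ℝ :=
  max (max (Real.sqrt n / α ^ 2) (Real.sqrt n / (α ^ (3 / 2 : ℝ) * ε)))
    ((n : ℝ) ^ (1 / 3 : ℝ) / (α ^ (5 / 3 : ℝ) * ε ^ (2 / 3 : ℝ)))

/-! ### The algorithm Priv'IT -/

/-- The Laplace distribution with mean `0` and scale `b > 0`. -/
def laplace (b : ℝ) : Measure ℝ :=
  volume.withDensity fun x => ENNReal.ofReal (Real.exp (-|x| / b) / (2 * b))

theorem laplace_univ {b : ℝ} (hb : 0 < b) : laplace b Set.univ = 1 := by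
  have e : ∫ x in Set.Ioi (0 : ℝ), Real.exp (-x / b) = b := by
    have := integral_exp_mul_Ioi (a := -(1 / b)) (by simpa using hb) 0
    rw [show (fun x : ℝ => Real.exp (-x / b)) = fun x => Real.exp (-(1 / b) * x) by
      ext x; congr 1; field_simp, this]
    simp
  have h1 : ∫ x : ℝ, Real.exp (-|x| / b) / (2 * b) = 1 := by
    rw [integral_comp_abs (f := fun t => Real.exp (-t / b) / (2 * b)), integral_div, e]
    field_simp
  have hI : Integrable fun x : ℝ => Real.exp (-|x| / b) / (2 * b) :=
    Integrable.of_integral_ne_zero (by rw [h1]; exact one_ne_zero)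
  rw [laplace, withDensity_apply _ MeasurableSet.univ, Measure.restrict_univ,
    ← ofReal_integral_eq_lintegral_ofReal hI
      (Filter.Eventually.of_forall fun x => by positivity), h1, ENNReal.ofReal_one]

theorem laplace_of_nonpos {b : ℝ} (hb : b ≤ 0) : laplace b = 0 := by
  have : (fun x : ℝ => ENNReal.ofReal (Real.exp (-|x| / b) / (2 * b))) = 0 := by
    ext x
    simp only [Pi.zero_apply, ENNReal.ofReal_eq_zero]
    exact div_nonpos_of_nonneg_of_nonpos (Real.exp_pos _).le (by linarith)
  rw [laplace, this, withDensity_zero]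

theorem laplace_univ_le (b : ℝ) : laplace b Set.univ ≤ 1 := by
  rcases lt_or_ge 0 b with hb | hb
  · exact (laplace_univ hb).le
  · simp [laplace_of_nonpos hb]

instance (b : ℝ) : IsFiniteMeasure (laplace b) :=
  ⟨(laplace_univ_le b).trans_lt ENNReal.one_lt_top⟩

/-- The constant `c₁`. -/
def c₁ : ℝ := 1 / 4

/-- The constant `c₂`. -/
def c₂ : ℝ := 3 / 40

section
variable {n : ℕ} (ε α : ℝ) (m : ℕ) (q : PMF (Fin n))

/-- The set `𝒜 = {i : qᵢ ≥ c₁ α / n}`. -/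
def heavy : Finset (Fin n) :=
  Finset.univ.filter fun i => c₁ * α / n ≤ (q i).toReal

/-- The noise threshold `2 / (c₂ ε) * log (1 / (1 - (1 - c₂) ^ (1 / |𝒜|)))`. -/
def noiseThreshold : ℝ :=
  2 / (c₂ * ε) * Real.log (1 / (1 - (1 - c₂) ^ (1 / ((heavy α q).card : ℝ))))

/-- The allowed statistical deviation `max {4 √(m qᵢ log n), log n}` of the `i`-th count. -/
def deviation (i : Fin n) : ℝ :=
  max (4 * Real.sqrt (m * (q i).toReal * Real.log n)) (Real.log n)

/-- The statistic `Z = 2 / (m α²) * ∑ i ∈ 𝒜, ((Nᵢ - m qᵢ)² - Nᵢ) / (m qᵢ)`. -/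
def statistic (N : Fin n → ℕ) : ℝ :=
  2 / (m * α ^ 2) * ∑ i ∈ heavy α q,
    (((N i : ℝ) - m * (q i).toReal) ^ 2 - N i) / (m * (q i).toReal)

/-- The conditional probability that Priv'IT answers "`p ≠ q`", given the counts `N` and the noise
`y`. If some noise variable is too large, then the answer is a fair coin. Otherwise, if some noisy
count is far from its expectation under `q`, then the answer is "`p ≠ q`". Otherwise, the answer is
"`p ≠ q`" with probability equal to the point of `[0, 1]` that is closest to the statistic. -/
def rejectGivenNoise (N : Fin n → ℕ) (y : heavy α q → ℝ) : ℝ :=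
  if ∃ i, noiseThreshold ε α q ≤ |y i| then 1 / 2
  else if ∃ i : heavy α q,
      noiseThreshold ε α q + deviation m q i ≤ |(N i : ℝ) + y i - m * (q i).toReal| then 1
  else max 0 (min 1 (statistic α m q N))

/-- The probability that Priv'IT answers "`p ≠ q`" on the counts `N`, the noise being independent
Laplace variables of scale `2 / (c₂ ε)`, one for each element of `𝒜`. -/
def rejectProb (N : Fin n → ℕ) : ℝ :=
  ∫ y, rejectGivenNoise ε α m q N y ∂Measure.pi fun _ : heavy α q => laplace (2 / (c₂ * ε))

theorem rejectGivenNoise_nonneg (N : Fin n → ℕ) (y : heavy α q → ℝ) :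
    0 ≤ rejectGivenNoise ε α m q N y := by
  unfold rejectGivenNoise
  split_ifs <;> simp

theorem rejectGivenNoise_le_one (N : Fin n → ℕ) (y : heavy α q → ℝ) :
    rejectGivenNoise ε α m q N y ≤ 1 := by
  unfold rejectGivenNoise
  split_ifs
  · norm_num
  · exact le_rfl
  · simp

theorem rejectProb_nonneg (N : Fin n → ℕ) : 0 ≤ rejectProb ε α m q N :=
  integral_nonneg fun y => rejectGivenNoise_nonneg ε α m q N y

theorem rejectProb_le_one (N : Fin n → ℕ) : rejectProb ε α m q N ≤ 1 := by
  set μ := Measure.pi fun _ : heavy α q => laplace (2 / (c₂ * ε)) with hμ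
  have hu : μ Set.univ ≤ 1 := by
    rw [hμ, Measure.pi_univ]
    exact Finset.prod_le_one' fun _ _ => laplace_univ_le _
  have hr : μ.real Set.univ ≤ 1 := by
    simpa [Measure.real] using ENNReal.toReal_mono ENNReal.one_ne_top hu
  have h := norm_integral_le_of_norm_le_const (μ := μ) (C := 1)
    (f := rejectGivenNoise ε α m q N)
    (Filter.Eventually.of_forall fun y => by
      rw [Real.norm_of_nonneg (rejectGivenNoise_nonneg ε α m q N y)]
      exact rejectGivenNoise_le_one ε α m q N y)
  exact (le_abs_self _).trans (h.trans (by simpa using hr))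

/-- The distribution on verdicts that gives "`p ≠ q`" the probability `t`. -/
def verdictCoin (t : ℝ) (h0 : 0 ≤ t) (h1 : t ≤ 1) : PMF Verdict :=
  PMF.ofFintype
    (fun v => match v with
      | .equal => ENNReal.ofReal (1 - t)
      | .different => ENNReal.ofReal t)
    (by
      rw [show (Finset.univ : Finset Verdict) = {.equal, .different} from rfl,
        Finset.sum_pair (by decide), ← ENNReal.ofReal_add (by linarith) h0]
      simp)

/-- Priv'IT, as a randomized algorithm on vectors of counts. -/
def privIT : Mechanism n Verdict := fun N =>
  verdictCoin (rejectProb ε α m q N) (rejectProb_nonneg ε α m q N) (rejectProb_le_one ε α m q N)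

end

end PrivIT

end

open MeasureTheory ProbabilityTheory
open scoped ENNReal NNReal Nat

noncomputable section

/-! Privacy. Inserting one element changes one count in the threshold comparison and one term of the
statistic. The first change is traded for a unit shift of one Laplace variable, at the cost of a
factor `exp (c₂ * ε / 2)`. Truncating the noise at τ makes the comparison informative: if it is
passed, then the true count satisfies |Nᵢ - m qᵢ| ≤ 2τ + deviation. On this window the statistic,
whose increment is 4 (Nᵢ - m qᵢ) / (m² α² qᵢ), moves by at most 0.036 ε. Here the second term of B
controls τ ≈ log n / ε, the third controls √(m qᵢ log n), and the first two together control the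
logarithmic remainder. A truncation usually costs an additive δ. Here the fair coin thrown when the
noise is large gives each answer probability at least c₂ / 2 on every dataset, and this floor
absorbs both the noise mass that leaves the window and the additive change of the statistic
(`gateMean_shift_le`, `gateMean_le_exp_mul`). Hence δ = 0.

Accuracy. With Poisson(m) samples the counts are independent Poisson variables, and (Nᵢ - m qᵢ)² -
Nᵢ is an unbiased estimate of m² (pᵢ - qᵢ)². By Cauchy–Schwarz the statistic has mean at least 9/8
if p is far from q; it has mean 0 if p = q. The first term of B makes its variance small against the
squared mean in the first case and absolutely small in the second, so second-moment bounds of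
Chebyshev type suffice. If p = q, Chernoff bounds show moreover that the comparison is rarely
failed. This needs n ≥ 2: for n = 1 the allowed deviation is 0.

Amplification. For exactly m samples and arbitrary errors, each element independently receives one
of R group labels, or none with probability at least 1/2; Priv'IT is run on each group and the
majority decides. One element touches one group only, so privacy is inherited
(`stableUnderInsertion_labelAverage`). The joint law of the group counts is at most three times that
of independent Poisson samples (`sum_option_occurrences_le`): the likelihood ratio is a quotient of
two Poisson masses, both of order 1/√m. The errors are therefore at most 3 (4 / (3√2)) ^ R, and R of
order log (1/β) groups suffice. -/

namespace PrivIT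

/-! ### Occurrence counts -/

section Occurrences

variable {κ : Type*}

/-- The number of indices at which the family `y` takes the value `i`. -/
def occurrences [DecidableEq κ] {A : Type*} [Fintype A] (y : A → κ) (i : κ) : ℕ :=
  (Finset.univ.filter fun a => y a = i).card

theorem occurrences_comp_equiv [DecidableEq κ] {A B : Type*} [Fintype A] [Fintype B]
    (e : A ≃ B) (y : B → κ) :
    occurrences (y ∘ e) = occurrences y := by
  ext i
  unfold occurrences
  rw [← Fintype.card_subtype, ← Fintype.card_subtype]
  exact Fintype.card_congr (e.subtypeEquiv fun a => Iff.rfl)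

theorem prod_comp_eq_prod_pow_occurrences [Fintype κ] [DecidableEq κ] {A M : Type*} [Fintype A]
    [CommMonoid M]
    (P : κ → M) (y : A → κ) : ∏ a, P (y a) = ∏ i, P i ^ occurrences y i := by
  rw [← Finset.prod_fiberwise Finset.univ y]
  refine Finset.prod_congr rfl fun i _ => ?_
  rw [Finset.prod_congr rfl (g := fun _ => P i), Finset.prod_const]
  · rfl
  · intro a ha
    rw [(Finset.mem_filter.mp ha).2]

theorem sum_occurrences [Fintype κ] [DecidableEq κ] {A : Type*} [Fintype A] (y : A → κ) :
    ∑ i, occurrences y i = Fintype.card A := by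
  unfold occurrences
  rw [← Finset.card_eq_sum_card_fiberwise (fun _ _ => Finset.mem_univ _), Finset.card_univ]

theorem occurrences_cons [DecidableEq κ] {m : ℕ} (i : κ) (y : Fin m → κ) :
    occurrences (Fin.cons i y : Fin (m + 1) → κ) = occurrences y + Pi.single i 1 := by
  ext j
  unfold occurrences
  simp only [Finset.card_filter, Fin.sum_univ_succ, Fin.cons_zero, Fin.cons_succ, Pi.add_apply,
    Pi.single_apply]
  rw [add_comm]
  simp [eq_comm]

/-- The induction splits the sequences by their first entry: those beginning with `i` contribute `w
i * m !`, and the `w i` add up to `m + 1`. The product form avoids division of natural numbers. -/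
theorem card_occurrences_mul [Fintype κ] [DecidableEq κ] (m : ℕ) (w : κ → ℕ) (hw : ∑ i, w i = m) :
    (Finset.univ.filter fun y : Fin m → κ => occurrences y = w).card * ∏ i, (w i)! = m ! := by
  induction m generalizing w with
  | zero =>
    have hw0 : w = 0 := by
      ext i
      simpa using (Finset.sum_eq_zero_iff.mp hw) i (Finset.mem_univ i)
    subst hw0
    have : ∀ y : Fin 0 → κ, occurrences y = 0 := fun y => by ext; simp [occurrences]
    simp [this]
  | succ m ih =>
    have key : ∀ i : κ, w i ≠ 0 →
        (Finset.univ.filter fun y : Fin m → κ => occurrences y + Pi.single i 1 = w).card *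
          ∏ i, (w i)! = w i * m ! := by
      intro i hi
      set w' := w - Pi.single i 1 with hw'
      have hww : w = w' + Pi.single i 1 := by
        ext j
        by_cases hj : j = i
        · subst hj
          simp [hw']
          lia
        · simp [hw', hj]
      have hs : ∑ i, w' i = m := by
        have := hw
        rw [hww] at this
        simp [Finset.sum_add_distrib] at this
        exact this
      have h2 := ih w' hs
      have h3 : ∏ j, (w j)! = w i * ∏ j, (w' j)! := by
        rw [← Finset.mul_prod_erase _ _ (Finset.mem_univ i),
          ← Finset.mul_prod_erase _ (fun j => (w' j)!) (Finset.mem_univ i), ← mul_assoc]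
        congr 1
        · have : w i = w' i + 1 := by rw [hww]; simp
          rw [this, Nat.factorial_succ]
        · refine Finset.prod_congr rfl fun j hj => ?_
          have hj := (Finset.mem_erase.mp hj).1
          rw [hww]
          simp [hj]
      have h4 : (Finset.univ.filter fun y : Fin m → κ => occurrences y + Pi.single i 1 = w) =
          (Finset.univ.filter fun y : Fin m → κ => occurrences y = w') := by
        ext y
        simp only [Finset.mem_filter, Finset.mem_univ, true_and]
        rw [hww]
        exact add_left_inj _
      rw [h4, h3, ← h2]
      ring
    have split : (Finset.univ.filter fun y : Fin (m + 1) → κ => occurrences y = w).card =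
        ∑ i, (Finset.univ.filter fun y : Fin m → κ =>
          occurrences y + Pi.single i 1 = w).card := by
      simp only [Finset.card_filter]
      rw [← (Fin.consEquiv fun _ => κ).sum_comp, Fintype.sum_prod_type]
      simp [Fin.consEquiv, occurrences_cons]
    rw [split, Finset.sum_mul]
    calc _ = ∑ i, w i * m ! := by
          refine Finset.sum_congr rfl fun i _ => ?_
          by_cases hi : w i = 0
          · rw [hi, zero_mul]
            refine mul_eq_zero_of_left (Finset.card_eq_zero.mpr ?_) _
            refine Finset.filter_eq_empty_iff.mpr fun y _ h => ?_
            have := congrFun h i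
            simp [hi] at this
          · exact key i hi
      _ = (m + 1)! := by
          rw [← Finset.sum_mul, hw, Nat.factorial_succ]

/-- The law of the occurrence counts of independent samples is multinomial. -/
theorem sum_prod_mul_occurrences [Fintype κ] [DecidableEq κ] (P : κ → ℝ≥0) (m : ℕ)
    (H : (κ → ℕ) → ℝ≥0∞) :
    ∑ y : Fin m → κ, (∏ a, (P (y a) : ℝ≥0∞)) * H (occurrences y) =
      ∑' w : κ → ℕ, if ∑ i, w i = m then
        ((m ! * ∏ i, P i ^ w i / (w i)! : ℝ≥0) : ℝ≥0∞) * H w else 0 := by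
  have h1 : ∀ y : Fin m → κ, (∏ a, (P (y a) : ℝ≥0∞)) * H (occurrences y) =
      ∑' w : κ → ℕ, if occurrences y = w then (∏ i, (P i : ℝ≥0∞) ^ w i) * H w else 0 := by
    intro y
    rw [tsum_eq_single (occurrences y)]
    · rw [if_pos rfl, prod_comp_eq_prod_pow_occurrences fun i => (P i : ℝ≥0∞)]
    · intro w hw
      rw [if_neg hw.symm]
  rw [Finset.sum_congr rfl fun y _ => h1 y,
    ← Summable.tsum_finsetSum fun _ _ => ENNReal.summable]
  refine tsum_congr fun w => ?_
  rw [← Finset.sum_filter, Finset.sum_const, nsmul_eq_mul, ← mul_assoc]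
  split_ifs with hw
  · congr 1
    have h2 := card_occurrences_mul m w hw
    have h3 : ((Finset.univ.filter fun y : Fin m → κ => occurrences y = w).card : ℝ≥0) =
        m ! / ∏ i, ((w i)! : ℝ≥0) := by
      rw [eq_div_iff (by exact Finset.prod_ne_zero_iff.mpr fun i _ => by positivity)]
      exact_mod_cast h2
    rw [← ENNReal.coe_natCast, h3]
    norm_cast
    rw [Finset.prod_div_distrib]
    push_cast
    ring
  · rw [Finset.card_eq_zero.mpr]
    · simp
    · refine Finset.filter_eq_empty_iff.mpr fun y _ h => hw ?_
      rw [← h, sum_occurrences, Fintype.card_fin]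

/-- The joint law of independent Poisson variables with means `r * P i`. -/
def poissonCounts [Fintype κ] (r : ℝ≥0) (P : κ → ℝ≥0) : Measure (κ → ℕ) :=
  Measure.pi fun i => poissonMeasure (r * P i)

instance [Fintype κ] (r : ℝ≥0) (P : κ → ℝ≥0) : IsProbabilityMeasure (poissonCounts r P) := by
  unfold poissonCounts; infer_instance

theorem poissonCounts_singleton [Fintype κ] (r : ℝ≥0) (P : κ → ℝ≥0) (w : κ → ℕ) :
    poissonCounts r P {w} = ENNReal.ofReal (Real.exp (-(r * ∑ i, P i : ℝ≥0)) *
      r ^ (∑ i, w i) * ∏ i, (P i : ℝ) ^ w i / (w i)!) := by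
  rw [poissonCounts, Measure.pi_singleton]
  simp_rw [poissonMeasure_singleton]
  rw [← ENNReal.ofReal_prod_of_nonneg fun i _ => by positivity]
  congr 1
  rw [Finset.mul_sum, NNReal.coe_sum, ← Finset.sum_neg_distrib, Real.exp_sum,
    ← Finset.prod_pow_eq_pow_sum, ← Finset.prod_mul_distrib, ← Finset.prod_mul_distrib]
  refine Finset.prod_congr rfl fun i _ => ?_
  push_cast
  rw [mul_pow]
  ring

theorem lintegral_poissonCounts [Fintype κ] (r : ℝ≥0) (P : κ → ℝ≥0) (H : (κ → ℕ) → ℝ≥0∞) :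
    ∫⁻ w, H w ∂poissonCounts r P = ∑' w, H w * poissonCounts r P {w} :=
  lintegral_countable' _

/-- Poissonization: the counts of a Poisson number of independent samples are independent. -/
theorem tsum_poisson_sum_occurrences [Fintype κ] [DecidableEq κ] (r : ℝ≥0) (P : κ → ℝ≥0)
    (hP : ∑ i, P i = 1)
    (H : (κ → ℕ) → ℝ≥0∞) :
    ∑' K, poissonMeasure r {K} *
        ∑ y : Fin K → κ, (∏ a, (P (y a) : ℝ≥0∞)) * H (occurrences y) =
      ∫⁻ w, H w ∂poissonCounts r P := by
  simp_rw [sum_prod_mul_occurrences, lintegral_poissonCounts, ← ENNReal.tsum_mul_left]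
  rw [ENNReal.tsum_comm]
  refine tsum_congr fun w => ?_
  -- The counts determine the number of samples. Its factorial in the multinomial mass cancels the
  -- one in the Poisson mass.
  rw [tsum_eq_single (∑ i, w i) fun K hK => by rw [if_neg hK.symm, mul_zero], if_pos rfl,
    ← mul_assoc, mul_comm (H w)]
  congr 1
  rw [poissonMeasure_singleton, poissonCounts_singleton, hP, ← ENNReal.ofReal_coe_nnreal,
    ← ENNReal.ofReal_mul (by positivity)]
  congr 1
  push_cast
  field_simp

end Occurrences

/-! ### Comparison of a multinomial law with a Poisson law -/

/-- The ratio of consecutive terms is x / (a + 1), which is at least 1 while a + 1 ≤ x. -/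
theorem pow_div_factorial_le_of_add_le {x : ℝ} (hx : 0 ≤ x) (a d : ℕ) (h : ((a + d : ℕ) : ℝ) ≤ x) :
    x ^ a / a ! ≤ x ^ (a + d) / (a + d)! := by
  induction d with
  | zero => simp
  | succ d ih =>
    refine (ih (le_trans (by push_cast; linarith) h)).trans ?_
    rw [← add_assoc, Nat.factorial_succ, pow_succ, div_le_div_iff₀ (by positivity) (by positivity)]
    push_cast at h ⊢
    have : (0 : ℝ) ≤ x ^ (a + d) * (a + d)! := by positivity
    nlinarith

/-- For fixed a the left side is largest at x = a, where Stirling's lower bound for a! applies. -/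
theorem exp_neg_mul_pow_div_factorial_le_self {x : ℝ} (hx : 0 ≤ x) {a : ℕ} (ha : 1 ≤ a) :
    Real.exp (-x) * x ^ a / a ! ≤ 1 / √(2 * Real.pi * a) := by
  have ha' : (0 : ℝ) < a := by exact_mod_cast ha
  have h1 : (x / a) ^ a ≤ Real.exp (x - a) := by
    have : x / a ≤ Real.exp (x / a - 1) := by linarith [Real.add_one_le_exp (x / a - 1)]
    calc (x / a) ^ a ≤ Real.exp (x / a - 1) ^ a := by gcongr
      _ = Real.exp (x - a) := by
        rw [← Real.exp_nat_mul]
        congr 1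
        field_simp
  have h2 := Stirling.le_factorial_stirling a
  have h3 : Real.exp (-x) * x ^ a ≤ (a / Real.exp 1) ^ a := by
    rw [div_pow, div_le_iff₀ (by positivity)] at h1
    rw [div_pow, le_div_iff₀ (by positivity), ← Real.exp_nat_mul, mul_one]
    calc Real.exp (-x) * x ^ a * Real.exp a
        ≤ Real.exp (-x) * (Real.exp (x - a) * a ^ a) * Real.exp a := by gcongr
      _ = Real.exp (-x + (x - a) + a) * a ^ a := by rw [Real.exp_add, Real.exp_add]; ring
      _ = a ^ a := by rw [show -x + (x - a) + a = 0 by ring, Real.exp_zero, one_mul]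
  rw [div_le_div_iff₀ (by positivity) (by positivity), one_mul]
  calc _ ≤ (a / Real.exp 1) ^ a * √(2 * Real.pi * a) := by gcongr
    _ ≤ _ := by rw [mul_comm]; exact h2

/-- Poisson masses increase up to the mean, so an index below j is dominated by j itself; an index
above j has the even smaller Stirling bound. -/
theorem exp_neg_mul_pow_div_factorial_le {x : ℝ} {j : ℕ} (hj : 1 ≤ j) (hjx : j ≤ x) (a : ℕ) :
    Real.exp (-x) * x ^ a / a ! ≤ 1 / √(2 * Real.pi * j) := by
  have hj' : (0 : ℝ) < j := by exact_mod_cast hj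
  have hx : 0 ≤ x := hj'.le.trans hjx
  rcases le_total j a with h | h
  · refine (exp_neg_mul_pow_div_factorial_le_self hx (hj.trans h)).trans ?_
    gcongr
  · refine le_trans ?_ (exp_neg_mul_pow_div_factorial_le_self hx hj)
    obtain ⟨d, rfl⟩ := Nat.exists_eq_add_of_le h
    rw [mul_div_assoc, mul_div_assoc]
    exact mul_le_mul_of_nonneg_left (pow_div_factorial_le_of_add_le hx a d hjx) (Real.exp_pos _).le

/-- The Stirling sequence decreases, so it is bounded by its first value e / √2. -/
theorem factorial_mul_exp_div_pow_le {m : ℕ} (hm : 1 ≤ m) :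
    m ! * Real.exp m / m ^ m ≤ Real.exp 1 * √m := by
  have hm' : (0 : ℝ) < m := by exact_mod_cast hm
  have h := Stirling.stirlingSeq'_antitone (Nat.zero_le (m - 1))
  simp only [Function.comp, Nat.succ_eq_add_one, Nat.sub_add_cancel hm, zero_add,
    Stirling.stirlingSeq, Nat.cast_one, mul_one, pow_one, Nat.factorial_one] at h
  rw [div_pow, ← Real.exp_nat_mul, mul_one, Real.sqrt_mul (by norm_num)] at h
  rw [div_le_div_iff₀ (by positivity) (by positivity)] at h
  rw [div_le_iff₀ (by positivity)]
  have := mul_le_mul_of_nonneg_right h (Real.exp_pos m).le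
  field_simp at this
  linarith

/-- The ratio to be bounded is P[Poisson(mt) = a] / P[Poisson(m) = m]. The numerator is O(1/√m)
because mt ≥ m/2, and the denominator is at least 1/(e√m). -/
theorem factorial_mul_pow_div_factorial_le {m a s : ℕ} (hm : 2 ≤ m) (has : a + s = m) {t : ℝ}
    (ht : 1 / 2 ≤ t) :
    m ! * t ^ a / a ! ≤ 3 * (Real.exp (-(m * (1 - t))) * m ^ s) := by
  have hm' : (2 : ℝ) ≤ m := by exact_mod_cast hm
  have hx : 1 ≤ m * t := by nlinarith
  have hj : 1 ≤ ⌊m * t⌋₊ := Nat.le_floor (by simpa using hx)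
  have hj' : (1 : ℝ) ≤ ⌊m * t⌋₊ := by exact_mod_cast hj
  have h1 := exp_neg_mul_pow_div_factorial_le hj (Nat.floor_le (by linarith)) a
  have h2 := factorial_mul_exp_div_pow_le (show 1 ≤ m by lia)
  -- Rounding down a number that is at least 1 loses at most a factor of two.
  have h3 : (m : ℝ) / 4 ≤ ⌊m * t⌋₊ := by
    have := Nat.lt_floor_add_one (m * t)
    nlinarith
  -- The number (49/40)² is a rational square slightly below π/2 = 2π/4.
  have h4 : 1 / √(2 * Real.pi * ⌊m * t⌋₊) ≤ 1 / √((49 / 50) * (49 / 50) * (25 / 16) * m) := by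
    gcongr 1 / √?_
    nlinarith [Real.pi_gt_d2]
  have h5 : √((49 / 50) * (49 / 50) * (25 / 16) * m) = 49 / 40 * √m := by
    rw [Real.sqrt_mul (by norm_num), show (49 / 50 : ℝ) * (49 / 50) * (25 / 16) = (49 / 40) ^ 2 by
      norm_num, Real.sqrt_sq (by norm_num)]
  rw [h5] at h4
  have hs : 0 < √(m : ℝ) := by positivity
  have h6 := mul_le_mul h2 (h1.trans h4) (by positivity) (by positivity)
  have h7 : Real.exp 1 * √m * (1 / (49 / 40 * √m)) ≤ 3 := by
    rw [mul_one_div, div_le_iff₀ (by positivity)]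
    nlinarith [Real.exp_one_lt_d9]
  have h8 := h6.trans h7
  have h9 : m ! * t ^ a / a ! = (m ! * Real.exp m / m ^ m *
      (Real.exp (-(m * t)) * (m * t) ^ a / a !)) * (Real.exp (-(m * (1 - t))) * m ^ s) := by
    have e1 : Real.exp m * Real.exp (-(m * t)) * Real.exp (-(m * (1 - t))) = 1 := by
      rw [← Real.exp_add, ← Real.exp_add,
        show (m : ℝ) + -(m * t) + -(m * (1 - t)) = 0 by ring, Real.exp_zero]
    have e2 : (m : ℝ) ^ m = m ^ a * m ^ s := by rw [← pow_add, has]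
    calc m ! * t ^ a / a ! = m ! * t ^ a / a ! *
          (Real.exp m * Real.exp (-(m * t)) * Real.exp (-(m * (1 - t)))) := by rw [e1, mul_one]
      _ = _ := by
        rw [e2, mul_pow]
        field_simp
  rw [h9]
  gcongr

/-- The weights on `Option κ` that extend `P` by the weight `t` of `none`. -/
def extendWeights {κ : Type*} (t : ℝ≥0) (P : κ → ℝ≥0) : Option κ → ℝ≥0 :=
  fun o => o.elim t P

/-- If at most half of the samples are used on average, then the law of the counts of the used
samples is dominated by a multiple of the law of independent Poisson counts. -/
theorem sum_option_occurrences_le {κ : Type*} [Fintype κ] [DecidableEq κ] {m : ℕ} (hm : 2 ≤ m)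
    (t : ℝ≥0) (P : κ → ℝ≥0) (hP : t + ∑ i, P i = 1) (ht : 1 / 2 ≤ t) (H : (κ → ℕ) → ℝ≥0∞) :
    ∑ y : Fin m → Option κ, (∏ a, (extendWeights t P (y a) : ℝ≥0∞)) *
        H (fun i => occurrences y (some i)) ≤
      3 * ∫⁻ w, H w ∂poissonCounts m P := by
  rw [sum_prod_mul_occurrences (extendWeights t P) m fun w => H fun i => w (some i),
    lintegral_poissonCounts, ← ENNReal.tsum_mul_left,
    ← (Equiv.piOptionEquivProd (β := fun _ : Option κ => ℕ)).symm.tsum_eq]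
  simp only [Fintype.sum_option, Fintype.prod_option]
  rw [ENNReal.tsum_prod', ENNReal.tsum_comm]
  refine ENNReal.tsum_le_tsum fun v => ?_
  calc _ ≤ ∑' a : ℕ, if a + ∑ i, v i = m then 3 * (H v * poissonCounts m P {v}) else 0 := by
        refine ENNReal.tsum_le_tsum fun a => ?_
        change (if a + ∑ i, v i = m then
          ((m ! * (t ^ a / a ! * ∏ i, P i ^ v i / (v i)!) : ℝ≥0) : ℝ≥0∞) * H v else 0) ≤ _
        by_cases h1 : a + ∑ i, v i = m
        · rw [if_pos h1, if_pos h1, mul_comm _ (H v), mul_left_comm 3]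
          gcongr
          rw [poissonCounts_singleton, ← ENNReal.ofReal_coe_nnreal,
            show (3 : ℝ≥0∞) = ENNReal.ofReal 3 by simp, ← ENNReal.ofReal_mul (by norm_num)]
          refine ENNReal.ofReal_le_ofReal ?_
          have h3 := factorial_mul_pow_div_factorial_le hm h1 (t := t) (by exact_mod_cast ht)
          have h4 : (∑ i, P i : ℝ) = 1 - t := by
            have := congrArg (fun x : ℝ≥0 => (x : ℝ)) hP
            push_cast at this
            linarith
          push_cast
          rw [h4]
          have h5 : (0 : ℝ) ≤ ∏ i, (P i : ℝ) ^ v i / (v i)! := by positivity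
          have := mul_le_mul_of_nonneg_right h3 h5
          calc _ = (m ! * (t : ℝ) ^ a / a !) * ∏ i, (P i : ℝ) ^ v i / (v i)! := by ring
            _ ≤ _ := this
            _ = _ := by ring
        · rw [if_neg h1, if_neg h1]
    -- The number of unused samples is determined by `v`. If `v` has more than `m` elements, the
    -- truncated subtraction is harmless, as the left side vanishes.
    _ ≤ ∑' a : ℕ, if a = m - ∑ i, v i then 3 * (H v * poissonCounts m P {v}) else 0 := by
        refine ENNReal.tsum_le_tsum fun a => ?_
        split_ifs with h1 h2
        · exact le_rfl
        · exact absurd (by lia) h2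
        · positivity
        · exact le_rfl
    _ = _ := by rw [tsum_ite_eq]

/-! ### The Laplace distribution -/

theorem isProbabilityMeasure_laplace {b : ℝ} (hb : 0 < b) : IsProbabilityMeasure (laplace b) :=
  ⟨laplace_univ hb⟩

/-- The Laplace density. -/
def laplaceDensity (b x : ℝ) : ℝ := Real.exp (-|x| / b) / (2 * b)

theorem measurable_laplaceDensity (b : ℝ) : Measurable (laplaceDensity b) := by
  unfold laplaceDensity; fun_prop

theorem lintegral_laplace (b : ℝ) (f : ℝ → ℝ≥0∞) (hf : Measurable f) :
    ∫⁻ x, f x ∂laplace b = ∫⁻ x, ENNReal.ofReal (laplaceDensity b x) * f x := by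
  rw [laplace, lintegral_withDensity_eq_lintegral_mul₀]
  · rfl
  · exact (measurable_laplaceDensity b).ennreal_ofReal.aemeasurable
  · exact hf.aemeasurable

theorem laplaceDensity_sub_le {b : ℝ} (hb : 0 < b) {s : ℝ} (hs : |s| ≤ 1) (x : ℝ) :
    laplaceDensity b (x - s) ≤ Real.exp (1 / b) * laplaceDensity b x := by
  unfold laplaceDensity
  rw [← mul_div_assoc, ← Real.exp_add, ← add_div]
  gcongr
  linarith [abs_sub_abs_le_abs_sub x (x - s), sub_sub_cancel x s ▸ abs_sub_abs_le_abs_sub x (x - s)]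

theorem laplace_tail {b : ℝ} (hb : 0 < b) {τ : ℝ} (hτ : 0 ≤ τ) :
    laplace b {x | τ ≤ |x|} = ENNReal.ofReal (Real.exp (-τ / b)) := by
  have hm : MeasurableSet {x : ℝ | τ ≤ |x|} := measurableSet_le measurable_const (by fun_prop)
  have e : ∫ x in Set.Ioi τ, Real.exp (-x / b) = b * Real.exp (-τ / b) := by
    have := integral_exp_mul_Ioi (a := -(1 / b)) (by simpa using hb) τ
    rw [show (fun x : ℝ => Real.exp (-x / b)) = fun x => Real.exp (-(1 / b) * x) by
      ext x; congr 1; field_simp, this]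
    field_simp
  have h1 : ∫ x : ℝ, {x | τ ≤ |x|}.indicator (laplaceDensity b) x = Real.exp (-τ / b) := by
    have h2 : ({x | τ ≤ |x|}.indicator (laplaceDensity b)) =
        fun x => (fun t => (Set.Ici τ).indicator (fun t => Real.exp (-t / b) / (2 * b)) t) |x| := by
      ext x
      simp [Set.indicator_apply, laplaceDensity]
    rw [h2, integral_comp_abs, setIntegral_indicator measurableSet_Ici]
    have h3 : ∫ x in Set.Ioi 0 ∩ Set.Ici τ, Real.exp (-x / b) / (2 * b) =
        ∫ x in Set.Ioi τ, Real.exp (-x / b) / (2 * b) := by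
      refine setIntegral_congr_set ?_
      rcases hτ.eq_or_lt with rfl | h
      · rw [Set.inter_eq_left.mpr Set.Ioi_subset_Ici_self]
        exact Filter.EventuallyEq.rfl
      · rw [Set.inter_eq_right.mpr (Set.Ici_subset_Ioi.mpr h)]
        exact Ioi_ae_eq_Ici.symm
    rw [h3, integral_div, e]
    field_simp
  rw [laplace, withDensity_apply _ hm, ← h1, ← lintegral_indicator hm,
    ofReal_integral_eq_lintegral_ofReal]
  · refine lintegral_congr fun x => ?_
    by_cases hx : τ ≤ |x| <;> simp [hx, laplaceDensity]
  · exact Integrable.of_integral_ne_zero (by rw [h1]; exact (Real.exp_pos _).ne')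
  · refine Filter.Eventually.of_forall fun x => Set.indicator_nonneg (fun x _ => ?_) x
    unfold laplaceDensity
    positivity

/-- For either sign, exp (a x) with a = ±1/b dominates exp (-|x|/b) and has an explicit integral.
The two signs serve the two edges of the truncation window. -/
theorem laplace_Icc_le {b : ℝ} (hb : 0 < b) {a : ℝ} (ha : a ≠ 0) (hab : |a| = 1 / b) (u : ℝ) :
    laplace b (Set.Icc u (u + 1)) ≤
      ENNReal.ofReal ((Real.exp (a * (u + 1)) - Real.exp (a * u)) / (2 * b * a)) := by
  have hd : ∀ x, HasDerivAt (fun x => Real.exp (a * x) / (2 * b * a))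
      (Real.exp (a * x) / (2 * b)) x := by
    intro x
    have h : HasDerivAt (fun x => a * x) a x := by simpa using (hasDerivAt_id x).const_mul a
    exact (h.exp.div_const _).congr_deriv (by field_simp)
  have hc : Continuous fun x => Real.exp (a * x) / (2 * b) := by fun_prop
  have h1 := intervalIntegral.integral_eq_sub_of_hasDerivAt (a := u) (b := u + 1)
    (fun x _ => hd x) (hc.intervalIntegrable _ _)
  rw [sub_div, ← h1, intervalIntegral.integral_of_le (by linarith),
    ← integral_Icc_eq_integral_Ioc, laplace, withDensity_apply _ measurableSet_Icc,
    ofReal_integral_eq_lintegral_ofReal (hc.integrableOn_Icc)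
      (Filter.Eventually.of_forall fun x => by positivity)]
  refine lintegral_mono fun x => ENNReal.ofReal_le_ofReal ?_
  gcongr
  have : a * x ≥ -|a * x| := neg_abs_le _
  rw [abs_mul, hab] at this
  calc -|x| / b = -(1 / b * |x|) := by ring
    _ ≤ _ := this

/-- Noise values that stay in the window after the shift are handled by the ratio of densities.
Those that leave it lie in an interval of length 1 at one edge; there `k` is bounded by 1, and the
additive term is the bound for the mass of that interval. -/
theorem lintegral_truncated_laplace_shift_le {b : ℝ} (hb : 0 < b) (τ : ℝ) {s : ℝ} (hs : |s| ≤ 1)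
    (k : ℝ → ℝ≥0∞) (hk : Measurable k) (hk1 : ∀ x, k x ≤ 1) :
    ∫⁻ x, {x : ℝ | |x| < τ}.indicator (fun x => k (x + s)) x ∂laplace b ≤
      ENNReal.ofReal (Real.exp (1 / b)) * ∫⁻ x, {x : ℝ | |x| < τ}.indicator k x ∂laplace b +
        ENNReal.ofReal (Real.exp (-τ / b) * (Real.exp (1 / b) - 1) / 2) := by
  set I : Set ℝ := {x : ℝ | |x| < τ} with hI
  have hIm : MeasurableSet I := measurableSet_lt (by fun_prop) measurable_const
  have hIm' : MeasurableSet {x : ℝ | x + s ∉ I} := (hIm.compl).preimage (by fun_prop)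
  have hkm : Measurable (I.indicator k) := hk.indicator hIm
  have hkms : Measurable fun x => I.indicator k (x + s) := hkm.comp (measurable_id.add_const s)
  have h1 : ∀ x, I.indicator (fun x => k (x + s)) x ≤
      I.indicator k (x + s) + (I ∩ {x | x + s ∉ I}).indicator 1 x := by
    intro x
    by_cases hx : x ∈ I
    · by_cases hx' : x + s ∈ I
      · simp [hx, hx']
      · simp [hx, hx', hk1]
    · simp [hx]
  have h2 : ∫⁻ x, I.indicator k (x + s) ∂laplace b ≤
      ENNReal.ofReal (Real.exp (1 / b)) * ∫⁻ x, I.indicator k x ∂laplace b := by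
    have hdk : Measurable fun x => ENNReal.ofReal (laplaceDensity b x) * I.indicator k x :=
      (measurable_laplaceDensity b).ennreal_ofReal.mul hkm
    rw [lintegral_laplace b _ hkms,
      lintegral_laplace b _ hkm, ← lintegral_const_mul _ hdk,
      ← lintegral_sub_right_eq_self _ s]
    refine lintegral_mono fun x => ?_
    simp only [sub_add_cancel, ← mul_assoc]
    gcongr
    rw [← ENNReal.ofReal_mul (Real.exp_pos _).le]
    exact ENNReal.ofReal_le_ofReal (laplaceDensity_sub_le hb hs x)
  have h3 : laplace b (I ∩ {x | x + s ∉ I}) ≤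
      ENNReal.ofReal (Real.exp (-τ / b) * (Real.exp (1 / b) - 1) / 2) := by
    rw [abs_le] at hs
    rcases le_total 0 s with h | h
    · refine (measure_mono ?_).trans ((laplace_Icc_le hb (a := -(1 / b)) (by simpa using hb.ne')
        (by rw [abs_neg, abs_of_pos (by positivity)]) (τ - 1)).trans_eq ?_)
      · rintro x ⟨hx, hx'⟩
        simp only [hI, Set.mem_ofPred_eq, abs_lt, not_and, not_lt] at hx hx'
        exact ⟨by linarith [hx' (by linarith [hx.1])], by linarith [hx.2]⟩
      · congr 1
        rw [show -(1 / b) * (τ - 1 + 1) = -τ / b by ring,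
          show -(1 / b) * (τ - 1) = -τ / b + 1 / b by ring, Real.exp_add]
        field_simp
        ring
    · refine (measure_mono ?_).trans ((laplace_Icc_le hb (a := 1 / b) (by simpa using hb.ne')
        (by rw [abs_of_pos (by positivity)]) (-τ)).trans_eq ?_)
      · rintro x ⟨hx, hx'⟩
        simp only [hI, Set.mem_ofPred_eq, abs_lt, not_and', not_lt] at hx hx'
        have := hx' (by linarith [hx.2])
        exact ⟨by linarith [hx.1], by linarith⟩
      · congr 1
        rw [show 1 / b * (-τ + 1) = -τ / b + 1 / b by ring,
          show 1 / b * -τ = -τ / b by ring, Real.exp_add]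
        field_simp
  calc _ ≤ ∫⁻ x, (I.indicator k (x + s) + (I ∩ {x | x + s ∉ I}).indicator 1 x) ∂laplace b :=
        lintegral_mono h1
    _ = ∫⁻ x, I.indicator k (x + s) ∂laplace b + laplace b (I ∩ {x | x + s ∉ I}) := by
        rw [lintegral_add_left hkms,
          lintegral_indicator_one (hIm.inter hIm')]
    _ ≤ _ := add_le_add h2 h3

/-! ### Vectors of independent Laplace variables -/

section Noise

variable {ι : Type*} [Fintype ι]

/-- The noise vectors all of whose entries have absolute value below `τ`. -/
def smallNoise (τ : ℝ) : Set (ι → ℝ) := {y | ∀ i, |y i| < τ}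

theorem measurableSet_smallNoise (τ : ℝ) : MeasurableSet (smallNoise τ : Set (ι → ℝ)) := by
  rw [smallNoise, Set.ofPred_forall]
  exact MeasurableSet.iInter fun i => measurableSet_lt (by fun_prop) measurable_const

theorem pi_laplace_smallNoise {b : ℝ} (hb : 0 < b) {τ : ℝ} (hτ : 0 ≤ τ) :
    Measure.pi (fun _ : ι => laplace b) (smallNoise τ) =
      ENNReal.ofReal ((1 - Real.exp (-τ / b)) ^ Fintype.card ι) := by
  have := isProbabilityMeasure_laplace hb
  have h0 : Real.exp (-τ / b) ≤ 1 :=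
    Real.exp_le_one_iff.mpr (div_nonpos_of_nonpos_of_nonneg (by linarith) hb.le)
  have h1 : (smallNoise τ : Set (ι → ℝ)) = Set.univ.pi fun _ => {x | τ ≤ |x|}ᶜ := by
    ext y
    simp [smallNoise]
  rw [h1, Measure.pi_pi, Finset.prod_const, Finset.card_univ,
    prob_compl_eq_one_sub (measurableSet_le measurable_const (by fun_prop)), laplace_tail hb hτ,
    ENNReal.ofReal_pow (by linarith), ENNReal.ofReal_sub _ (Real.exp_pos _).le, ENNReal.ofReal_one]

/-- Integrate over the coordinate `i` first. Either the other coordinates are all small and the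
one-dimensional estimate applies, or the integrand on the left vanishes. -/
theorem lintegral_smallNoise_shift_le [DecidableEq ι] {b : ℝ} (hb : 0 < b) (τ : ℝ) {s : ℝ}
    (hs : |s| ≤ 1) (i : ι) (F : (ι → ℝ) → ℝ≥0∞) (hF : Measurable F) (hF1 : ∀ x, F x ≤ 1) :
    ∫⁻ y, (smallNoise τ).indicator (fun y => F (y + Pi.single i s)) y
        ∂Measure.pi (fun _ => laplace b) ≤
      ENNReal.ofReal (Real.exp (1 / b)) *
          ∫⁻ y, (smallNoise τ).indicator F y ∂Measure.pi (fun _ => laplace b) +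
        ENNReal.ofReal (Real.exp (-τ / b) * (Real.exp (1 / b) - 1) / 2) := by
  have := isProbabilityMeasure_laplace hb
  have hG := measurableSet_smallNoise (ι := ι) τ
  have hFs : Measurable fun y : ι → ℝ => F (y + Pi.single i s) :=
    hF.comp (measurable_id.add_const _)
  set C := ENNReal.ofReal (Real.exp (1 / b)) with hC
  set c := ENNReal.ofReal (Real.exp (-τ / b) * (Real.exp (1 / b) - 1) / 2) with hc
  calc _ ≤ ∫⁻ y, (C * (smallNoise τ).indicator F y + c) ∂Measure.pi (fun _ => laplace b) := by
        refine lintegral_le_of_lmarginal_le {i} (hFs.indicator hG)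
          (((hF.indicator hG).const_mul C).add_const c) fun x => ?_
        rw [lmarginal_singleton, lmarginal_singleton]
        have hupd : ∀ t, Function.update x i t ∈ (smallNoise τ : Set (ι → ℝ)) ↔
            (∀ j, j ≠ i → |x j| < τ) ∧ |t| < τ := by
          intro t
          constructor
          · intro h
            refine ⟨fun j hj => ?_, ?_⟩
            · simpa [hj] using h j
            · simpa using h i
          · rintro ⟨h, ht⟩ j
            by_cases hj : j = i
            · subst hj; simpa using ht
            · simpa [hj] using h j hj
        have hadd : ∀ t, Function.update x i t + Pi.single i s = Function.update x i (t + s) := by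
          intro t
          ext j
          by_cases hj : j = i
          · subst hj; simp
          · simp [hj]
        by_cases hx : ∀ j, j ≠ i → |x j| < τ
        · set k : ℝ → ℝ≥0∞ := fun t => F (Function.update x i t) with hk
          have hkm : Measurable k := hF.comp (measurable_update x)
          have e1 : ∀ t, (smallNoise τ).indicator (fun y => F (y + Pi.single i s))
              (Function.update x i t) = {x : ℝ | |x| < τ}.indicator (fun t => k (t + s)) t := by
            intro t
            by_cases ht : t ∈ {x : ℝ | |x| < τ}
            · rw [Set.indicator_of_mem ((hupd t).mpr ⟨hx, ht⟩), Set.indicator_of_mem ht, hadd]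
            · rw [Set.indicator_of_notMem fun h => ht ((hupd t).mp h).2,
                Set.indicator_of_notMem ht]
          have e2 : ∀ t, (smallNoise τ).indicator F (Function.update x i t) =
              {x : ℝ | |x| < τ}.indicator k t := by
            intro t
            by_cases ht : t ∈ {x : ℝ | |x| < τ}
            · rw [Set.indicator_of_mem ((hupd t).mpr ⟨hx, ht⟩), Set.indicator_of_mem ht]
            · rw [Set.indicator_of_notMem fun h => ht ((hupd t).mp h).2,
                Set.indicator_of_notMem ht]
          simp_rw [e1, e2]
          have hIm : MeasurableSet {x : ℝ | |x| < τ} :=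
            measurableSet_lt (by fun_prop) measurable_const
          rw [lintegral_add_right _ measurable_const, lintegral_const, measure_univ, mul_one,
            lintegral_const_mul _ (hkm.indicator hIm)]
          exact lintegral_truncated_laplace_shift_le hb τ hs k hkm fun t => hF1 _
        · have e1 : ∀ t, (smallNoise τ).indicator (fun y => F (y + Pi.single i s))
              (Function.update x i t) = 0 := fun t =>
            Set.indicator_of_notMem (fun h => hx ((hupd t).mp h).1) _
          simp_rw [e1]
          simp
    _ = _ := by
        rw [lintegral_add_right _ measurable_const, lintegral_const, measure_univ, mul_one,
          lintegral_const_mul _ (hF.indicator hG)]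

end Noise

/-! ### Differential privacy of a randomized verdict -/

/-- The value of `f` changes by a factor of at most `exp ε` when one element is inserted. -/
def StableUnderInsertion {n : ℕ} (ε : ℝ) (f : (Fin n → ℕ) → ℝ) : Prop :=
  ∀ (D : Fin n → ℕ) (i : Fin n), f (D + Pi.single i 1) ≤ Real.exp ε * f D ∧
    f D ≤ Real.exp ε * f (D + Pi.single i 1)

theorem exists_insertion_of_neighbours {n : ℕ} {D D' : Fin n → ℕ}
    (h : ∑ i, |(D i : ℤ) - (D' i : ℤ)| ≤ 1) :
    D = D' ∨ ∃ i, D = D' + Pi.single i 1 ∨ D' = D + Pi.single i 1 := by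
  by_cases hD : D = D'
  · exact Or.inl hD
  · right
    obtain ⟨i, hi⟩ := Function.ne_iff.mp hD
    have h1 : ∀ j, j ≠ i → D j = D' j := by
      intro j hj
      have h2 : |(D i : ℤ) - D' i| + |(D j : ℤ) - D' j| ≤ 1 := by
        refine le_trans ?_ h
        rw [← Finset.sum_pair (f := fun i => |(D i : ℤ) - D' i|) hj.symm]
        exact Finset.sum_le_sum_of_subset_of_nonneg (Finset.subset_univ _)
          fun _ _ _ => abs_nonneg _
      have h3 : 1 ≤ |(D i : ℤ) - D' i| := Int.one_le_abs (by lia)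
      have h4 : |(D j : ℤ) - D' j| = 0 := le_antisymm (by linarith) (abs_nonneg _)
      have := abs_eq_zero.mp h4
      lia
    have h5 : |(D i : ℤ) - D' i| ≤ 1 :=
      (Finset.single_le_sum (f := fun i => |(D i : ℤ) - D' i|) (fun _ _ => abs_nonneg _)
        (Finset.mem_univ i)).trans h
    refine ⟨i, ?_⟩
    rw [abs_le] at h5
    rcases lt_or_gt_of_ne hi with h6 | h6
    · right
      ext j
      by_cases hj : j = i
      · subst hj; simp; lia
      · simp [hj, h1 j hj]
    · left
      ext j
      by_cases hj : j = i
      · subst hj; simp; lia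
      · simp [hj, h1 j hj]

/-- For `δ = 0` the inequality on single outputs sums to all sets of outputs; hence one condition
for each of the two verdicts. -/
theorem differentiallyPrivate_verdictCoin {n : ℕ} {ε : ℝ} (hε : 0 ≤ ε) (f : (Fin n → ℕ) → ℝ)
    (h0 : ∀ D, 0 ≤ f D) (h1 : ∀ D, f D ≤ 1) (hf : StableUnderInsertion ε f)
    (hf' : StableUnderInsertion ε fun D => 1 - f D) :
    DifferentiallyPrivate (fun D => verdictCoin (f D) (h0 D) (h1 D)) ε 0 := by
  intro D D' hDD' S
  have he : 1 ≤ Real.exp ε := Real.one_le_exp hε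
  have key : f D ≤ Real.exp ε * f D' ∧ 1 - f D ≤ Real.exp ε * (1 - f D') := by
    rcases exists_insertion_of_neighbours hDD' with rfl | ⟨i, rfl | rfl⟩
    · constructor <;> nlinarith [h0 D, h1 D]
    · exact ⟨(hf D' i).1, (hf' D' i).1⟩
    · exact ⟨(hf D i).2, (hf' D i).2⟩
  rw [PMF.toOuterMeasure_apply_fintype, PMF.toOuterMeasure_apply_fintype, ENNReal.ofReal_zero,
    add_zero, Finset.mul_sum]
  refine Finset.sum_le_sum fun v _ => ?_
  by_cases hv : v ∈ S
  · rw [Set.indicator_of_mem hv, Set.indicator_of_mem hv]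
    cases v
    · change ENNReal.ofReal (1 - f D) ≤ _ * ENNReal.ofReal (1 - f D')
      rw [← ENNReal.ofReal_mul (Real.exp_pos _).le]
      exact ENNReal.ofReal_le_ofReal key.2
    · change ENNReal.ofReal (f D) ≤ _ * ENNReal.ofReal (f D')
      rw [← ENNReal.ofReal_mul (Real.exp_pos _).le]
      exact ENNReal.ofReal_le_ofReal key.1
  · simp [hv]

/-! ### Privacy of the noisy thresholds of Priv'IT -/

theorem sum_toReal_pmf {n : ℕ} (q : PMF (Fin n)) : ∑ i, (q i).toReal = 1 := by
  rw [← ENNReal.toReal_sum fun i _ => q.apply_ne_top i, ← tsum_fintype (L := .unconditional _),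
    q.tsum_coe, ENNReal.toReal_one]

section

variable {n : ℕ} {ε α : ℝ} {m : ℕ} {q : PMF (Fin n)}

theorem pos_of_pmf (q : PMF (Fin n)) : 0 < n := by
  obtain ⟨i, _⟩ := q.support_nonempty
  exact i.pos

theorem heavy_nonempty (q : PMF (Fin n)) (hα : α ≤ 1) : (heavy α q).Nonempty := by
  by_contra h
  rw [Finset.not_nonempty_iff_eq_empty, heavy, Finset.filter_eq_empty_iff] at h
  have hn := pos_of_pmf q
  have hn' : (0 : ℝ) < n := by exact_mod_cast hn
  have h1 : ∑ i, (q i).toReal ≤ ∑ _i : Fin n, c₁ * α / n :=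
    Finset.sum_le_sum fun i hi => (not_le.mp (h hi)).le
  rw [sum_toReal_pmf, Finset.sum_const, Finset.card_univ, Fintype.card_fin, nsmul_eq_mul,
    mul_div_cancel₀ _ hn'.ne', c₁] at h1
  linarith

theorem le_of_mem_heavy {i : Fin n} (hi : i ∈ heavy α q) : α / (4 * n) ≤ (q i).toReal := by
  refine le_trans (le_of_eq ?_) (Finset.mem_filter.mp hi).2
  rw [c₁]
  ring

theorem pos_of_mem_heavy (hα : 0 < α) {i : Fin n} (hi : i ∈ heavy α q) : 0 < (q i).toReal := by
  have hn' : (0 : ℝ) < n := by exact_mod_cast i.pos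
  exact lt_of_lt_of_le (by positivity) (le_of_mem_heavy hi)

theorem noiseScale_pos (hε : 0 < ε) : 0 < 2 / (c₂ * ε) := by
  unfold c₂; positivity

theorem one_div_noiseScale : 1 / (2 / (c₂ * ε)) = c₂ * ε / 2 := by
  rw [one_div_div]

/-- This is the probability that one noise variable exceeds the threshold, tuned so that all of them
stay below it with probability exactly 1 - c₂. -/
theorem exp_neg_noiseThreshold (q : PMF (Fin n)) (hε : 0 < ε) (hα : α ≤ 1) :
    Real.exp (-noiseThreshold ε α q / (2 / (c₂ * ε))) =
      1 - (1 - c₂) ^ (1 / ((heavy α q).card : ℝ)) := by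
  have hk : (0 : ℝ) < (heavy α q).card := by exact_mod_cast (heavy_nonempty q hα).card_pos
  have h1 : (1 - c₂) ^ (1 / ((heavy α q).card : ℝ)) < 1 :=
    Real.rpow_lt_one (by norm_num [c₂]) (by norm_num [c₂]) (by positivity)
  rw [noiseThreshold, neg_div, mul_div_cancel_left₀ _ (noiseScale_pos hε).ne', one_div,
    Real.log_inv, neg_neg, Real.exp_log (by linarith)]

/-- It lets the coin, of mass c₂, pay for the noise mass lost at an edge of the window. -/
theorem exp_neg_noiseThreshold_le (q : PMF (Fin n)) (hε : 0 < ε) (hα : α ≤ 1) :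
    Real.exp (-noiseThreshold ε α q / (2 / (c₂ * ε))) ≤ c₂ := by
  rw [exp_neg_noiseThreshold q hε hα]
  have hk : (1 : ℝ) ≤ (heavy α q).card := by
    exact_mod_cast (heavy_nonempty q hα).card_pos
  have h1 := Real.rpow_le_rpow_of_exponent_ge (x := 1 - c₂) (by norm_num [c₂]) (by norm_num [c₂])
    (div_le_one_of_le₀ hk (by positivity))
  rw [Real.rpow_one] at h1
  linarith

theorem noiseThreshold_nonneg (q : PMF (Fin n)) (hε : 0 < ε) (hα : α ≤ 1) :
    0 ≤ noiseThreshold ε α q := by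
  have h1 := exp_neg_noiseThreshold_le q hε hα
  by_contra h
  have : 0 ≤ -noiseThreshold ε α q / (2 / (c₂ * ε)) :=
    div_nonneg (by linarith) (noiseScale_pos hε).le
  have h2 := (Real.one_le_exp this).trans h1
  norm_num [c₂] at h2

/-- Bernoulli's inequality bounds the tail probability below by c₂ / n. The constant is 80 = 3 ·
2/c₂, where 3 bounds log (1/c₂). -/
theorem noiseThreshold_le (q : PMF (Fin n)) (hε : 0 < ε) (hα : α ≤ 1) :
    noiseThreshold ε α q ≤ 80 * (1 + Real.log n) / ε := by
  have hn' : (1 : ℝ) ≤ n := by exact_mod_cast pos_of_pmf q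
  have hk : (1 : ℝ) ≤ (heavy α q).card := by
    exact_mod_cast (heavy_nonempty q hα).card_pos
  have hkn : ((heavy α q).card : ℝ) ≤ n := by
    exact_mod_cast (Finset.card_le_univ _).trans_eq (Fintype.card_fin n)
  have h0 := Real.log_nonneg hn'
  have h1 : c₂ / n ≤ Real.exp (-noiseThreshold ε α q / (2 / (c₂ * ε))) := by
    rw [exp_neg_noiseThreshold q hε hα]
    have := rpow_one_add_le_one_add_mul_self (s := -c₂) (by norm_num [c₂])
      (p := 1 / ((heavy α q).card : ℝ)) (by positivity) (div_le_one_of_le₀ hk (by positivity))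
    rw [← sub_eq_add_neg] at this
    have h2 : c₂ / n ≤ 1 / ((heavy α q).card : ℝ) * c₂ := by
      rw [one_div_mul_eq_div]
      gcongr
      norm_num [c₂]
    linarith
  have h2 : Real.log (c₂ / n) ≤ -noiseThreshold ε α q / (2 / (c₂ * ε)) :=
    (Real.log_le_iff_le_exp (by unfold c₂; positivity)).mpr h1
  rw [Real.log_div (by norm_num [c₂]) (by positivity), neg_div] at h2
  have h3 : -3 ≤ Real.log c₂ := by
    rw [Real.le_log_iff_exp_le (by norm_num [c₂]), Real.exp_neg, inv_le_comm₀ (Real.exp_pos _)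
      (by norm_num [c₂]), show (3 : ℝ) = ((3 : ℕ) : ℝ) * 1 by norm_num, Real.exp_nat_mul]
    calc (c₂)⁻¹ ≤ (2.7 : ℝ) ^ 3 := by norm_num [c₂]
      _ ≤ _ := by
        gcongr
        linarith [Real.exp_one_gt_d9]
  have h4 : noiseThreshold ε α q / (2 / (c₂ * ε)) ≤ 3 * (1 + Real.log n) := by linarith
  rw [div_le_iff₀ (noiseScale_pos hε)] at h4
  refine h4.trans (le_of_eq ?_)
  rw [c₂]
  field_simp
  norm_num

/-- The law of the noise vector. -/
def noiseLaw (ε α : ℝ) (q : PMF (Fin n)) : Measure (heavy α q → ℝ) :=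
  Measure.pi fun _ => laplace (2 / (c₂ * ε))

theorem isProbabilityMeasure_noiseLaw (q : PMF (Fin n)) (hε : 0 < ε) :
    IsProbabilityMeasure (noiseLaw ε α q) := by
  have := isProbabilityMeasure_laplace (noiseScale_pos hε)
  unfold noiseLaw
  infer_instance

theorem noiseLaw_smallNoise (q : PMF (Fin n)) (hε : 0 < ε) (hα : α ≤ 1) :
    noiseLaw ε α q (smallNoise (noiseThreshold ε α q)) = ENNReal.ofReal (1 - c₂) := by
  have hk : (0 : ℝ) < (heavy α q).card := by exact_mod_cast (heavy_nonempty q hα).card_pos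
  rw [noiseLaw, pi_laplace_smallNoise (noiseScale_pos hε) (noiseThreshold_nonneg q hε hα),
    exp_neg_noiseThreshold q hε hα, Fintype.card_coe, sub_sub_cancel, ← Real.rpow_natCast,
    ← Real.rpow_mul (by norm_num [c₂]), one_div_mul_cancel hk.ne', Real.rpow_one]

/-- The probability, given the counts `N` and the noise `y`, of an answer of Priv'IT that has
probability `r` after the comparison of the noisy counts with their thresholds has failed and
probability `t` after it has succeeded. -/
def gate (ε α : ℝ) (m : ℕ) (q : PMF (Fin n)) (r t : ℝ) (N : Fin n → ℕ) (y : heavy α q → ℝ) : ℝ :=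
  if ∃ i, noiseThreshold ε α q ≤ |y i| then 1 / 2
  else if ∃ i : heavy α q,
      noiseThreshold ε α q + deviation m q i ≤ |(N i : ℝ) + y i - m * (q i).toReal| then r
  else t

/-- The mean of `gate` over the noise. -/
def gateMean (ε α : ℝ) (m : ℕ) (q : PMF (Fin n)) (r t : ℝ) (N : Fin n → ℕ) : ℝ :=
  ∫ y, gate ε α m q r t N y ∂noiseLaw ε α q

variable {r t : ℝ}

theorem measurable_gate (N : Fin n → ℕ) : Measurable (gate ε α m q r t N) := by
  unfold gate
  refine Measurable.ite ?_ measurable_const (Measurable.ite ?_ measurable_const measurable_const)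
  · rw [Set.ofPred_exists]
    exact MeasurableSet.iUnion fun i => measurableSet_le measurable_const (by fun_prop)
  · rw [Set.ofPred_exists]
    exact MeasurableSet.iUnion fun i => measurableSet_le measurable_const (by fun_prop)

theorem gate_nonneg (hr : 0 ≤ r) (ht : 0 ≤ t) (N : Fin n → ℕ) (y : heavy α q → ℝ) :
    0 ≤ gate ε α m q r t N y := by
  unfold gate; split_ifs <;> positivity

theorem gate_le_one (hr : r ≤ 1) (ht : t ≤ 1) (N : Fin n → ℕ) (y : heavy α q → ℝ) :
    gate ε α m q r t N y ≤ 1 := by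
  unfold gate; split_ifs <;> first | assumption | norm_num

theorem integrable_gate (hε : 0 < ε) (hr : 0 ≤ r) (hr' : r ≤ 1) (ht : 0 ≤ t) (ht' : t ≤ 1)
    (N : Fin n → ℕ) : Integrable (gate ε α m q r t N) (noiseLaw ε α q) := by
  have := isProbabilityMeasure_noiseLaw (α := α) q hε
  refine Integrable.of_bound (measurable_gate N).aestronglyMeasurable 1
    (Filter.Eventually.of_forall fun y => ?_)
  rw [Real.norm_of_nonneg (gate_nonneg hr ht N y)]
  exact gate_le_one hr' ht' N y

theorem rejectProb_eq_gateMean (N : Fin n → ℕ) :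
    rejectProb ε α m q N = gateMean ε α m q 1 (max 0 (min 1 (statistic α m q N))) N := rfl

/-- The fair coin is its own complement, so the opposite verdict is again a gate and each privacy
estimate is needed only once. -/
theorem one_sub_gateMean (hε : 0 < ε) (hr : 0 ≤ r) (hr' : r ≤ 1) (ht : 0 ≤ t) (ht' : t ≤ 1)
    (N : Fin n → ℕ) : 1 - gateMean ε α m q r t N = gateMean ε α m q (1 - r) (1 - t) N := by
  have := isProbabilityMeasure_noiseLaw (α := α) q hε
  have h1 : ∫ _y : heavy α q → ℝ, (1 : ℝ) ∂noiseLaw ε α q = 1 := by simp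
  rw [gateMean, ← h1, ← integral_sub (integrable_const _) (integrable_gate hε hr hr' ht ht' N),
    gateMean, h1]
  refine integral_congr_ae (Filter.Eventually.of_forall fun y => ?_)
  simp only [gate]
  split_ifs <;> norm_num

theorem ofReal_gateMean (hε : 0 < ε) (hα : α ≤ 1) (hr : 0 ≤ r) (hr' : r ≤ 1) (ht : 0 ≤ t)
    (ht' : t ≤ 1) (N : Fin n → ℕ) :
    ENNReal.ofReal (gateMean ε α m q r t N) = ENNReal.ofReal (c₂ / 2) +
      ∫⁻ y, (smallNoise (noiseThreshold ε α q)).indicator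
        (fun y => ENNReal.ofReal (if ∃ i : heavy α q, noiseThreshold ε α q + deviation m q i ≤
          |(N i : ℝ) + y i - m * (q i).toReal| then r else t)) y ∂noiseLaw ε α q := by
  have := isProbabilityMeasure_noiseLaw (α := α) q hε
  have hG := measurableSet_smallNoise (ι := heavy α q) (noiseThreshold ε α q)
  rw [gateMean, ofReal_integral_eq_lintegral_ofReal (integrable_gate hε hr hr' ht ht' N)
    (Filter.Eventually.of_forall fun y => gate_nonneg hr ht N y)]
  have h1 : ∀ y, ENNReal.ofReal (gate ε α m q r t N y) =
      (smallNoise (noiseThreshold ε α q))ᶜ.indicator (fun _ => ENNReal.ofReal (1 / 2)) y +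
      (smallNoise (noiseThreshold ε α q)).indicator
        (fun y => ENNReal.ofReal (if ∃ i : heavy α q, noiseThreshold ε α q + deviation m q i ≤
          |(N i : ℝ) + y i - m * (q i).toReal| then r else t)) y := by
    intro y
    by_cases hy : y ∈ smallNoise (noiseThreshold ε α q)
    · have : ¬ ∃ i, noiseThreshold ε α q ≤ |y i| := by
        rintro ⟨i, hi⟩
        exact absurd (hy i) (not_lt.mpr hi)
      simp only [gate, if_neg this]
      simp [hy]
    · have : ∃ i, noiseThreshold ε α q ≤ |y i| := by
        by_contra h
        push Not at h
        exact hy h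
      simp only [gate, if_pos this]
      simp [hy]
  rw [lintegral_congr h1, lintegral_add_left (measurable_const.indicator hG.compl),
    lintegral_indicator_const hG.compl, prob_compl_eq_one_sub hG, noiseLaw_smallNoise q hε hα,
    ← ENNReal.ofReal_one, ← ENNReal.ofReal_sub _ (by norm_num [c₂]),
    ← ENNReal.ofReal_mul (by norm_num)]
  congr 2
  norm_num [c₂]

/-- Changing one count while `t` is kept fixed amounts to shifting one noise variable. -/
theorem gateMean_shift_le (hε : 0 < ε) (hα : α ≤ 1) (hr : 0 ≤ r) (hr' : r ≤ 1) (ht : 0 ≤ t)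
    (ht' : t ≤ 1) {N N' : Fin n → ℕ} {i : Fin n} (hi : i ∈ heavy α q)
    (hN : ∀ j, j ≠ i → N' j = N j) (hNi : |(N' i : ℝ) - N i| ≤ 1) :
    gateMean ε α m q r t N' ≤ Real.exp (c₂ * ε / 2) * gateMean ε α m q r t N := by
  have h0 : ∀ N, 0 ≤ gateMean ε α m q r t N := fun N =>
    integral_nonneg fun y => gate_nonneg hr ht N y
  rw [← ENNReal.ofReal_le_ofReal_iff (mul_nonneg (Real.exp_pos _).le (h0 N)),
    ENNReal.ofReal_mul (Real.exp_pos _).le, ofReal_gateMean hε hα hr hr' ht ht',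
    ofReal_gateMean hε hα hr hr' ht ht']
  set F : (heavy α q → ℝ) → ℝ≥0∞ := fun y =>
    ENNReal.ofReal (if ∃ i : heavy α q, noiseThreshold ε α q + deviation m q i ≤
          |(N i : ℝ) + y i - m * (q i).toReal| then r else t) with hF
  have hFm : Measurable F := by
    refine Measurable.ennreal_ofReal (Measurable.ite ?_ measurable_const measurable_const)
    rw [Set.ofPred_exists]
    exact MeasurableSet.iUnion fun i => measurableSet_le measurable_const (by fun_prop)
  have hF1 : ∀ y, F y ≤ 1 := by
    intro y
    rw [hF, ← ENNReal.ofReal_one]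
    refine ENNReal.ofReal_le_ofReal ?_
    split_ifs <;> assumption
  have key := lintegral_smallNoise_shift_le (noiseScale_pos hε) (noiseThreshold ε α q) hNi
    (⟨i, hi⟩ : heavy α q) F hFm hF1
  have hFs : (fun y : heavy α q → ℝ =>
      F (y + Pi.single (⟨i, hi⟩ : heavy α q) ((N' i : ℝ) - N i))) = fun y =>
      ENNReal.ofReal (if ∃ i : heavy α q, noiseThreshold ε α q + deviation m q i ≤
          |(N' i : ℝ) + y i - m * (q i).toReal| then r else t) := by
    funext y
    have : ∀ j : heavy α q, (N j : ℝ) + (y + Pi.single (⟨i, hi⟩ : heavy α q)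
        ((N' i : ℝ) - N i) : heavy α q → ℝ) j - m * (q j).toReal =
          N' j + y j - m * (q j).toReal := by
      intro j
      by_cases hj : j = ⟨i, hi⟩
      · subst hj
        simp
        ring
      · have : (j : Fin n) ≠ i := fun h => hj (Subtype.ext h)
        simp [hj, hN _ this]
    simp only [hF, this]
  rw [hFs, one_div_noiseScale] at key
  have he : 1 ≤ Real.exp (c₂ * ε / 2) := Real.one_le_exp (by unfold c₂; positivity)
  have hτ := exp_neg_noiseThreshold_le q hε hα
  refine (add_le_add le_rfl key).trans ?_
  rw [mul_add, ← ENNReal.ofReal_mul (Real.exp_pos _).le, add_left_comm, add_comm]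
  rw [← ENNReal.ofReal_add (by norm_num [c₂])
    (div_nonneg (mul_nonneg (Real.exp_pos _).le (by linarith)) (by norm_num))]
  refine add_le_add (ENNReal.ofReal_le_ofReal ?_) le_rfl
  -- With E = exp (c₂ε/2), the edge loss is at most c₂(E - 1)/2, exactly what the coin's share c₂/2
  -- gains when multiplied by E.
  nlinarith

theorem half_c₂_le_gateMean (hε : 0 < ε) (hα : α ≤ 1) (hr : 0 ≤ r) (hr' : r ≤ 1) (ht : 0 ≤ t)
    (ht' : t ≤ 1) (N : Fin n → ℕ) : c₂ / 2 ≤ gateMean ε α m q r t N := by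
  have h0 : 0 ≤ gateMean ε α m q r t N := integral_nonneg fun y => gate_nonneg hr ht N y
  rw [← ENNReal.ofReal_le_ofReal_iff h0, ofReal_gateMean hε hα hr hr' ht ht']
  exact le_self_add

/-- The change from `t` to `t'` matters only where truncated noise passes the comparison, so `htt`
is asked for only on the window of width 2τ + deviation. The additive η becomes multiplicative
because the gate mean is at least c₂/2, and the shift has used only c₂ε/2 of the privacy budget. -/
theorem gateMean_le_exp_mul (hε : 0 < ε) (hα : α ≤ 1) (hr : 0 ≤ r) (hr' : r ≤ 1) {t' η : ℝ}
    (ht : 0 ≤ t) (ht1 : t ≤ 1) (ht' : 0 ≤ t') (ht1' : t' ≤ 1) {N N' : Fin n → ℕ} {i : Fin n}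
    (hi : i ∈ heavy α q) (hN : ∀ j, j ≠ i → N' j = N j) (hNi : |(N' i : ℝ) - N i| ≤ 1)
    (hη : 0 ≤ η) (hηε : η ≤ 36 / 1000 * ε)
    (htt : |(N' i : ℝ) - m * (q i).toReal| ≤ 2 * noiseThreshold ε α q + deviation m q i →
      t' ≤ t + η) :
    gateMean ε α m q r t' N' ≤ Real.exp ε * gateMean ε α m q r t N := by
  have := isProbabilityMeasure_noiseLaw (α := α) q hε
  have h1 : gateMean ε α m q r t' N' ≤ gateMean ε α m q r t N' + η := by
    have h2 : ∫ _y : heavy α q → ℝ, η ∂noiseLaw ε α q = η := by simp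
    rw [gateMean, gateMean]
    rw [← h2, ← integral_add (integrable_gate hε hr hr' ht ht1 N') (integrable_const _)]
    refine integral_mono (integrable_gate hε hr hr' ht' ht1' N')
      ((integrable_gate hε hr hr' ht ht1 N').add (integrable_const _)) fun y => ?_
    simp only [gate]
    split_ifs with hy hy'
    · linarith
    · linarith
    · push Not at hy hy'
      refine htt ?_
      have a1 := hy ⟨i, hi⟩
      have a2 := hy' ⟨i, hi⟩
      simp only at a2
      rw [abs_lt] at a1 a2
      rw [abs_le]
      constructor <;> linarith
  have h2 := gateMean_shift_le (m := m) hε hα hr hr' ht ht1 hi hN hNi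
  have h3 := half_c₂_le_gateMean (m := m) (q := q) hε hα hr hr' ht ht1 N
  have h4 : Real.exp (c₂ * ε / 2) * (1 + (1 - c₂ / 2) * ε) ≤ Real.exp ε := by
    rw [show Real.exp ε = Real.exp (c₂ * ε / 2) * Real.exp ((1 - c₂ / 2) * ε) by
      rw [← Real.exp_add]; ring_nf]
    gcongr
    linarith [Real.add_one_le_exp ((1 - c₂ / 2) * ε)]
  have h5 : 1 ≤ Real.exp (c₂ * ε / 2) := Real.one_le_exp (by unfold c₂; positivity)
  set E := Real.exp (c₂ * ε / 2)
  set g := gateMean ε α m q r t N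
  have h6 : η ≤ E * ((1 - c₂ / 2) * ε) * g := by
    have h8 : (1 - c₂ / 2) * ε * (c₂ / 2) ≤ (1 - c₂ / 2) * ε * g := by
      refine mul_le_mul_of_nonneg_left h3 ?_
      unfold c₂
      positivity
    -- Here (1 - c₂/2) · c₂/2 ≈ 0.03609, the source of the constant 36/1000.
    have h7 : 36 / 1000 * ε ≤ (1 - c₂ / 2) * ε * (c₂ / 2) := by
      norm_num [c₂]
      linarith
    have h9 : (1 - c₂ / 2) * ε * g ≤ E * ((1 - c₂ / 2) * ε * g) :=
      le_mul_of_one_le_left (by linarith) h5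
    linarith
  have h7 : E * (1 + (1 - c₂ / 2) * ε) * g ≤ Real.exp ε * g := by
    gcongr
    exact le_trans (by norm_num [c₂]) h3
  linarith

end

/-! ### Consequences of the lower bound on the number of samples -/

section Bound

variable {n : ℕ} {ε α C x : ℝ}

theorem one_le_sampleBound (hn : 1 ≤ n) (hα : 0 < α) (hα1 : α ≤ 1) : 1 ≤ sampleBound n α ε := by
  refine le_trans ?_ ((le_max_left _ _).trans (le_max_left _ _))
  rw [one_le_div (by positivity)]
  calc α ^ 2 ≤ 1 := pow_le_one₀ hα.le hα1
    _ ≤ _ := Real.one_le_sqrt.mpr (by exact_mod_cast hn)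

/-- This and the next two lemmas turn the three terms of the maximum into inequalities with integer
exponents. -/
theorem sq_mul_le_of_sampleBound_le (hα : 0 < α) (hC : 0 ≤ C) (h : C * sampleBound n α ε ≤ x) :
    C ^ 2 * n ≤ x ^ 2 * α ^ 4 := by
  have h1 : C * (√n / α ^ 2) ≤ x := le_trans (mul_le_mul_of_nonneg_left
    ((le_max_left _ _).trans (le_max_left _ _)) hC) h
  have h2 : C * √n ≤ x * α ^ 2 := by
    rwa [← mul_div_assoc, div_le_iff₀ (by positivity)] at h1
  have h3 := pow_le_pow_left₀ (by positivity) h2 2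
  rw [mul_pow, Real.sq_sqrt (by positivity)] at h3
  calc _ ≤ _ := h3
    _ = _ := by ring

theorem sq_mul_sq_le_of_sampleBound_le (hε : 0 < ε) (hα : 0 < α) (hC : 0 ≤ C)
    (h : C * sampleBound n α ε ≤ x) : C ^ 2 * n ≤ x ^ 2 * α ^ 3 * ε ^ 2 := by
  have h1 : C * (√n / (α ^ (3 / 2 : ℝ) * ε)) ≤ x := le_trans (mul_le_mul_of_nonneg_left
    ((le_max_right _ _).trans (le_max_left _ _)) hC) h
  have h2 : C * √n ≤ x * (α ^ (3 / 2 : ℝ) * ε) := by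
    rwa [← mul_div_assoc, div_le_iff₀ (by positivity)] at h1
  have h3 := pow_le_pow_left₀ (by positivity) h2 2
  rw [mul_pow, Real.sq_sqrt (by positivity), mul_pow, mul_pow, ← Real.rpow_natCast (α ^ _),
    ← Real.rpow_mul hα.le, show (3 / 2 : ℝ) * ((2 : ℕ) : ℝ) = ((3 : ℕ) : ℝ) by norm_num,
    Real.rpow_natCast] at h3
  linarith

theorem cube_mul_le_of_sampleBound_le (hε : 0 < ε) (hα : 0 < α) (hC : 0 ≤ C)
    (h : C * sampleBound n α ε ≤ x) : C ^ 3 * n ≤ x ^ 3 * α ^ 5 * ε ^ 2 := by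
  have h1 : C * ((n : ℝ) ^ (1 / 3 : ℝ) / (α ^ (5 / 3 : ℝ) * ε ^ (2 / 3 : ℝ))) ≤ x :=
    le_trans (mul_le_mul_of_nonneg_left (le_max_right _ _) hC) h
  have h2 : C * (n : ℝ) ^ (1 / 3 : ℝ) ≤ x * (α ^ (5 / 3 : ℝ) * ε ^ (2 / 3 : ℝ)) := by
    rwa [← mul_div_assoc, div_le_iff₀ (by positivity)] at h1
  have h3 := pow_le_pow_left₀ (by positivity) h2 3
  have e : ∀ (y s : ℝ) (k : ℕ), 0 ≤ y → s * 3 = k → (y ^ s) ^ 3 = y ^ k := by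
    intro y s k hy hs
    rw [← Real.rpow_natCast (y ^ s), ← Real.rpow_mul hy, ← Real.rpow_natCast y k, ← hs]
    norm_num
  rw [mul_pow, mul_pow, mul_pow, e _ _ 1 (by positivity) (by norm_num),
    e _ _ 5 hα.le (by norm_num), e _ _ 2 hε.le (by norm_num), pow_one] at h3
  linarith

end Bound

/-! ### Privacy of Priv'IT -/

section Privacy

variable {n : ℕ} {ε α : ℝ} {m : ℕ} {q : PMF (Fin n)}

/-- The correction -Nᵢ cancels the constant in the increment of the square, so the change is linear
in the deviation of the count. -/
theorem statistic_insert (hα : 0 < α) {N : Fin n → ℕ} {i : Fin n} (hi : i ∈ heavy α q) :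
    statistic α m q (N + Pi.single i 1) - statistic α m q N =
      4 * ((N i : ℝ) - m * (q i).toReal) / (m * α ^ 2 * (m * (q i).toReal)) := by
  have hq := pos_of_mem_heavy hα hi
  rw [statistic, statistic, ← mul_sub, ← Finset.sum_sub_distrib, Finset.sum_eq_single_of_mem i hi]
  · simp only [Pi.add_apply, Pi.single_eq_same, Nat.cast_add, Nat.cast_one]
    rw [← sub_div, div_mul_div_comm]
    congr 1
    ring
  · intro j _ hj
    simp [hj]

theorem statistic_insert_of_notMem {N : Fin n → ℕ} {i : Fin n} (hi : i ∉ heavy α q) :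
    statistic α m q (N + Pi.single i 1) = statistic α m q N := by
  rw [statistic, statistic]
  congr 1
  refine Finset.sum_congr rfl fun j hj => ?_
  have : j ≠ i := fun h => hi (h ▸ hj)
  simp [this]

theorem rejectProb_insert_of_notMem {N : Fin n → ℕ} {i : Fin n} (hi : i ∉ heavy α q) :
    rejectProb ε α m q (N + Pi.single i 1) = rejectProb ε α m q N := by
  rw [rejectProb_eq_gateMean, rejectProb_eq_gateMean, statistic_insert_of_notMem hi]
  have : ∀ j : heavy α q, (N + Pi.single i 1 : Fin n → ℕ) j = N j := by
    intro j
    have : (j : Fin n) ≠ i := fun h => hi (h ▸ j.2)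
    simp [this]
  simp only [gateMean, gate, this]

/-- The statistic of Priv'IT is insensitive to the insertion of one element, as long as the noisy
counts may pass the comparison with their thresholds. -/
theorem sensitivity_le {C : ℝ} (hC : 1000 ≤ C) (hε : 0 < ε) (hα : 0 < α) (hα1 : α ≤ 1)
    (hm : C * (1 + Real.log n) * sampleBound n α ε ≤ m) {i : Fin n} (hi : i ∈ heavy α q) {x : ℝ}
    (hx : |x| ≤ 2 * noiseThreshold ε α q + deviation m q i + 1) :
    |4 * x / (m * α ^ 2 * (m * (q i).toReal))| ≤ 36 / 1000 * ε := by
  have hn : 1 ≤ n := pos_of_pmf q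
  have hn' : (1 : ℝ) ≤ n := by exact_mod_cast hn
  have hL := Real.log_nonneg hn'
  set L := Real.log n with hLdef
  set ℓ := 1 + L with hℓ
  have hℓ1 : 1 ≤ ℓ := by linarith
  have hCℓ : C ≤ C * ℓ := le_mul_of_one_le_right (by linarith) hℓ1
  have hB := one_le_sampleBound (ε := ε) hn hα hα1
  have hm1 : (1 : ℝ) ≤ m := by nlinarith
  have hq := pos_of_mem_heavy hα hi
  have hqn := le_of_mem_heavy hi
  set p := (q i).toReal with hp
  have h1 := sq_mul_le_of_sampleBound_le hα (by linarith) hm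
  have h2 := sq_mul_sq_le_of_sampleBound_le hε hα (by linarith) hm
  have h3 := cube_mul_le_of_sampleBound_le hε hα (by linarith) hm
  have hqn' : α ≤ 4 * n * p := by
    rw [div_le_iff₀ (by positivity)] at hqn
    linarith
  set X := (m : ℝ) * α ^ 2 * (m * p) with hX
  have hXpos : 0 < X := by positivity
  have hXlow : (m : ℝ) ^ 2 * α ^ 3 ≤ 4 * n * X := by
    have := mul_le_mul_of_nonneg_left hqn' (show (0 : ℝ) ≤ m ^ 2 * α ^ 2 by positivity)
    rw [hX]
    nlinarith
  have hCsq : (1000000 : ℝ) * ℓ ^ 2 ≤ (C * ℓ) ^ 2 := by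
    rw [mul_pow]
    gcongr
    nlinarith
  have hτ : noiseThreshold ε α q * ε ≤ 80 * ℓ :=
    (le_div_iff₀ hε).mp (noiseThreshold_le q hε hα1)
  -- From the second term of B together with qᵢ ≥ α/(4n); it controls the noise threshold.
  have b1 : 250000 * ℓ ^ 2 ≤ ε ^ 2 * X := by
    have h4 : (1000000 * ℓ ^ 2) * n ≤ 4 * (ε ^ 2 * X) * n := by
      calc _ ≤ (C * ℓ) ^ 2 * n := by gcongr
        _ ≤ m ^ 2 * α ^ 3 * ε ^ 2 := h2
        _ ≤ 4 * n * X * ε ^ 2 := by gcongr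
        _ = _ := by ring
    have := le_of_mul_le_mul_right h4 (by positivity)
    linarith
  -- The product of the bounds from the first two terms of B gives this after a square root; it
  -- controls 1 + log n.
  have b2 : 250000 * ℓ ^ 2 ≤ ε * X := by
    have h4 : (1000000 * ℓ ^ 2) * n ≤ ε * (m ^ 2 * α ^ 3) := by
      refine (pow_le_pow_iff_left₀ (by positivity) (by positivity) two_ne_zero).mp ?_
      have h5 : (1000000 * ℓ ^ 2) * n ≤ (C * ℓ) ^ 2 * n := by gcongr
      have h6 : (1000000 * ℓ ^ 2) * n ≤ m ^ 2 * α ^ 3 := by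
        exact (h5.trans h1).trans (mul_le_mul_of_nonneg_left
          (pow_le_pow_of_le_one hα.le hα1 (by norm_num)) (by positivity))
      have h7 := mul_le_mul h6 (h5.trans h2) (by positivity) (by positivity)
      calc _ = (1000000 * ℓ ^ 2 * n) * (1000000 * ℓ ^ 2 * n) := by ring
        _ ≤ _ := h7
        _ = _ := by ring
    have h8 : (1000000 * ℓ ^ 2) * n ≤ 4 * (ε * X) * n := by
      calc _ ≤ _ := h4
        _ ≤ ε * (4 * n * X) := by gcongr
        _ = _ := by ring
    have := le_of_mul_le_mul_right h8 (by positivity)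
    linarith
  -- This is where the third term of B is needed.
  have b3 : √(m * p * L) ≤ 1 / 2000 * (ε * X) := by
    refine Real.sqrt_le_iff.mpr ⟨by positivity, ?_⟩
    have h4 : (1000000000 : ℝ) * L ≤ (C * ℓ) ^ 3 := by
      calc (1000000000 : ℝ) * L = 1000 ^ 3 * L := by norm_num
        _ ≤ C ^ 3 * ℓ ^ 3 := by
          gcongr
          nlinarith [sq_nonneg L, pow_nonneg hL 3]
        _ = _ := by ring
    have h5 : (1000000000 * L) * n ≤ 4 * (m ^ 3 * α ^ 4 * ε ^ 2 * p) * n := by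
      calc _ ≤ (C * ℓ) ^ 3 * n := by gcongr
        _ ≤ m ^ 3 * α ^ 5 * ε ^ 2 := h3
        _ = m ^ 3 * α ^ 4 * ε ^ 2 * α := by ring
        _ ≤ m ^ 3 * α ^ 4 * ε ^ 2 * (4 * n * p) := by gcongr
        _ = _ := by ring
    have h6 := le_of_mul_le_mul_right h5 (by positivity)
    have h7 : (1 / 2000 * (ε * X)) ^ 2 =
        (1 / 4000000) * (m ^ 3 * α ^ 4 * ε ^ 2 * p) * (m * p) := by
      rw [hX]; ring
    rw [h7]
    calc m * p * L = L * (m * p) := by ring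
      _ ≤ _ := by
        gcongr
        linarith
  have hdev : deviation m q i ≤ 4 * √(m * p * L) + L := by
    unfold deviation
    exact max_le (by linarith) (by linarith [Real.sqrt_nonneg (m * p * L)])
  rw [abs_div, abs_of_pos hXpos, div_le_iff₀ hXpos, abs_mul, abs_of_pos (show (0 : ℝ) < 4 by simp)]
  have hτX : noiseThreshold ε α q ≤ 80 / 250000 * (ε * X) := by
    have h4 : noiseThreshold ε α q * ε ≤ (80 / 250000 * (ε * X)) * ε := by
      calc _ ≤ 80 * ℓ := hτ
        _ ≤ 80 * ℓ ^ 2 := by nlinarith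
        _ ≤ _ := by linarith
    exact le_of_mul_le_mul_right h4 hε
  have hL2 : ℓ ≤ 1 / 250000 * (ε * X) := by nlinarith
  linarith

theorem clamp_sub_clamp_le (x y : ℝ) : max 0 (min 1 x) ≤ max 0 (min 1 y) + |x - y| := by
  have h := abs_nonneg (x - y)
  have h' := le_abs_self (x - y)
  rcases le_total 1 x with h1 | h1 <;> rcases le_total 1 y with h2 | h2 <;>
    rcases le_total 0 x with h3 | h3 <;> rcases le_total 0 y with h4 | h4 <;>
    simp [h1, h2, h3, h4] <;> linarith

theorem clamp_nonneg (x : ℝ) : 0 ≤ max 0 (min 1 x) := le_max_left _ _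

theorem clamp_le_one (x : ℝ) : max 0 (min 1 x) ≤ 1 := max_le zero_le_one (min_le_left _ _)

theorem stableUnderInsertion_rejectProb {C : ℝ} (hC : 1000 ≤ C) (q : PMF (Fin n)) (hε : 0 < ε)
    (hα : 0 < α) (hα1 : α ≤ 1) (hm : C * (1 + Real.log n) * sampleBound n α ε ≤ m) :
    StableUnderInsertion ε (rejectProb ε α m q) ∧
      StableUnderInsertion ε fun N => 1 - rejectProb ε α m q N := by
  have he : 1 ≤ Real.exp ε := Real.one_le_exp hε.le
  -- The increment involves the count before the insertion, while the window may concern the count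
  -- after it. The summand 1 in the hypothesis of `sensitivity_le` covers this difference.
  have key : ∀ (N : Fin n → ℕ) (i : Fin n), i ∈ heavy α q → ∀ x : ℝ,
      (x = N i ∨ x = N i + 1) →
      |x - m * (q i).toReal| ≤ 2 * noiseThreshold ε α q + deviation m q i →
      |statistic α m q (N + Pi.single i 1) - statistic α m q N| ≤ 36 / 1000 * ε := by
    intro N i hi x hx hx'
    rw [statistic_insert hα hi]
    refine sensitivity_le hC hε hα hα1 hm hi ?_
    rw [abs_le] at hx' ⊢
    rcases hx with rfl | rfl <;> constructor <;> linarith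
  have c0 := clamp_nonneg
  have c1 := clamp_le_one
  have hη : 0 ≤ 36 / 1000 * ε := by positivity
  simp only [StableUnderInsertion]
  refine ⟨fun N i => ?_, fun N i => ?_⟩
  · by_cases hi : i ∈ heavy α q
    · rw [rejectProb_eq_gateMean, rejectProb_eq_gateMean]
      constructor
      · refine gateMean_le_exp_mul hε hα1 zero_le_one le_rfl (c0 _) (c1 _) (c0 _) (c1 _) hi
          (fun j hj => by simp [hj]) (by simp) hη le_rfl fun h => ?_
        have h1 := key N i hi _ (Or.inr (by simp)) h
        exact (clamp_sub_clamp_le _ _).trans (by gcongr)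
      · refine gateMean_le_exp_mul hε hα1 zero_le_one le_rfl (c0 _) (c1 _) (c0 _) (c1 _) hi
          (fun j hj => by simp [hj]) (by simp) hη le_rfl fun h => ?_
        have h1 := key N i hi _ (Or.inl rfl) h
        rw [abs_sub_comm] at h1
        exact (clamp_sub_clamp_le _ _).trans (by gcongr)
    · rw [rejectProb_insert_of_notMem hi]
      have := rejectProb_nonneg ε α m q N
      constructor <;> nlinarith
  · by_cases hi : i ∈ heavy α q
    · rw [rejectProb_eq_gateMean, rejectProb_eq_gateMean,
        one_sub_gateMean hε zero_le_one le_rfl (c0 _) (c1 _),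
        one_sub_gateMean hε zero_le_one le_rfl (c0 _) (c1 _), sub_self]
      constructor
      · refine gateMean_le_exp_mul hε hα1 le_rfl zero_le_one (sub_nonneg.mpr (c1 _))
          (sub_le_self _ (c0 _)) (sub_nonneg.mpr (c1 _)) (sub_le_self _ (c0 _)) hi
          (fun j hj => by simp [hj]) (by simp) hη le_rfl fun h => ?_
        have h1 := key N i hi _ (Or.inr (by simp)) h
        rw [abs_sub_comm] at h1
        linarith [clamp_sub_clamp_le (statistic α m q N) (statistic α m q (N + Pi.single i 1))]
      · refine gateMean_le_exp_mul hε hα1 le_rfl zero_le_one (sub_nonneg.mpr (c1 _))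
          (sub_le_self _ (c0 _)) (sub_nonneg.mpr (c1 _)) (sub_le_self _ (c0 _)) hi
          (fun j hj => by simp [hj]) (by simp) hη le_rfl fun h => ?_
        have h1 := key N i hi _ (Or.inl rfl) h
        linarith [clamp_sub_clamp_le (statistic α m q (N + Pi.single i 1)) (statistic α m q N)]
    · rw [rejectProb_insert_of_notMem hi]
      have := rejectProb_le_one ε α m q N
      constructor <;> nlinarith

theorem differentiallyPrivate_privIT {C : ℝ} (hC : 1000 ≤ C) (q : PMF (Fin n)) (hε : 0 < ε)
    (hα : 0 < α) (hα1 : α ≤ 1) (hm : C * (1 + Real.log n) * sampleBound n α ε ≤ m) :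
    DifferentiallyPrivate (privIT ε α m q) ε 0 :=
  have h := stableUnderInsertion_rejectProb hC q hε hα hα1 hm
  differentiallyPrivate_verdictCoin hε.le _ _ _ h.1 h.2

end Privacy

/-! ### Moments and tails of the Poisson distribution -/

/-- Falling factorials merely shift the exponential series; all moments below are reduced to them.
-/
theorem hasSum_poisson_descFactorial (r : ℝ≥0) (j : ℕ) :
    HasSum (fun k : ℕ => Real.exp (-r) * r ^ k / k ! * (k.descFactorial j : ℝ)) (r ^ j) := by
  have h := (hasSum_one_poissonMeasure r).mul_left ((r : ℝ) ^ j)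
  rw [mul_one] at h
  rw [← (add_left_injective j).hasSum_iff]
  · convert! h using 1
    ext k
    have h1 := Nat.factorial_mul_descFactorial (Nat.le_add_left j k)
    rw [Nat.add_sub_cancel] at h1
    have h2 : ((k + j)! : ℝ) = k ! * (k + j).descFactorial j := by exact_mod_cast h1.symm
    have h3 : ((k + j).descFactorial j : ℝ) ≠ 0 := by
      have : (k + j).descFactorial j ≠ 0 := by
        rw [Ne, Nat.descFactorial_eq_zero_iff_lt]; lia
      exact_mod_cast this
    simp only [Function.comp]
    rw [h2, pow_add]
    field_simp
  · intro k hk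
    have : k < j := by
      by_contra h
      exact hk ⟨k - j, Nat.sub_add_cancel (not_lt.mp h)⟩
    simp [Nat.descFactorial_eq_zero_iff_lt.mpr this]

theorem integrable_descFactorial (r : ℝ≥0) (j : ℕ) :
    Integrable (fun k : ℕ => (k.descFactorial j : ℝ)) (poissonMeasure r) := by
  rw [integrable_poissonMeasure_iff]
  simpa using (hasSum_poisson_descFactorial r j).summable

theorem cast_descFactorial_succ (k j : ℕ) :
    (k.descFactorial (j + 1) : ℝ) = (k - j) * k.descFactorial j := by
  rw [Nat.descFactorial_succ, Nat.cast_mul]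
  rcases le_or_gt j k with h | h
  · rw [Nat.cast_sub h]
  · simp [Nat.descFactorial_eq_zero_iff_lt.mpr h]

/-- An unbiased estimate of `(μ - l) ^ 2` from a Poisson variable `k` of mean `μ`. -/
def centredSquare (l : ℝ) (k : ℕ) : ℝ := (k - l) ^ 2 - k

theorem centredSquare_eq (l : ℝ) (k : ℕ) : centredSquare l k =
    k.descFactorial 2 - 2 * l * k.descFactorial 1 + l ^ 2 * k.descFactorial 0 := by
  simp only [centredSquare, cast_descFactorial_succ, Nat.descFactorial_zero]
  push_cast
  ring

theorem centredSquare_sq_eq (l : ℝ) (k : ℕ) : centredSquare l k ^ 2 =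
    k.descFactorial 4 + (4 - 4 * l) * k.descFactorial 3 +
      (2 - 8 * l + 6 * l ^ 2) * k.descFactorial 2 +
      (4 * l ^ 2 - 4 * l ^ 3) * k.descFactorial 1 + l ^ 4 * k.descFactorial 0 := by
  simp only [centredSquare, cast_descFactorial_succ, Nat.descFactorial_zero]
  push_cast
  ring

theorem integral_centredSquare (r : ℝ≥0) (l : ℝ) :
    ∫ k, centredSquare l k ∂poissonMeasure r = (r - l) ^ 2 := by
  have h := hasSum_poisson_descFactorial r
  have h1 := ((h 2).sub ((h 1).mul_left (2 * l))).add ((h 0).mul_left (l ^ 2))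
  rw [integral_poissonMeasure]
  refine (HasSum.tsum_eq (a := (r - l) ^ 2) ?_)
  convert! h1 using 1
  · ext k
    rw [centredSquare_eq, smul_eq_mul]
    ring
  · ring

theorem integrable_centredSquare_sq (r : ℝ≥0) (l : ℝ) :
    Integrable (fun k => centredSquare l k ^ 2) (poissonMeasure r) := by
  have i := integrable_descFactorial r
  simp_rw [centredSquare_sq_eq]
  exact ((((i 4).add ((i 3).const_mul _)).add ((i 2).const_mul _)).add ((i 1).const_mul _)).add
    ((i 0).const_mul _)

theorem integral_centredSquare_sq (r : ℝ≥0) (l : ℝ) :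
    ∫ k, centredSquare l k ^ 2 ∂poissonMeasure r =
      (r - l) ^ 4 + 4 * r * (r - l) ^ 2 + 2 * r ^ 2 := by
  have h := hasSum_poisson_descFactorial r
  have h1 := ((((h 4).add ((h 3).mul_left (4 - 4 * l))).add
    ((h 2).mul_left (2 - 8 * l + 6 * l ^ 2))).add ((h 1).mul_left (4 * l ^ 2 - 4 * l ^ 3))).add
    ((h 0).mul_left (l ^ 4))
  rw [integral_poissonMeasure]
  refine (HasSum.tsum_eq ?_)
  convert! h1 using 1
  · ext k
    rw [centredSquare_sq_eq, smul_eq_mul]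
    ring
  · ring

theorem memLp_centredSquare (r : ℝ≥0) (l : ℝ) :
    MemLp (centredSquare l) 2 (poissonMeasure r) :=
  (memLp_two_iff_integrable_sq .of_discrete).mpr (integrable_centredSquare_sq r l)

theorem variance_centredSquare (r : ℝ≥0) (l : ℝ) :
    Var[centredSquare l; poissonMeasure r] = 4 * r * (r - l) ^ 2 + 2 * r ^ 2 := by
  rw [variance_eq_sub (memLp_centredSquare r l)]
  simp only [Pi.pow_apply, integral_centredSquare, integral_centredSquare_sq]
  ring

theorem hasSum_poisson_exp (r : ℝ≥0) (s : ℝ) :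
    HasSum (fun k : ℕ => Real.exp (-r) * r ^ k / k ! * Real.exp (s * k))
      (Real.exp (r * (Real.exp s - 1))) := by
  have h := (NormedSpace.expSeries_div_hasSum_exp ((r : ℝ) * Real.exp s)).mul_left (Real.exp (-r))
  rw [← Real.exp_eq_exp_ℝ, ← Real.exp_add] at h
  convert! h using 1
  · ext k
    rw [mul_pow, ← Real.exp_nat_mul, mul_comm (k : ℝ) s]
    ring
  · congr 1
    ring

theorem integrable_exp_poisson (r : ℝ≥0) (s : ℝ) :
    Integrable (fun k : ℕ => Real.exp (s * k)) (poissonMeasure r) := by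
  rw [integrable_poissonMeasure_iff]
  simpa using (hasSum_poisson_exp r s).summable

theorem mgf_poisson (r : ℝ≥0) (s : ℝ) :
    mgf (fun k : ℕ => (k : ℝ)) (poissonMeasure r) s = Real.exp (r * (Real.exp s - 1)) := by
  rw [mgf, integral_poissonMeasure]
  simpa using (hasSum_poisson_exp r s).tsum_eq

/-- The same `s` serves both tails: the exponent of the lower one is no larger because sinh s ≥ s.
-/
theorem poisson_deviation_le (r : ℝ≥0) (x : ℝ) {s : ℝ} (hs : 0 ≤ s) :
    (poissonMeasure r).real {k : ℕ | x ≤ |(k : ℝ) - r|} ≤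
      2 * Real.exp (-(s * x) + r * (Real.exp s - 1 - s)) := by
  have h1 := measure_ge_le_exp_mul_mgf (r + x) hs (integrable_exp_poisson r s)
  have h2 := measure_le_le_exp_mul_mgf (r - x) (neg_nonpos.mpr hs) (integrable_exp_poisson r (-s))
  rw [mgf_poisson, ← Real.exp_add] at h1 h2
  have h3 : {k : ℕ | x ≤ |(k : ℝ) - r|} ⊆
      {k : ℕ | r + x ≤ (k : ℝ)} ∪ {k : ℕ | (k : ℝ) ≤ r - x} := by
    intro k hk
    rcases le_abs.mp (show x ≤ |(k : ℝ) - r| from hk) with h | h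
    · left
      change (r : ℝ) + x ≤ k
      linarith
    · right
      change (k : ℝ) ≤ r - x
      linarith
  have h4 := Real.self_le_sinh_iff.mpr hs
  rw [Real.sinh_eq] at h4
  have hr : (0 : ℝ) ≤ r := r.2
  refine (measureReal_mono h3).trans ((measureReal_union_le _ _).trans ?_)
  have h5 : Real.exp (-s * (r + x) + r * (Real.exp s - 1)) ≤
      Real.exp (-(s * x) + r * (Real.exp s - 1 - s)) :=
    Real.exp_le_exp.mpr (by linarith)
  have h6 : Real.exp (- -s * (r - x) + r * (Real.exp (-s) - 1)) ≤
      Real.exp (-(s * x) + r * (Real.exp s - 1 - s)) :=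
    Real.exp_le_exp.mpr (by nlinarith)
  linarith

/-! ### The statistic of Priv'IT on Poisson samples -/

section Statistic

variable {n : ℕ} {α : ℝ} {m : ℕ}

/-- The law of the counts of `Poisson(m)` independent samples from `p`. -/
def countsLaw (m : ℕ) (p : PMF (Fin n)) : Measure (Fin n → ℕ) :=
  poissonCounts m fun i => (p i).toNNReal

instance (m : ℕ) (p : PMF (Fin n)) : IsProbabilityMeasure (countsLaw m p) := by
  unfold countsLaw; infer_instance

/-- The contribution of the `i`-th count to the statistic. -/
def statisticTerm (α : ℝ) (m : ℕ) (q : PMF (Fin n)) (i : Fin n) (k : ℕ) : ℝ :=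
  (if i ∈ heavy α q then 2 / (m * α ^ 2) / (m * (q i).toReal) else 0) *
    centredSquare (m * (q i).toReal) k

theorem statistic_eq_sum (q : PMF (Fin n)) (N : Fin n → ℕ) :
    statistic α m q N = ∑ i, statisticTerm α m q i (N i) := by
  simp only [statistic, statisticTerm, ite_mul, zero_mul, Finset.sum_ite_mem, Finset.univ_inter,
    Finset.mul_sum, centredSquare]
  refine Finset.sum_congr rfl fun i _ => ?_
  ring

theorem memLp_statisticTerm (q : PMF (Fin n)) (i : Fin n) (r : ℝ≥0) :
    MemLp (statisticTerm α m q i) 2 (poissonMeasure r) :=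
  (memLp_centredSquare r _).const_mul _

theorem memLp_statistic (p q : PMF (Fin n)) :
    MemLp (statistic α m q) 2 (countsLaw m p) := by
  have : statistic α m q = fun N => ∑ i, statisticTerm α m q i (N i) :=
    funext (statistic_eq_sum q)
  rw [this]
  exact memLp_finsetSum _ fun i _ =>
    (memLp_statisticTerm q i _).comp_measurePreserving (measurePreserving_eval _ i)

theorem integral_statistic (p q : PMF (Fin n)) :
    ∫ N, statistic α m q N ∂countsLaw m p = ∑ i ∈ heavy α q,
      2 / (m * α ^ 2) / (m * (q i).toReal) * (m * (p i).toReal - m * (q i).toReal) ^ 2 := by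
  simp_rw [statistic_eq_sum]
  have hi : ∀ i, Integrable (statisticTerm α m q i) (poissonMeasure (m * (p i).toNNReal)) :=
    fun i => (memLp_statisticTerm q i _).integrable one_le_two
  rw [countsLaw, poissonCounts, integral_finsetSum _ fun i _ => integrable_comp_eval (hi i)]
  have h : ∀ i, ∫ N : Fin n → ℕ, statisticTerm α m q i (N i)
      ∂Measure.pi (fun i => poissonMeasure (m * (p i).toNNReal)) =
      ∫ k, statisticTerm α m q i k ∂poissonMeasure (m * (p i).toNNReal) := fun i =>
    integral_comp_eval (μ := fun i => poissonMeasure (m * (p i).toNNReal))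
      (hi i).aestronglyMeasurable
  simp_rw [h]
  simp only [statisticTerm, integral_const_mul, integral_centredSquare]
  simp only [ite_mul, zero_mul, Finset.sum_ite_mem, Finset.univ_inter]
  rfl

theorem variance_statistic (p q : PMF (Fin n)) :
    Var[statistic α m q; countsLaw m p] = ∑ i ∈ heavy α q,
      (2 / (m * α ^ 2) / (m * (q i).toReal)) ^ 2 *
        (4 * (m * (p i).toReal) * (m * (p i).toReal - m * (q i).toReal) ^ 2 +
          2 * (m * (p i).toReal) ^ 2) := by
  have : statistic α m q = ∑ i, fun N : Fin n → ℕ => statisticTerm α m q i (N i) := by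
    ext N
    rw [statistic_eq_sum, Finset.sum_apply]
  rw [this, countsLaw, poissonCounts, variance_sum_pi fun i => memLp_statisticTerm q i _]
  have h : ∀ i, Var[statisticTerm α m q i; poissonMeasure (m * (p i).toNNReal)] =
      if i ∈ heavy α q then (2 / (m * α ^ 2) / (m * (q i).toReal)) ^ 2 *
        (4 * (m * (p i).toReal) * (m * (p i).toReal - m * (q i).toReal) ^ 2 +
          2 * (m * (p i).toReal) ^ 2) else 0 := by
    intro i
    change Var[fun k => _ * centredSquare _ k; _] = _
    rw [variance_const_mul, variance_centredSquare]
    split_ifs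
    · rfl
    · ring
  simp_rw [h, Finset.sum_ite_mem, Finset.univ_inter]

end Statistic

/-! ### Accuracy of Priv'IT on Poisson samples -/

theorem exp_three_half_le : Real.exp (3 / 2) ≤ 4.49 := by
  refine (pow_le_pow_iff_left₀ (Real.exp_pos _).le (by norm_num) two_ne_zero).mp ?_
  rw [← Real.exp_nat_mul, show ((2 : ℕ) : ℝ) * (3 / 2) = ((3 : ℕ) : ℝ) * 1 by norm_num,
    Real.exp_nat_mul]
  calc Real.exp 1 ^ 3 ≤ (2.7182818286 : ℝ) ^ 3 := by
        gcongr
        exact Real.exp_one_lt_d9.le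
    _ ≤ _ := by norm_num

/-- Poisson variables rarely exceed the statistical deviation that Priv'IT allows. -/
theorem poisson_deviation_le_of_large {r : ℝ≥0} {L : ℝ} (hL : 0 < L) (hr : 4 * L ≤ r) :
    (poissonMeasure r).real {k : ℕ | max (4 * √(r * L)) L ≤ |(k : ℝ) - r|} ≤
      2 * Real.exp (-(4 * L)) := by
  have hr0 : (0 : ℝ) < r := by linarith
  set a := √(r : ℝ) with ha
  set b := √L with hb
  have ha2 : a ^ 2 = r := Real.sq_sqrt hr0.le
  have hb2 : b ^ 2 = L := Real.sq_sqrt hL.le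
  have ha0 : 0 < a := Real.sqrt_pos.mpr hr0
  have hb0 : 0 < b := Real.sqrt_pos.mpr hL
  have hab : 2 * b ≤ a := by
    refine (pow_le_pow_iff_left₀ (by positivity) ha0.le two_ne_zero).mp ?_
    nlinarith
  -- The Chernoff parameter is s = 2√(L/r). The linear gain is then at least 8L and the quadratic
  -- cost at most r s² = 4L; the bound exp s - 1 - s ≤ s² needs s ≤ 1.
  have hs1 : 2 * b / a ≤ 1 := (div_le_one ha0).mpr hab
  have hs0 : 0 < 2 * b / a := by positivity
  refine (poisson_deviation_le r _ hs0.le).trans ?_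
  gcongr
  have h1 := Real.abs_exp_sub_one_sub_id_le (x := 2 * b / a) (by rwa [abs_of_pos hs0])
  have h2 := (le_abs_self _).trans h1
  have h3 : (r : ℝ) * (Real.exp (2 * b / a) - 1 - 2 * b / a) ≤ 4 * L := by
    calc _ ≤ (r : ℝ) * (2 * b / a) ^ 2 := by gcongr
      _ = 4 * L := by
        rw [← ha2, ← hb2]
        field_simp
        norm_num
  have h4 : 8 * L ≤ 2 * b / a * max (4 * √(r * L)) L := by
    calc 8 * L = 2 * b / a * (4 * √(r * L)) := by
          rw [Real.sqrt_mul hr0.le, ← ha, ← hb, ← hb2]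
          field_simp
          norm_num
      _ ≤ _ := by
        gcongr
        exact le_max_left _ _
  linarith

/-- For means below 4L the fixed parameter s = 3/2 suffices. The term L in the maximum covers r ≤
L/16 and the square root covers the rest. -/
theorem poisson_deviation_le_of_pos {r : ℝ≥0} {L : ℝ} (hL : 0 < L) :
    (poissonMeasure r).real {k : ℕ | max (4 * √(r * L)) L ≤ |(k : ℝ) - r|} ≤
      2 * Real.exp (-(4 / 3 * L)) := by
  have hr0 : (0 : ℝ) ≤ r := r.2
  rcases le_total (4 * L) r with h | h
  · refine (poisson_deviation_le_of_large hL h).trans ?_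
    gcongr
    norm_num
  · refine (poisson_deviation_le r _ (show (0 : ℝ) ≤ 3 / 2 by norm_num)).trans ?_
    gcongr
    have h1 : (r : ℝ) * (Real.exp (3 / 2) - 1 - 3 / 2) ≤ r * 1.99 := by
      gcongr
      linarith [exp_three_half_le]
    suffices 4 / 3 * L + r * 1.99 ≤ 3 / 2 * max (4 * √(r * L)) L by linarith
    rcases le_total (r : ℝ) (L / 16) with h2 | h2
    · have := le_max_right (4 * √(r * L)) L
      linarith
    · refine le_trans ?_ (mul_le_mul_of_nonneg_left (le_max_left _ _) (by norm_num))
      rw [Real.sqrt_mul hr0]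
      set a := √(r : ℝ) with ha
      set b := √L with hb
      have ha2 : a ^ 2 = r := Real.sq_sqrt hr0
      have hb2 : b ^ 2 = L := Real.sq_sqrt hL.le
      have ha0 : 0 ≤ a := Real.sqrt_nonneg _
      have hb0 : 0 < b := Real.sqrt_pos.mpr hL
      have hab : a ≤ 2 * b := by
        refine (pow_le_pow_iff_left₀ ha0 (by positivity) two_ne_zero).mp ?_
        nlinarith
      have hba : b / 4 ≤ a := by
        refine (pow_le_pow_iff_left₀ (by positivity) ha0 two_ne_zero).mp ?_
        nlinarith
      rw [← ha2, ← hb2]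
      nlinarith [mul_nonneg (sub_nonneg.mpr hab) (sub_nonneg.mpr hba),
        mul_nonneg hb0.le (sub_nonneg.mpr hba)]

section

variable {n : ℕ} {ε α : ℝ} {m : ℕ} {q : PMF (Fin n)}

/-- If failing the comparison cannot push the probability above `t`, the noise adds at most the
coin's contribution c₂/2. -/
theorem gateMean_le_half_c₂_add {r t : ℝ} (hε : 0 < ε) (hα : α ≤ 1) (hr : 0 ≤ r) (hr' : r ≤ 1)
    (ht : 0 ≤ t) (ht' : t ≤ 1) (N : Fin n → ℕ)
    (h : ∀ y : heavy α q → ℝ, (∀ i, |y i| < noiseThreshold ε α q) →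
      (∃ i : heavy α q, noiseThreshold ε α q + deviation m q i ≤
        |(N i : ℝ) + y i - m * (q i).toReal|) → r ≤ t) :
    gateMean ε α m q r t N ≤ c₂ / 2 + t := by
  have := isProbabilityMeasure_noiseLaw (α := α) q hε
  have hc : 0 ≤ c₂ / 2 := by norm_num [c₂]
  rw [← ENNReal.ofReal_le_ofReal_iff (by positivity), ofReal_gateMean hε hα hr hr' ht ht',
    ENNReal.ofReal_add hc ht]
  refine add_le_add le_rfl ?_
  calc _ ≤ ∫⁻ _y : heavy α q → ℝ, ENNReal.ofReal t ∂noiseLaw ε α q := by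
        refine lintegral_mono fun y => ?_
        by_cases hy : y ∈ smallNoise (noiseThreshold ε α q)
        · rw [Set.indicator_of_mem hy]
          refine ENNReal.ofReal_le_ofReal ?_
          split_ifs with h1
          · exact h y hy h1
          · exact le_rfl
        · rw [Set.indicator_of_notMem hy]
          exact zero_le
    _ = _ := by simp

theorem one_sub_rejectProb_le (hε : 0 < ε) (hα : α ≤ 1) (N : Fin n → ℕ) :
    1 - rejectProb ε α m q N ≤ c₂ / 2 + (1 - max 0 (min 1 (statistic α m q N))) := by
  have c0 := clamp_nonneg (statistic α m q N)
  have c1 := clamp_le_one (statistic α m q N)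
  rw [rejectProb_eq_gateMean, one_sub_gateMean hε zero_le_one le_rfl c0 c1, sub_self]
  exact gateMean_le_half_c₂_add hε hα le_rfl zero_le_one (by linarith) (by linarith) N
    fun _ _ _ => by linarith

theorem rejectProb_le (hε : 0 < ε) (hα : α ≤ 1) (N : Fin n → ℕ)
    (h : ∀ i ∈ heavy α q, |(N i : ℝ) - m * (q i).toReal| < deviation m q i) :
    rejectProb ε α m q N ≤ c₂ / 2 + max 0 (min 1 (statistic α m q N)) := by
  rw [rejectProb_eq_gateMean]
  refine gateMean_le_half_c₂_add hε hα zero_le_one le_rfl (clamp_nonneg _) (clamp_le_one _) N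
    fun y hy ⟨i, hi⟩ => absurd hi (not_le.mpr ?_)
  have h1 := h i i.2
  have h2 := hy i
  rw [abs_lt] at *
  constructor <;> linarith

/-- The heavy symbols account for most of the total variation distance. -/
theorem le_sum_heavy_abs_sub (hα : 0 < α) {p : PMF (Fin n)} (h : α ≤ tvDist p q) :
    3 / 4 * α ≤ ∑ i ∈ heavy α q, |(p i).toReal - (q i).toReal| := by
  have hn' : (0 : ℝ) < n := by exact_mod_cast pos_of_pmf q
  set a : Fin n → ℝ := fun i => (p i).toReal - (q i).toReal with ha
  have h1 : 2 * α ≤ ∑ i, |a i| := by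
    rw [tvDist] at h
    linarith
  have h2 : ∑ i, a i = 0 := by
    rw [Finset.sum_sub_distrib, sum_toReal_pmf, sum_toReal_pmf, sub_self]
  rw [← Finset.sum_add_sum_compl (heavy α q)] at h1 h2
  have h3 : ∑ i ∈ (heavy α q)ᶜ, (q i).toReal ≤ α / 4 := by
    calc _ ≤ ∑ i ∈ (heavy α q)ᶜ, α / (4 * n) := by
          refine Finset.sum_le_sum fun i hi => ?_
          have : ¬ c₁ * α / n ≤ (q i).toReal := fun h =>
            Finset.mem_compl.mp hi (Finset.mem_filter.mpr ⟨Finset.mem_univ _, h⟩)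
          refine (not_le.mp this).le.trans (le_of_eq ?_)
          rw [c₁]
          ring
      _ ≤ ∑ i : Fin n, α / (4 * n) :=
          Finset.sum_le_sum_of_subset_of_nonneg (Finset.subset_univ _) fun _ _ _ => by positivity
      _ = α / 4 := by
          rw [Finset.sum_const, Finset.card_univ, Fintype.card_fin, nsmul_eq_mul]
          field_simp
  -- As p ≥ 0, |a i| ≤ a i + 2 qᵢ. The light sum of `a` is minus the heavy one, so any excess of p
  -- on light symbols appears as a deficit on heavy ones.
  have h4 : ∑ i ∈ (heavy α q)ᶜ, |a i| ≤
      ∑ i ∈ (heavy α q)ᶜ, a i + 2 * ∑ i ∈ (heavy α q)ᶜ, (q i).toReal := by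
    rw [Finset.mul_sum, ← Finset.sum_add_distrib]
    refine Finset.sum_le_sum fun i _ => ?_
    have hp : 0 ≤ (p i).toReal := ENNReal.toReal_nonneg
    have hq : 0 ≤ (q i).toReal := ENNReal.toReal_nonneg
    simp only [ha]
    rw [abs_le]
    constructor <;> linarith
  have h5 := (neg_le_abs _).trans (Finset.abs_sum_le_sum_abs a (heavy α q))
  linarith

/-- Cauchy–Schwarz with weights qᵢ, whose heavy sum is at most 1; the constant is (3/4)². -/
theorem sum_sq_div_ge (hα : 0 < α) {p : PMF (Fin n)} (h : α ≤ tvDist p q) :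
    9 / 16 * (m * α ^ 2) ≤ ∑ i ∈ heavy α q,
      (m * (p i).toReal - m * (q i).toReal) ^ 2 / (m * (q i).toReal) := by
  rcases Nat.eq_zero_or_pos m with rfl | hm
  · simp
  have hm' : (0 : ℝ) < m := by exact_mod_cast hm
  have h1 := le_sum_heavy_abs_sub hα h
  have h2 := Finset.sq_sum_div_le_sum_sq_div (heavy α q)
    (fun i => |(p i).toReal - (q i).toReal|) fun i hi => pos_of_mem_heavy hα hi
  have h3 : ∑ i ∈ heavy α q, (q i).toReal ≤ 1 := by
    rw [← sum_toReal_pmf q]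
    exact Finset.sum_le_sum_of_subset_of_nonneg (Finset.subset_univ _)
      fun _ _ _ => ENNReal.toReal_nonneg
  by_cases h0 : (heavy α q).Nonempty
  · have h4 : 0 < ∑ i ∈ heavy α q, (q i).toReal :=
      Finset.sum_pos (fun i hi => pos_of_mem_heavy hα hi) h0
    have h5 : (3 / 4 * α) ^ 2 ≤ ∑ i ∈ heavy α q,
        |(p i).toReal - (q i).toReal| ^ 2 / (q i).toReal := by
      refine le_trans ?_ h2
      rw [le_div_iff₀ h4]
      have := pow_le_pow_left₀ (by positivity) h1 2
      nlinarith [sq_nonneg (3 / 4 * α)]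
    calc 9 / 16 * (m * α ^ 2) = (m : ℝ) * (3 / 4 * α) ^ 2 := by ring
      _ ≤ (m : ℝ) * ∑ i ∈ heavy α q, |(p i).toReal - (q i).toReal| ^ 2 / (q i).toReal :=
        mul_le_mul_of_nonneg_left h5 hm'.le
      _ = _ := by
        rw [Finset.mul_sum]
        refine Finset.sum_congr rfl fun i hi => ?_
        have := pos_of_mem_heavy hα hi
        rw [sq_abs]
        field_simp
  · rw [Finset.not_nonempty_iff_eq_empty] at h0
    rw [h0] at h1
    simp only [Finset.sum_empty] at h1
    linarith

/-- Write x = (μ - l)²/l and u = |μ - l|/l. A term is at most 4(1 + u)x + 4 + 4u², where u² = x/l ≤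
xS/K² and u ≤ S/K. The sum is thus at most 4S + 4S²/K + 4S²/K² + 4|A|, and each of the four parts is
at most 4/10000 of S². -/
theorem sum_variance_terms_le {ι : Type*} (A : Finset ι) (μ l : ι → ℝ) {K Λ S : ℝ}
    (hK : 10000 ≤ K) (hΛ : 0 < Λ) (hl : ∀ i ∈ A, Λ ≤ l i)
    (hS : ∑ i ∈ A, (μ i - l i) ^ 2 / l i = S) (hSK : K ≤ S) (hSΛ : K ^ 2 ≤ S * Λ)
    (hSA : K ^ 2 * A.card ≤ S ^ 2) (hμ : ∀ i ∈ A, 0 ≤ μ i) :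
    ∑ i ∈ A, (4 * μ i * (μ i - l i) ^ 2 + 2 * μ i ^ 2) / l i ^ 2 ≤ 1 / 500 * S ^ 2 := by
  have hS0 : 0 < S := by linarith
  have hK0 : 0 < K := by linarith
  have hterm : ∀ i ∈ A, (4 * μ i * (μ i - l i) ^ 2 + 2 * μ i ^ 2) / l i ^ 2 ≤
      (4 + 4 * (S / K) + 4 * (S / K ^ 2)) * ((μ i - l i) ^ 2 / l i) + 4 := by
    intro i hi
    have hli : 0 < l i := hΛ.trans_le (hl i hi)
    set x := (μ i - l i) ^ 2 / l i with hx
    set u := |μ i - l i| / l i with hu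
    have hx0 : 0 ≤ x := by positivity
    have hu0 : 0 ≤ u := by positivity
    have hxS : x ≤ S := by
      rw [← hS]
      exact Finset.single_le_sum (f := fun i => (μ i - l i) ^ 2 / l i)
        (fun j hj => div_nonneg (sq_nonneg _) (hΛ.trans_le (hl j hj)).le) hi
    have hu2 : u ^ 2 = x / l i := by
      rw [hu, hx, div_pow, sq_abs]
      field_simp
    have hΛi : 1 / l i ≤ S / K ^ 2 := by
      rw [div_le_div_iff₀ hli (by positivity)]
      nlinarith [hl i hi]
    have hu2' : u ^ 2 ≤ x * (S / K ^ 2) := by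
      rw [hu2, div_eq_mul_one_div]
      gcongr
    have huS : u ≤ S / K := by
      refine (pow_le_pow_iff_left₀ hu0 (by positivity) two_ne_zero).mp (hu2'.trans ?_)
      calc x * (S / K ^ 2) ≤ S * (S / K ^ 2) := by gcongr
        _ = _ := by ring
    have hμ1 : μ i / l i ≤ 1 + u := by
      rw [hu, div_le_iff₀ hli, add_mul, div_mul_cancel₀ _ hli.ne']
      linarith [le_abs_self (μ i - l i)]
    have hμ0 : 0 ≤ μ i / l i := div_nonneg (hμ i hi) hli.le
    have e : (4 * μ i * (μ i - l i) ^ 2 + 2 * μ i ^ 2) / l i ^ 2 =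
        4 * (μ i / l i) * x + 2 * (μ i / l i) ^ 2 := by
      rw [hx]
      field_simp
    rw [e]
    have h1 : 4 * (μ i / l i) * x ≤ 4 * (1 + S / K) * x := by
      gcongr
      linarith
    have h2 : (μ i / l i) ^ 2 ≤ 2 + 2 * u ^ 2 := by
      have := pow_le_pow_left₀ hμ0 hμ1 2
      nlinarith [sq_nonneg (1 - u)]
    nlinarith
  refine (Finset.sum_le_sum hterm).trans ?_
  rw [Finset.sum_add_distrib, ← Finset.mul_sum, hS, Finset.sum_const, nsmul_eq_mul]
  have h1 : 4 * S ≤ 4 / 10000 * S ^ 2 := by nlinarith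
  have h2 : S / K * S ≤ 1 / 10000 * S ^ 2 := by
    rw [div_mul_eq_mul_div, div_le_iff₀ hK0]
    nlinarith [sq_nonneg S]
  have hK2 : 10000 ≤ K ^ 2 := by nlinarith
  have h3 : S / K ^ 2 * S ≤ 1 / 10000 * S ^ 2 := by
    rw [div_mul_eq_mul_div, div_le_iff₀ (by positivity)]
    nlinarith [sq_nonneg S]
  have h4 : (A.card : ℝ) ≤ 1 / 10000 * S ^ 2 := by
    nlinarith [Nat.cast_nonneg (α := ℝ) A.card]
  linarith

theorem integrable_rejectProb (p q : PMF (Fin n)) :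
    Integrable (rejectProb ε α m q) (countsLaw m p) := by
  refine Integrable.of_bound .of_discrete 1 (Filter.Eventually.of_forall fun N => ?_)
  rw [Real.norm_of_nonneg (rejectProb_nonneg _ _ _ _ _)]
  exact rejectProb_le_one _ _ _ _ _

/-- The left side is nonzero only if z < 1, and then e - z ≥ e - 1 ≥ e/9. This is Chebyshev's
inequality in pointwise form. -/
theorem one_sub_clamp_le {e z : ℝ} (he : 9 / 8 ≤ e) :
    1 - max 0 (min 1 z) ≤ 81 / e ^ 2 * (z - e) ^ 2 := by
  rcases le_total 1 z with h | h
  · rw [min_eq_left h, max_eq_right zero_le_one, sub_self]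
    positivity
  · have h1 : 1 - max 0 (min 1 z) ≤ 1 := by linarith [clamp_nonneg z]
    refine h1.trans ?_
    rw [div_mul_eq_mul_div, le_div_iff₀ (by positivity)]
    nlinarith

theorem clamp_le_add_sq (z : ℝ) : max 0 (min 1 z) ≤ 1 / 100 + 25 * z ^ 2 := by
  have h : z ≤ 1 / 100 + 25 * z ^ 2 := by nlinarith [sq_nonneg (50 * z - 1)]
  exact max_le (by positivity) ((min_le_right _ _).trans h)

/-- Failing the comparison only favours the correct answer, so the error is the coin's c₂/2 plus the
Chebyshev term 81/500. -/
theorem integral_one_sub_rejectProb_le {C : ℝ} (hC : 100000 ≤ C) (hε : 0 < ε) (hα : 0 < α)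
    (hα1 : α ≤ 1) (hm : C * (1 + Real.log n) * sampleBound n α ε ≤ m) {p : PMF (Fin n)}
    (hp : α ≤ tvDist p q) : ∫ N, (1 - rejectProb ε α m q N) ∂countsLaw m p ≤ 1 / 3 := by
  have hn : 1 ≤ n := pos_of_pmf q
  have hn' : (1 : ℝ) ≤ n := by exact_mod_cast hn
  have hL := Real.log_nonneg hn'
  have hCℓ : C ≤ C * (1 + Real.log n) := le_mul_of_one_le_right (by linarith) (by linarith)
  have hB := one_le_sampleBound (ε := ε) hn hα hα1
  have hm1 : (1 : ℝ) ≤ m := by nlinarith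
  have hmC : C * sampleBound n α ε ≤ m := le_trans (by gcongr) hm
  have hmA := sq_mul_le_of_sampleBound_le hα (by linarith) hmC
  have hCsq : (10000000000 : ℝ) ≤ C ^ 2 := by nlinarith
  have hmB : 10000000000 * (n : ℝ) ≤ m ^ 2 * α ^ 4 := le_trans (by gcongr) hmA
  set S := ∑ i ∈ heavy α q,
      (m * (p i).toReal - m * (q i).toReal) ^ 2 / (m * (q i).toReal) with hS
  have hSm : 9 / 16 * (m * α ^ 2) ≤ S := sum_sq_div_ge hα hp
  have hSn : 10000 ^ 2 * (n : ℝ) ≤ S ^ 2 := by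
    have := pow_le_pow_left₀ (by positivity) hSm 2
    nlinarith
  have hmean : ∫ N, statistic α m q N ∂countsLaw m p = 2 / (m * α ^ 2) * S := by
    rw [integral_statistic, hS, Finset.mul_sum]
    refine Finset.sum_congr rfl fun i _ => ?_
    ring
  have hq : ∀ i ∈ heavy α q, m * (α / (4 * n)) ≤ m * (q i).toReal := fun i hi =>
    mul_le_mul_of_nonneg_left (le_of_mem_heavy hi) (by positivity)
  have hvar : Var[statistic α m q; countsLaw m p] ≤
      (2 / (m * α ^ 2)) ^ 2 * (1 / 500 * S ^ 2) := by
    have h1 := sum_variance_terms_le (heavy α q) (fun i => m * (p i).toReal)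
      (fun i => m * (q i).toReal) (K := 10000) (Λ := m * (α / (4 * n))) (S := S) le_rfl
      (by positivity) hq hS.symm ?_ ?_ ?_ ?_
    · rw [variance_statistic]
      calc _ = (2 / (m * α ^ 2)) ^ 2 * _ := by
            rw [Finset.mul_sum]
            refine Finset.sum_congr rfl fun i _ => ?_
            rw [div_pow _ (_ * (q i).toReal)]
            ring
        _ ≤ _ := mul_le_mul_of_nonneg_left h1 (by positivity)
    · have hS0 : 0 ≤ S := le_trans (by positivity) hSm
      refine (pow_le_pow_iff_left₀ (by norm_num) hS0 two_ne_zero).mp ?_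
      linarith
    · have h2 : 9 / 16 * (m * α ^ 2) * (m * (α / (4 * n))) ≤ S * (m * (α / (4 * n))) := by gcongr
      refine le_trans ?_ h2
      have h3 : 9 / 16 * (m * α ^ 2) * (m * (α / (4 * n))) = 9 / 64 * (m ^ 2 * α ^ 3) / n := by
        field_simp
        norm_num
      rw [h3, le_div_iff₀ (by positivity)]
      have h4 : (m : ℝ) ^ 2 * α ^ 4 ≤ m ^ 2 * α ^ 3 :=
        mul_le_mul_of_nonneg_left (pow_le_pow_of_le_one hα.le hα1 (by norm_num)) (by positivity)
      linarith
    · refine le_trans ?_ hSn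
      gcongr
      exact (Finset.card_le_univ _).trans_eq (Fintype.card_fin n)
    · exact fun i _ => by positivity
  set e := 2 / (m * α ^ 2) * S with he
  have he98 : 9 / 8 ≤ e := by
    rw [he, div_mul_eq_mul_div, le_div_iff₀ (by positivity)]
    linarith
  have hmem := memLp_statistic (α := α) (m := m) p q
  have hvarI : Var[statistic α m q; countsLaw m p] =
      ∫ N, (statistic α m q N - e) ^ 2 ∂countsLaw m p := by
    rw [variance_eq_integral hmem.aestronglyMeasurable.aemeasurable, hmean]
  have hint : Integrable (fun N => (statistic α m q N - e) ^ 2) (countsLaw m p) :=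
    (hmem.sub (memLp_const e)).integrable_sq
  calc ∫ N, (1 - rejectProb ε α m q N) ∂countsLaw m p
      ≤ ∫ N, (c₂ / 2 + 81 / e ^ 2 * (statistic α m q N - e) ^ 2) ∂countsLaw m p := by
        refine integral_mono ((integrable_const _).sub (integrable_rejectProb p q))
          ((integrable_const _).add (hint.const_mul _)) fun N => ?_
        have := one_sub_rejectProb_le (m := m) (q := q) hε hα1 N
        exact this.trans (add_le_add le_rfl (one_sub_clamp_le he98))
    _ = c₂ / 2 + 81 / e ^ 2 * Var[statistic α m q; countsLaw m p] := by
        rw [integral_add (integrable_const _) (hint.const_mul _), integral_const_mul, hvarI]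
        simp
    _ ≤ c₂ / 2 + 81 / e ^ 2 * (1 / 500 * e ^ 2) := by
        gcongr
        rw [he]
        refine hvar.trans (le_of_eq ?_)
        ring
    _ ≤ 1 / 3 := by
        rw [show 81 / e ^ 2 * (1 / 500 * e ^ 2) = 81 / 500 by field_simp]
        norm_num [c₂]

theorem measureReal_countsLaw_coordinate (p : PMF (Fin n)) (i : Fin n) (s : Set ℕ) :
    (countsLaw m p).real {N | N i ∈ s} = (poissonMeasure (m * (p i).toNNReal)).real s := by
  have h := measurePreserving_eval (fun i => poissonMeasure (m * (p i).toNNReal)) i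
  exact h.measureReal_preimage MeasurableSet.of_discrete.nullMeasurableSet

/-- A union bound. The general tail gives 2 n^(-1/3), which suffices from n = 512 = 8³ on. For
smaller n, the size of m makes every heavy mean at least 4 log n, and the stronger tail gives 2 n⁻³.
-/
theorem measureReal_exists_deviation_le {C : ℝ} (hC : 100000 ≤ C) (hn : 2 ≤ n) (hα : 0 < α)
    (hα1 : α ≤ 1) (hm : C * (1 + Real.log n) * sampleBound n α ε ≤ m) :
    (countsLaw m q).real
      {N | ∃ i ∈ heavy α q, deviation m q i ≤ |(N i : ℝ) - m * (q i).toReal|} ≤ 1 / 4 := by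
  have hn2 : (2 : ℝ) ≤ n := by exact_mod_cast hn
  have hL : 0 < Real.log n := Real.log_pos (by linarith)
  set L := Real.log n with hLdef
  have hexp : Real.exp L = n := Real.exp_log (by linarith)
  have hB := one_le_sampleBound (ε := ε) (by lia : 1 ≤ n) hα hα1
  have hset : {N : Fin n → ℕ | ∃ i ∈ heavy α q,
      deviation m q i ≤ |(N i : ℝ) - m * (q i).toReal|} =
      ⋃ i ∈ heavy α q, {N : Fin n → ℕ | N i ∈ {k : ℕ |
        max (4 * √(((m * (q i).toNNReal : ℝ≥0) : ℝ) * L)) L ≤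
          |(k : ℝ) - (m * (q i).toNNReal : ℝ≥0)|}} := by
    ext N
    simp only [Set.mem_iUnion, exists_prop]
    rfl
  rw [hset]
  refine (measureReal_biUnion_finset_le _ _).trans ?_
  simp_rw [measureReal_countsLaw_coordinate]
  have hcard : ((heavy α q).card : ℝ) ≤ Real.exp L := by
    rw [hexp]
    exact_mod_cast (Finset.card_le_univ _).trans_eq (Fintype.card_fin n)
  have hsum : ∀ c : ℝ, (∀ i ∈ heavy α q, (poissonMeasure (m * (q i).toNNReal)).real {k : ℕ |
        max (4 * √(((m * (q i).toNNReal : ℝ≥0) : ℝ) * L)) L ≤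
          |(k : ℝ) - (m * (q i).toNNReal : ℝ≥0)|} ≤ 2 * Real.exp (-(c * L))) →
      ∑ i ∈ heavy α q, (poissonMeasure (m * (q i).toNNReal)).real {k : ℕ |
        max (4 * √(((m * (q i).toNNReal : ℝ≥0) : ℝ) * L)) L ≤
          |(k : ℝ) - (m * (q i).toNNReal : ℝ≥0)|} ≤ 2 * Real.exp (-((c - 1) * L)) := by
    intro c hc
    refine (Finset.sum_le_card_nsmul _ _ _ hc).trans ?_
    rw [nsmul_eq_mul]
    calc _ ≤ Real.exp L * (2 * Real.exp (-(c * L))) := by gcongr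
      _ = 2 * (Real.exp L * Real.exp (-(c * L))) := by ring
      _ = _ := by
        rw [← Real.exp_add]
        congr 2
        ring
  rcases le_or_gt 512 n with h512 | h512
  · refine (hsum (4 / 3) fun i _ => poisson_deviation_le_of_pos hL).trans ?_
    have h1 : (8 : ℝ) ^ 3 ≤ Real.exp L := by
      rw [hexp]
      exact_mod_cast (show 8 ^ 3 ≤ n by lia)
    have h2 : Real.exp (1 / 3 * L) ^ 3 = Real.exp L := by
      rw [← Real.exp_nat_mul]
      congr 1
      push_cast
      ring
    have h3 : 8 ≤ Real.exp (1 / 3 * L) := by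
      refine (pow_le_pow_iff_left₀ (by norm_num) (Real.exp_pos _).le three_ne_zero).mp ?_
      rwa [h2]
    rw [show (4 / 3 - 1 : ℝ) * L = 1 / 3 * L by ring, Real.exp_neg]
    have h4 := inv_anti₀ (by norm_num) h3
    linarith
  · refine (hsum 4 fun i hi => poisson_deviation_le_of_large hL ?_).trans ?_
    · have hn512 : (n : ℝ) ≤ 512 := by exact_mod_cast h512.le
      have hqi := le_of_mem_heavy hi
      have h1 : C * (1 + L) ≤ m * α ^ 2 := by
        have h2 : C * (1 + L) * (√n / α ^ 2) ≤ m := le_trans (mul_le_mul_of_nonneg_left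
          ((le_max_left _ _).trans (le_max_left _ _)) (by positivity)) hm
        rw [← mul_div_assoc, div_le_iff₀ (by positivity)] at h2
        refine le_trans (le_mul_of_one_le_right (by positivity) ?_) h2
        exact Real.one_le_sqrt.mpr (by linarith)
      have h3 : (m : ℝ) * α ^ 2 ≤ m * α := by
        have : α ^ 2 ≤ α := by nlinarith
        gcongr
      have h4 : m * α ≤ m * (q i).toReal * (4 * n) := by
        rw [div_le_iff₀ (by positivity)] at hqi
        rw [mul_assoc]
        gcongr
      have h5 : m * (q i).toReal * (4 * n) ≤ m * (q i).toReal * 2048 := by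
        gcongr
        linarith
      change 4 * L ≤ m * (q i).toReal
      nlinarith
    · have h1 : (2 : ℝ) ^ 3 ≤ Real.exp L ^ 3 := by
        rw [hexp]
        gcongr
      rw [show (4 - 1 : ℝ) * L = ((3 : ℕ) : ℝ) * L by norm_num, Real.exp_neg, Real.exp_nat_mul]
      have h4 := inv_anti₀ (by norm_num) h1
      linarith

/-- The error splits into 1/4 for a failed comparison, c₂/2 for the coin, and 1/100 plus 25 times
the second moment for the statistic. -/
theorem integral_rejectProb_le {C : ℝ} (hC : 100000 ≤ C) (hn : 2 ≤ n) (hε : 0 < ε) (hα : 0 < α)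
    (hα1 : α ≤ 1) (hm : C * (1 + Real.log n) * sampleBound n α ε ≤ m) :
    ∫ N, rejectProb ε α m q N ∂countsLaw m q ≤ 1 / 3 := by
  have hn' : (1 : ℝ) ≤ n := by exact_mod_cast (by lia : 1 ≤ n)
  have hL := Real.log_nonneg hn'
  have hCℓ : C ≤ C * (1 + Real.log n) := le_mul_of_one_le_right (by linarith) (by linarith)
  have hB := one_le_sampleBound (ε := ε) (by lia : 1 ≤ n) hα hα1
  have hm1 : (1 : ℝ) ≤ m := by nlinarith
  have hmC : C * sampleBound n α ε ≤ m := le_trans (by gcongr) hm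
  have hmA := sq_mul_le_of_sampleBound_le hα (by linarith) hmC
  have hCsq : (10000000000 : ℝ) ≤ C ^ 2 := by nlinarith
  have hmB : 10000000000 * (n : ℝ) ≤ m ^ 2 * α ^ 4 := le_trans (by gcongr) hmA
  have hmem := memLp_statistic (α := α) (m := m) q q
  have hmean : ∫ N, statistic α m q N ∂countsLaw m q = 0 := by
    rw [integral_statistic]
    simp
  have hvar : Var[statistic α m q; countsLaw m q] ≤ 1 / 100000 := by
    have h1 : Var[statistic α m q; countsLaw m q] =
        ∑ i ∈ heavy α q, 8 / (m ^ 2 * α ^ 4) := by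
      rw [variance_statistic]
      refine Finset.sum_congr rfl fun i hi => ?_
      have := pos_of_mem_heavy hα hi
      rw [sub_self]
      field_simp
      ring
    rw [h1, Finset.sum_const, nsmul_eq_mul, ← mul_div_assoc, div_le_iff₀ (by positivity)]
    have h2 : ((heavy α q).card : ℝ) ≤ n := by
      exact_mod_cast (Finset.card_le_univ _).trans_eq (Fintype.card_fin n)
    linarith
  have hsq : ∫ N, statistic α m q N ^ 2 ∂countsLaw m q ≤ 1 / 100000 := by
    rw [variance_eq_integral hmem.aestronglyMeasurable.aemeasurable, hmean] at hvar
    simpa using hvar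
  set E := {N : Fin n → ℕ |
    ∃ i ∈ heavy α q, deviation m q i ≤ |(N i : ℝ) - m * (q i).toReal|} with hE
  have hEm : MeasurableSet E := MeasurableSet.of_discrete
  have hEi : Integrable (E.indicator fun _ => (1 : ℝ)) (countsLaw m q) :=
    (integrable_const _).indicator hEm
  have hZi : Integrable (fun N => (c₂ / 2 + 1 / 100) + 25 * statistic α m q N ^ 2)
      (countsLaw m q) := (integrable_const _).add (hmem.integrable_sq.const_mul _)
  have hE4 := measureReal_exists_deviation_le (q := q) hC hn hα hα1 hm
  calc ∫ N, rejectProb ε α m q N ∂countsLaw m q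
      ≤ ∫ N, (E.indicator (fun _ => (1 : ℝ)) N +
          ((c₂ / 2 + 1 / 100) + 25 * statistic α m q N ^ 2)) ∂countsLaw m q := by
        refine integral_mono (integrable_rejectProb q q)
          (hEi.add hZi) fun N => ?_
        have hc : 0 ≤ c₂ := by norm_num [c₂]
        by_cases hN : N ∈ E
        · simp only [Set.indicator_of_mem hN]
          have := rejectProb_le_one ε α m q N
          have h0 : 0 ≤ (c₂ / 2 + 1 / 100) + 25 * statistic α m q N ^ 2 := by positivity
          linarith
        · simp only [Set.indicator_of_notMem hN]
          have h1 := rejectProb_le (m := m) (q := q) hε hα1 N fun i hi =>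
            not_le.mp fun h => hN ⟨i, hi, h⟩
          linarith [clamp_le_add_sq (statistic α m q N)]
    _ = (countsLaw m q).real E +
          ((c₂ / 2 + 1 / 100) + 25 * ∫ N, statistic α m q N ^ 2 ∂countsLaw m q) := by
        rw [integral_add hEi hZi,
          integral_add (integrable_const _) (hmem.integrable_sq.const_mul _), integral_const_mul,
          integral_indicator_const _ hEm]
        simp
    _ ≤ 1 / 3 := by
        norm_num [c₂]
        linarith

end

/-! ### Laws of outputs -/

section Output

variable {n : ℕ}

theorem coe_toNNReal_pmf (p : PMF (Fin n)) (i : Fin n) : ((p i).toNNReal : ℝ≥0∞) = p i :=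
  ENNReal.coe_toNNReal (p.apply_ne_top i)

theorem sum_toNNReal_pmf (p : PMF (Fin n)) : ∑ i, (p i).toNNReal = 1 := by
  rw [← NNReal.coe_inj, NNReal.coe_sum, NNReal.coe_one]
  exact sum_toReal_pmf p

theorem outputLaw_apply {R : Type} (M : Mechanism n R) (p : PMF (Fin n)) (m : ℕ) (v : R) :
    outputLaw M p m v = ∑ x : Fin m → Fin n,
      (∏ a, ((p (x a)).toNNReal : ℝ≥0∞)) * M (occurrences x) v := by
  rw [outputLaw, PMF.bind_apply, tsum_fintype]
  simp only [coe_toNNReal_pmf]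
  rfl

theorem poissonOutputLaw_apply {R : Type} (M : Mechanism n R) (p : PMF (Fin n)) (m : ℕ) (v : R) :
    poissonOutputLaw M p m v = ∫⁻ N, M N v ∂countsLaw m p := by
  rw [poissonOutputLaw, PMF.bind_apply, countsLaw,
    ← tsum_poisson_sum_occurrences _ _ (sum_toNNReal_pmf p)]
  simp only [outputLaw_apply]
  rfl

theorem toReal_equal_add_toReal_different (P : PMF Verdict) :
    (P .equal).toReal + (P .different).toReal = 1 := by
  rw [← ENNReal.toReal_add (P.apply_ne_top _) (P.apply_ne_top _), ← ENNReal.toReal_one,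
    ← P.tsum_coe, tsum_fintype, show (Finset.univ : Finset Verdict) = {.equal, .different} from rfl,
    Finset.sum_pair (by decide)]

theorem testsIdentity_poissonOutputLaw_privIT {ε α C : ℝ} {m : ℕ} (q : PMF (Fin n))
    (hC : 100000 ≤ C) (hn : 2 ≤ n) (hε : 0 < ε) (hα : 0 < α) (hα1 : α ≤ 1)
    (hm : C * (1 + Real.log n) * sampleBound n α ε ≤ m) :
    TestsIdentity (fun p => poissonOutputLaw (privIT ε α m q) p m) q α (1 / 3) (1 / 3) := by
  have hr0 := rejectProb_nonneg ε α m q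
  have hr1 := rejectProb_le_one ε α m q
  have hd : ∀ p, (poissonOutputLaw (privIT ε α m q) p m .different).toReal =
      ∫ N, rejectProb ε α m q N ∂countsLaw m p := by
    intro p
    rw [poissonOutputLaw_apply, integral_eq_lintegral_of_nonneg_ae
      (Filter.Eventually.of_forall hr0) .of_discrete]
    rfl
  constructor
  · have h1 := integral_rejectProb_le (q := q) hC hn hε hα hα1 hm
    rw [← hd] at h1
    linarith [toReal_equal_add_toReal_different (poissonOutputLaw (privIT ε α m q) q m)]
  · intro p hp
    have h1 := integral_one_sub_rejectProb_le hC hε hα hα1 hm hp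
    rw [integral_sub (integrable_const _) (integrable_rejectProb p q), ← hd] at h1
    simp only [integral_const, probReal_univ, smul_eq_mul, mul_one] at h1
    change 1 - 1 / 3 ≤ (poissonOutputLaw (privIT ε α m q) p m .different).toReal
    linarith

end Output

/-! ### Majority votes -/

section Votes

variable {R : ℕ}

/-- The probability of the outcome `b` of a coin that shows `true` with probability `u`. -/
def coinProb (u : ℝ) (b : Bool) : ℝ := if b then u else 1 - u

/-- The probability that the vector of outcomes of independent coins lies in `𝒮`. -/
def voteProb (𝒮 : Finset (Fin R → Bool)) (u : Fin R → ℝ) : ℝ :=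
  ∑ b ∈ 𝒮, ∏ j, coinProb (u j) (b j)

/-- The vectors of votes of which at least half are `true`. -/
def majority (R : ℕ) : Finset (Fin R → Bool) :=
  Finset.univ.filter fun b => R ≤ 2 * (Finset.univ.filter fun j => b j = true).card

theorem coinProb_nonneg {u : ℝ} (h0 : 0 ≤ u) (h1 : u ≤ 1) (b : Bool) : 0 ≤ coinProb u b := by
  cases b <;> simp [coinProb, h0, h1]

theorem voteProb_nonneg (𝒮 : Finset (Fin R → Bool)) {u : Fin R → ℝ} (h0 : ∀ j, 0 ≤ u j)
    (h1 : ∀ j, u j ≤ 1) : 0 ≤ voteProb 𝒮 u :=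
  Finset.sum_nonneg fun _ _ => Finset.prod_nonneg fun j _ => coinProb_nonneg (h0 j) (h1 j) _

theorem voteProb_add_compl (𝒮 : Finset (Fin R → Bool)) (u : Fin R → ℝ) :
    voteProb 𝒮 u + voteProb 𝒮ᶜ u = 1 := by
  rw [voteProb, voteProb, Finset.sum_add_sum_compl, ← Fintype.piFinset_univ,
    ← Finset.prod_univ_sum (fun _ => Finset.univ) fun j b => coinProb (u j) b]
  simp [coinProb]

/-- In each term only the factor of voter `j` changes, so the privacy of one voter passes to the
whole vote. -/
theorem voteProb_le_exp_mul {ε : ℝ} (𝒮 : Finset (Fin R → Bool)) {u u' : Fin R → ℝ}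
    (h0 : ∀ j, 0 ≤ u j) (h1 : ∀ j, u j ≤ 1) (j : Fin R) (hj : ∀ k, k ≠ j → u' k = u k)
    (ht : u' j ≤ Real.exp ε * u j)
    (hf : 1 - u' j ≤ Real.exp ε * (1 - u j)) :
    voteProb 𝒮 u' ≤ Real.exp ε * voteProb 𝒮 u := by
  rw [voteProb, voteProb, Finset.mul_sum]
  refine Finset.sum_le_sum fun b _ => ?_
  rw [← Finset.mul_prod_erase _ _ (Finset.mem_univ j),
    ← Finset.mul_prod_erase _ (fun j => coinProb (u j) (b j)) (Finset.mem_univ j), ← mul_assoc]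
  have h2 : ∏ k ∈ Finset.univ.erase j, coinProb (u' k) (b k) =
      ∏ k ∈ Finset.univ.erase j, coinProb (u k) (b k) :=
    Finset.prod_congr rfl fun k hk => by rw [hj k (Finset.ne_of_mem_erase hk)]
  rw [h2]
  refine mul_le_mul_of_nonneg_right ?_
    (Finset.prod_nonneg fun k _ => coinProb_nonneg (h0 k) (h1 k) _)
  cases hb : b j
  · exact hf
  · exact ht

/-- The Chernoff bound for votes. -/
theorem voteProb_le_prod {𝒮 : Finset (Fin R → Bool)} {u : Fin R → ℝ} (h0 : ∀ j, 0 ≤ u j)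
    (h1 : ∀ j, u j ≤ 1) (c : Bool)
    (h𝒮 : ∀ b ∈ 𝒮, R ≤ 2 * (Finset.univ.filter fun j => b j = c).card) :
    voteProb 𝒮 u ≤ (√2)⁻¹ ^ R * ∏ j, (1 + coinProb (u j) c) := by
  have hs : (1 : ℝ) ≤ √2 := Real.one_le_sqrt.mpr one_le_two
  have hs2 : √2 ^ 2 = 2 := Real.sq_sqrt zero_le_two
  -- The exponential moment of the number of votes for `c`, with base 2, factorises over the voters.
  have h2 : ∏ j, (1 + coinProb (u j) c) =
      ∑ b : Fin R → Bool, ∏ j, coinProb (u j) (b j) * (if b j = c then 2 else 1) := by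
    rw [← Fintype.piFinset_univ, ← Finset.prod_univ_sum (fun _ => Finset.univ)
      fun j b => coinProb (u j) b * (if b = c then 2 else 1)]
    refine Finset.prod_congr rfl fun j _ => ?_
    cases c <;> simp [coinProb] <;> ring
  have hterm : ∀ b : Fin R → Bool, 0 ≤ ∏ j, coinProb (u j) (b j) := fun b =>
    Finset.prod_nonneg fun j _ => coinProb_nonneg (h0 j) (h1 j) _
  rw [h2, Finset.mul_sum, voteProb]
  have h3 : ∀ b : Fin R → Bool, ∏ j, coinProb (u j) (b j) * (if b j = c then 2 else 1) =
      (∏ j, coinProb (u j) (b j)) * 2 ^ (Finset.univ.filter fun j => b j = c).card := by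
    intro b
    rw [Finset.prod_mul_distrib, Finset.prod_ite, Finset.prod_const, Finset.prod_const_one, mul_one]
  simp_rw [h3]
  refine (Finset.sum_le_sum fun b hb => ?_).trans
    (Finset.sum_le_sum_of_subset_of_nonneg (Finset.subset_univ 𝒮) fun b _ _ =>
      mul_nonneg (by positivity) (mul_nonneg (hterm b) (by positivity)))
  have h4 : √2 ^ R ≤ 2 ^ (Finset.univ.filter fun j => b j = c).card := by
    calc √2 ^ R ≤ √2 ^ (2 * (Finset.univ.filter fun j => b j = c).card) :=
          pow_le_pow_right₀ hs (h𝒮 b hb)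
      _ = _ := by rw [pow_mul, hs2]
  have h5 : 1 ≤ (√2)⁻¹ ^ R * 2 ^ (Finset.univ.filter fun j => b j = c).card := by
    rw [inv_pow, inv_mul_eq_div, one_le_div (by positivity)]
    exact h4
  calc _ ≤ (∏ j, coinProb (u j) (b j)) *
        ((√2)⁻¹ ^ R * 2 ^ (Finset.univ.filter fun j => b j = c).card) :=
        le_mul_of_one_le_right (hterm b) h5
    _ = _ := by ring

theorem voteProb_majority_le {u : Fin R → ℝ} (h0 : ∀ j, 0 ≤ u j) (h1 : ∀ j, u j ≤ 1) :
    voteProb (majority R) u ≤ (√2)⁻¹ ^ R * ∏ j, (1 + u j) :=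
  voteProb_le_prod h0 h1 true fun _ hb => (Finset.mem_filter.mp hb).2

theorem voteProb_compl_majority_le {u : Fin R → ℝ} (h0 : ∀ j, 0 ≤ u j) (h1 : ∀ j, u j ≤ 1) :
    voteProb (majority R)ᶜ u ≤ (√2)⁻¹ ^ R * ∏ j, (1 + (1 - u j)) := by
  refine voteProb_le_prod h0 h1 false fun b hb => ?_
  have h2 : ¬ R ≤ 2 * (Finset.univ.filter fun j => b j = true).card := fun h =>
    Finset.mem_compl.mp hb (Finset.mem_filter.mpr ⟨Finset.mem_univ _, h⟩)
  have h3 := Finset.card_filter_add_card_filter_not (s := (Finset.univ : Finset (Fin R)))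
    fun j => b j = true
  simp only [Bool.not_eq_true, Finset.card_univ, Fintype.card_fin] at h3
  lia

end Votes

/-! ### Random assignment of the elements of a dataset to groups -/

section Labels

variable {n R : ℕ} {A B : Type} [Fintype A] [Fintype B]

theorem occurrences_option {κ : Type*} [DecidableEq κ] (y : Option A → κ) (s : κ) :
    occurrences y s = occurrences (fun a => y (some a)) s + if y none = s then 1 else 0 := by
  unfold occurrences
  rw [Finset.card_filter, Finset.card_filter, Fintype.sum_option, add_comm]

theorem occurrences_sigma_fst (D : Fin n → ℕ) :
    occurrences (Sigma.fst : (Σ i, Fin (D i)) → Fin n) = D := by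
  ext i
  unfold occurrences
  rw [Finset.card_filter, Fintype.sum_sigma, Finset.sum_eq_single i]
  · simp
  · intro j _ hj
    simp [hj]
  · simp

/-- The symbols of the elements that have been assigned to groups, with their groups. -/
def labelled (l : A → Option (Fin R)) (x : A → Fin n) : A → Option (Fin R × Fin n) :=
  fun a => (l a).map fun j => (j, x a)

/-- The counts of the symbols in each group. -/
def groupCounts (l : A → Option (Fin R)) (x : A → Fin n) : Fin R → Fin n → ℕ :=
  fun j i => occurrences (labelled l x) (some (j, i))

/-- The counts after the insertion of the symbol `i` into the group with the given label. -/
def insertLabelled (c : Option (Fin R)) (i : Fin n) (v : Fin R → Fin n → ℕ) :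
    Fin R → Fin n → ℕ :=
  c.elim v fun j => Function.update v j (v j + Pi.single i 1)

/-- The mean of `Ψ` over the group counts, when each element of the dataset `x` is assigned at
random, independently and with weights `w`, to a group or to none. -/
def labelAverage [DecidableEq A] (w : Option (Fin R) → ℝ) (Ψ : (Fin R → Fin n → ℕ) → ℝ)
    (x : A → Fin n) : ℝ :=
  ∑ l : A → Option (Fin R), (∏ a, w (l a)) * Ψ (groupCounts l x)

theorem labelAverage_comp_equiv [DecidableEq A] [DecidableEq B] (w : Option (Fin R) → ℝ)
    (Ψ : (Fin R → Fin n → ℕ) → ℝ) (e : A ≃ B) (x : B → Fin n) :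
    labelAverage w Ψ (x ∘ e) = labelAverage w Ψ x := by
  unfold labelAverage
  refine (Fintype.sum_equiv (e.symm.arrowCongr (Equiv.refl _)) _ _ fun l => ?_).symm
  have h1 : groupCounts (l ∘ e) (x ∘ e) = groupCounts l x := by
    ext j i
    exact congrFun (occurrences_comp_equiv e (labelled l x)) _
  change _ = (∏ a, w (l (e a))) * Ψ (groupCounts (l ∘ e) (x ∘ e))
  rw [h1, e.prod_comp fun b => w (l b)]

/-- Any two listings of a dataset with the same counts differ by a bijection, so the label average
is a function of the counts alone. -/
theorem labelAverage_eq_of_occurrences_eq [DecidableEq A] (w : Option (Fin R) → ℝ)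
    (Ψ : (Fin R → Fin n → ℕ) → ℝ) (x : A → Fin n) (D : Fin n → ℕ) (h : occurrences x = D) :
    labelAverage w Ψ x = labelAverage w Ψ (Sigma.fst : (Σ i, Fin (D i)) → Fin n) := by
  subst h
  let e : A ≃ Σ i, Fin (occurrences x i) := (Equiv.sigmaFiberEquiv x).symm.trans
    (Equiv.sigmaCongrRight fun i => Fintype.equivFinOfCardEq (Fintype.card_subtype _))
  exact labelAverage_comp_equiv w Ψ e Sigma.fst

theorem groupCounts_option (l : Option A → Option (Fin R)) (x : Option A → Fin n) :
    groupCounts l x = insertLabelled (l none) (x none)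
      (groupCounts (fun a => l (some a)) fun a => x (some a)) := by
  ext j i
  rw [groupCounts, occurrences_option]
  change groupCounts (fun a => l (some a)) (fun a => x (some a)) j i + _ = _
  have h1 : labelled l x none = (l none).map fun j => (j, x none) := rfl
  rw [h1]
  rcases l none with - | k
  · simp [insertLabelled]
  · simp only [insertLabelled, Option.elim, Option.map_some, Option.some.injEq, Prod.mk.injEq]
    by_cases hk : j = k
    · subst hk
      by_cases hi : i = x none
      · subst hi; simp
      · simp [hi, Ne.symm hi]
    · simp [hk, Ne.symm hk]

theorem labelAverage_option [DecidableEq A] (w : Option (Fin R) → ℝ)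
    (Ψ : (Fin R → Fin n → ℕ) → ℝ) (x : Option A → Fin n) :
    labelAverage w Ψ x = ∑ l : A → Option (Fin R), (∏ a, w (l a)) *
      ∑ c, w c * Ψ (insertLabelled c (x none) (groupCounts l fun a => x (some a))) := by
  unfold labelAverage
  rw [← (Equiv.piOptionEquivProd (β := fun _ : Option A => Option (Fin R))).symm.sum_comp,
    Fintype.sum_prod_type_right]
  refine Finset.sum_congr rfl fun l _ => ?_
  rw [Finset.mul_sum]
  refine Finset.sum_congr rfl fun c _ => ?_
  rw [Fintype.prod_option, groupCounts_option]
  change w c * (∏ a, w (l a)) * Ψ (insertLabelled c (x none)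
    (groupCounts l fun a => x (some a))) = _
  ring

theorem sum_prod_weights [DecidableEq A] (w : Option (Fin R) → ℝ) (hw : ∑ c, w c = 1) :
    ∑ l : A → Option (Fin R), ∏ a, w (l a) = 1 := by
  rw [← Fintype.piFinset_univ, ← Finset.prod_univ_sum (fun _ => Finset.univ) fun _ c => w c]
  simp [hw]

theorem one_sub_labelAverage [DecidableEq A] (w : Option (Fin R) → ℝ) (hw : ∑ c, w c = 1)
    (Ψ : (Fin R → Fin n → ℕ) → ℝ) (x : A → Fin n) :
    1 - labelAverage w Ψ x = labelAverage w (fun v => 1 - Ψ v) x := by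
  rw [sub_eq_iff_eq_add, labelAverage, labelAverage, ← Finset.sum_add_distrib]
  refine (sum_prod_weights (A := A) w hw).symm.trans (Finset.sum_congr rfl fun l _ => ?_)
  ring

theorem labelAverage_nonneg [DecidableEq A] {w : Option (Fin R) → ℝ} (hw0 : ∀ c, 0 ≤ w c)
    {Ψ : (Fin R → Fin n → ℕ) → ℝ} (hΨ : ∀ v, 0 ≤ Ψ v) (x : A → Fin n) :
    0 ≤ labelAverage w Ψ x :=
  Finset.sum_nonneg fun _ _ => mul_nonneg (Finset.prod_nonneg fun _ _ => hw0 _) (hΨ _)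

/-- The random assignment to groups preserves stability under insertion. -/
theorem stableUnderInsertion_labelAverage {ε : ℝ} (hε : 0 ≤ ε) {w : Option (Fin R) → ℝ}
    (hw0 : ∀ c, 0 ≤ w c) (hw : ∑ c, w c = 1) {Ψ : (Fin R → Fin n → ℕ) → ℝ} (hΨ0 : ∀ v, 0 ≤ Ψ v)
    (hΨ : ∀ v j i, Ψ (Function.update v j (v j + Pi.single i 1)) ≤ Real.exp ε * Ψ v ∧
      Ψ v ≤ Real.exp ε * Ψ (Function.update v j (v j + Pi.single i 1))) :
    StableUnderInsertion ε fun D : Fin n → ℕ =>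
      labelAverage w Ψ (Sigma.fst : (Σ i, Fin (D i)) → Fin n) := by
  intro D i
  have he : 1 ≤ Real.exp ε := Real.one_le_exp hε
  have hΨ' : ∀ v c, Ψ (insertLabelled c i v) ≤ Real.exp ε * Ψ v ∧
      Ψ v ≤ Real.exp ε * Ψ (insertLabelled c i v) := by
    rintro v (- | j)
    · have := hΨ0 v
      change Ψ v ≤ Real.exp ε * Ψ v ∧ Ψ v ≤ Real.exp ε * Ψ v
      constructor <;> nlinarith
    · exact hΨ v j i
  -- The enlarged dataset is listed with the new element as `none`, so that the labels of the old
  -- elements can be fixed and the sums compared term by term.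
  let x : Option (Σ i, Fin (D i)) → Fin n := fun o => o.elim i Sigma.fst
  have hx : occurrences x = D + Pi.single i 1 := by
    ext k
    rw [occurrences_option]
    change occurrences (Sigma.fst : (Σ i, Fin (D i)) → Fin n) k + (if i = k then 1 else 0) = _
    rw [occurrences_sigma_fst]
    simp [Pi.single_apply, eq_comm]
  beta_reduce
  rw [← labelAverage_eq_of_occurrences_eq w Ψ x _ hx, labelAverage_option, labelAverage,
    Finset.mul_sum, Finset.mul_sum]
  constructor
  · refine Finset.sum_le_sum fun l _ => ?_
    rw [mul_left_comm]
    refine mul_le_mul_of_nonneg_left ?_ (Finset.prod_nonneg fun _ _ => hw0 _)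
    calc _ ≤ ∑ c, w c * (Real.exp ε * Ψ (groupCounts l Sigma.fst)) :=
          Finset.sum_le_sum fun c _ => mul_le_mul_of_nonneg_left (hΨ' _ c).1 (hw0 c)
      _ = _ := by rw [← Finset.sum_mul, hw, one_mul]
  · refine Finset.sum_le_sum fun l _ => ?_
    rw [mul_left_comm]
    refine mul_le_mul_of_nonneg_left ?_ (Finset.prod_nonneg fun _ _ => hw0 _)
    calc Ψ (groupCounts l Sigma.fst) = ∑ c, w c * Ψ (groupCounts l Sigma.fst) := by
          rw [← Finset.sum_mul, hw, one_mul]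
      _ ≤ ∑ c, w c * (Real.exp ε * Ψ (insertLabelled c i (groupCounts l Sigma.fst))) :=
          Finset.sum_le_sum fun c _ => mul_le_mul_of_nonneg_left (hΨ' _ c).2 (hw0 c)
      _ = _ := by
        rw [Finset.mul_sum]
        exact Finset.sum_congr rfl fun c _ => by rw [mul_left_comm]; rfl

end Labels

/-! ### The law of the group counts -/

section GroupLaw

variable {n R : ℕ}

/-- The image of a product law under a coordinatewise map. It serves to forget the symbols of the
samples that received no label. -/
theorem sum_prod_comp {A κ κ' : Type*} [Fintype A] [DecidableEq A] [Fintype κ] [Fintype κ']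
    [DecidableEq κ'] (pair : κ → κ') (ρ : κ → ℝ≥0∞) (G : (A → κ') → ℝ≥0∞) :
    ∑ z : A → κ, (∏ a, ρ (z a)) * G (fun a => pair (z a)) =
      ∑ y : A → κ', (∏ a, ∑ c ∈ Finset.univ.filter (fun c => pair c = y a), ρ c) * G y := by
  rw [← Finset.sum_fiberwise Finset.univ fun (z : A → κ) a => pair (z a)]
  refine Finset.sum_congr rfl fun y _ => ?_
  rw [Finset.prod_univ_sum, Finset.sum_mul]
  refine Finset.sum_congr ?_ fun z hz => ?_
  · ext z
    simp [Fintype.mem_piFinset, funext_iff]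
  · simp only [Fintype.mem_piFinset, Finset.mem_filter, Finset.mem_univ, true_and] at hz
    rw [show (fun a => pair (z a)) = y from funext hz]

theorem map_curry_poissonCounts (r s : ℝ≥0) (p : Fin n → ℝ≥0) :
    (poissonCounts r fun x : Fin R × Fin n => s * p x.2).map Function.curry =
      Measure.pi fun _ : Fin R => poissonCounts (r * s) p := by
  refine Measure.ext_of_singleton fun v => ?_
  rw [Measure.map_apply .of_discrete .of_discrete]
  have h : Function.curry ⁻¹' {v} = {Function.uncurry v} := by
    ext w
    simp only [Set.mem_preimage, Set.mem_singleton_iff]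
    constructor
    · rintro rfl; rfl
    · rintro rfl; rfl
  rw [h, poissonCounts, Measure.pi_singleton, Measure.pi_singleton, Fintype.prod_prod_type]
  refine Finset.prod_congr rfl fun j _ => ?_
  rw [poissonCounts, Measure.pi_singleton]
  simp only [mul_assoc, Function.uncurry]

/-- The mean of a product over the groups, for a random assignment of `m` samples to groups that
leaves out at least half of them on average, is at most three times the product of the means over
Poisson samples. -/
theorem sum_prod_groupCounts_le {m m₀ : ℕ} (hm : 2 ≤ m) (p : PMF (Fin n)) (s t : ℝ≥0)
    (hst : t + R * s = 1) (ht : 1 / 2 ≤ t) (hs : m * s = m₀) {h : (Fin n → ℕ) → ℝ}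
    (h0 : ∀ N, 0 ≤ h N) (hi : Integrable h (countsLaw m₀ p)) :
    ∑ x : Fin m → Fin n, (∏ a, ((p (x a)).toNNReal : ℝ≥0∞)) * ENNReal.ofReal
        (labelAverage (fun c => c.elim (t : ℝ) fun _ => s) (fun v : Fin R → Fin n → ℕ =>
          ∏ j, h (v j)) x) ≤
      ENNReal.ofReal (3 * (∫ N, h N ∂countsLaw m₀ p) ^ R) := by
  set P : Fin R × Fin n → ℝ≥0 := fun x => s * (p x.2).toNNReal with hP
  set H : (Fin R × Fin n → ℕ) → ℝ≥0∞ := fun w => ENNReal.ofReal (∏ j, h fun i => w (j, i)) with hH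
  have hPsum : t + ∑ x, P x = 1 := by
    rw [hP, ← hst, Fintype.sum_prod_type]
    simp only [← Finset.mul_sum, sum_toNNReal_pmf, mul_one, Finset.sum_const, Finset.card_univ,
      Fintype.card_fin, nsmul_eq_mul]
  set w : Option (Fin R) → ℝ≥0 := fun c => c.elim t fun _ => s with hw
  set ρ : Option (Fin R) × Fin n → ℝ≥0∞ := fun z => (w z.1 : ℝ≥0∞) * (p z.2).toNNReal with hρ
  set pair : Option (Fin R) × Fin n → Option (Fin R × Fin n) := fun z => z.1.map fun j => (j, z.2)
    with hpair
  have hfib : ∀ o, ∑ c ∈ Finset.univ.filter (fun c => pair c = o), ρ c = extendWeights t P o := by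
    intro o
    rw [Finset.sum_filter, Fintype.sum_prod_type, Fintype.sum_option]
    rcases o with - | ⟨j, i⟩
    · simp only [hpair, hρ, hw, Option.map_none, Option.map_some, Option.elim, if_true,
        reduceCtorEq, if_false, Finset.sum_const_zero, add_zero, ← Finset.mul_sum, extendWeights]
      rw [← ENNReal.ofNNReal_finsetSum, sum_toNNReal_pmf, ENNReal.coe_one, mul_one]
    · simp only [hpair, hρ, hw, Option.map_none, Option.map_some, Option.elim, reduceCtorEq,
        if_false, Finset.sum_const_zero, zero_add, Option.some.injEq, Prod.mk.injEq,
        extendWeights, hP, ite_and]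
      rw [Finset.sum_comm]
      simp
  have key := sum_option_occurrences_le hm t P hPsum ht H
  calc _ = ∑ z : Fin m → Option (Fin R) × Fin n, (∏ a, ρ (z a)) *
        (fun y : Fin m → Option (Fin R × Fin n) => H fun k => occurrences y (some k))
          (fun a => pair (z a)) := by
        rw [← (Equiv.arrowProdEquivProdArrow (Fin m) (fun _ => Option (Fin R))
          (fun _ => Fin n)).symm.sum_comp, Fintype.sum_prod_type_right]
        refine Finset.sum_congr rfl fun x _ => ?_
        rw [labelAverage, ENNReal.ofReal_sum_of_nonneg, Finset.mul_sum]
        · refine Finset.sum_congr rfl fun l _ => ?_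
          rw [ENNReal.ofReal_mul (Finset.prod_nonneg fun a _ => by
            cases l a <;> simp), ← mul_assoc]
          congr 1
          rw [ENNReal.ofReal_prod_of_nonneg fun a _ => by cases l a <;> simp,
            ← Finset.prod_mul_distrib]
          refine Finset.prod_congr rfl fun a _ => ?_
          change _ = (w (l a) : ℝ≥0∞) * (p (x a)).toNNReal
          rw [mul_comm]
          congr 1
          cases l a <;> simp [hw]
        · exact fun l _ => mul_nonneg (Finset.prod_nonneg fun a _ => by cases l a <;> simp)
            (Finset.prod_nonneg fun j _ => h0 _)
    _ = ∑ y : Fin m → Option (Fin R × Fin n), (∏ a, (extendWeights t P (y a) : ℝ≥0∞)) *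
          H fun k => occurrences y (some k) := by
        refine (sum_prod_comp pair ρ
          fun y : Fin m → Option (Fin R × Fin n) => H fun k => occurrences y (some k)).trans ?_
        simp_rw [hfib]
    _ ≤ _ := key
    _ = ENNReal.ofReal (3 * (∫ N, h N ∂countsLaw m₀ p) ^ R) := by
        rw [ENNReal.ofReal_mul (by norm_num)]
        congr 1
        · simp
        have h1 : ∫⁻ v, H v ∂poissonCounts m P = ∫⁻ v, ENNReal.ofReal (∏ j : Fin R, h (v j))
            ∂Measure.pi fun _ : Fin R => countsLaw m₀ p := by
          have h2 := map_curry_poissonCounts (R := R) m s fun i => (p i).toNNReal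
          rw [hs] at h2
          rw [countsLaw, ← h2, lintegral_map .of_discrete .of_discrete]
          rfl
        rw [h1, ← ofReal_integral_eq_lintegral_ofReal
          (Integrable.fintype_prod fun _ => hi)
          (Filter.Eventually.of_forall fun v => Finset.prod_nonneg fun j _ => h0 _),
          integral_fintype_prod_eq_pow]
        simp

end GroupLaw

/-! ### Amplification of the success probability -/

section Amplification

variable {n R : ℕ}

theorem labelAverage_le_mul {A : Type} [Fintype A] [DecidableEq A] {w : Option (Fin R) → ℝ}
    (hw0 : ∀ c, 0 ≤ w c) {Ψ Φ : (Fin R → Fin n → ℕ) → ℝ} {K : ℝ} (h : ∀ v, Ψ v ≤ K * Φ v)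
    (x : A → Fin n) : labelAverage w Ψ x ≤ K * labelAverage w Φ x := by
  rw [labelAverage, labelAverage, Finset.mul_sum]
  refine Finset.sum_le_sum fun l _ => ?_
  rw [mul_left_comm]
  exact mul_le_mul_of_nonneg_left (h _) (Finset.prod_nonneg fun _ _ => hw0 _)

theorem stableUnderInsertion_labelAverage_voteProb {ε : ℝ} (hε : 0 ≤ ε) {w : Option (Fin R) → ℝ}
    (hw0 : ∀ c, 0 ≤ w c) (hw : ∑ c, w c = 1) {g : (Fin n → ℕ) → ℝ} (g0 : ∀ N, 0 ≤ g N)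
    (g1 : ∀ N, g N ≤ 1) (hg : StableUnderInsertion ε g)
    (hg' : StableUnderInsertion ε fun N => 1 - g N) (𝒮 : Finset (Fin R → Bool)) :
    StableUnderInsertion ε fun D : Fin n → ℕ =>
      labelAverage w (fun v => voteProb 𝒮 fun j => g (v j))
        (Sigma.fst : (Σ i, Fin (D i)) → Fin n) := by
  refine stableUnderInsertion_labelAverage hε hw0 hw
    (fun v => voteProb_nonneg 𝒮 (fun _ => g0 _) fun _ => g1 _) fun v j i => ⟨?_, ?_⟩
  · refine voteProb_le_exp_mul 𝒮 (fun _ => g0 _) (fun _ => g1 _) j (fun k hk => ?_) ?_ ?_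
    · simp [hk]
    · simpa using (hg (v j) i).1
    · simpa using (hg' (v j) i).1
  · refine voteProb_le_exp_mul 𝒮 (fun _ => g0 _) (fun _ => g1 _) j (fun k hk => ?_) ?_ ?_
    · simp [hk]
    · simpa using (hg (v j) i).2
    · simpa using (hg' (v j) i).2

/-- A private tester with error probabilities at most `1 / 3` on Poisson samples can be amplified,
by a majority vote over random disjoint groups of a larger sample of fixed size. -/
theorem exists_amplified {ε α β : ℝ} (hε : 0 ≤ ε) {m m₀ : ℕ} (hm : 2 ≤ m)
    (hR : 2 * R * m₀ ≤ m) (hβ : 3 * (4 / (3 * √2)) ^ R ≤ β) (q : PMF (Fin n))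
    {g : (Fin n → ℕ) → ℝ} (g0 : ∀ N, 0 ≤ g N) (g1 : ∀ N, g N ≤ 1)
    (hg : StableUnderInsertion ε g) (hg' : StableUnderInsertion ε fun N => 1 - g N)
    (hq : ∫ N, g N ∂countsLaw m₀ q ≤ 1 / 3)
    (hp : ∀ p, α ≤ tvDist p q → ∫ N, (1 - g N) ∂countsLaw m₀ p ≤ 1 / 3) :
    ∃ M : Mechanism n Verdict, DifferentiallyPrivate M ε 0 ∧
      TestsIdentity (fun p => outputLaw M p m) q α β β := by
  have hm0 : (m : ℝ≥0) ≠ 0 := by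
    have : m ≠ 0 := by lia
    exact_mod_cast this
  -- With this label probability a group has `m₀` elements on average out of `m`. Since `s` does not
  -- depend on the dataset, the mechanism makes sense for datasets of every size.
  set s : ℝ≥0 := m₀ / m with hs
  have hs' : m * s = m₀ := mul_div_cancel₀ _ hm0
  have hRs : R * s ≤ 1 / 2 := by
    rw [hs, mul_div_assoc', div_le_iff₀ (pos_of_ne_zero hm0), one_div, inv_mul_eq_div,
      le_div_iff₀ (by norm_num)]
    have : R * m₀ * 2 ≤ m := by lia
    exact_mod_cast this
  set t : ℝ≥0 := 1 - R * s with ht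
  have hst : t + R * s = 1 := tsub_add_cancel_of_le (hRs.trans (by
    rw [div_le_iff₀ (by norm_num)]; norm_num))
  have ht2 : 1 / 2 ≤ t := by
    refine le_of_add_le_add_right (a := (1 / 2 : ℝ≥0)) ?_
    calc (1 / 2 : ℝ≥0) + 1 / 2 = t + R * s := by rw [add_halves, hst]
      _ ≤ t + 1 / 2 := by gcongr
  set w : Option (Fin R) → ℝ := fun c => c.elim (t : ℝ) fun _ => s with hw
  have hw0 : ∀ c, 0 ≤ w c := by rintro (- | c) <;> simp [hw]
  have hw1 : ∑ c, w c = 1 := by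
    rw [Fintype.sum_option]
    simp only [hw, Option.elim, Finset.sum_const, Finset.card_univ, Fintype.card_fin,
      nsmul_eq_mul]
    exact_mod_cast hst
  set f : Finset (Fin R → Bool) → (Fin n → ℕ) → ℝ := fun 𝒮 D =>
    labelAverage w (fun v => voteProb 𝒮 fun j => g (v j))
      (Sigma.fst : (Σ i, Fin (D i)) → Fin n) with hf
  have hf0 : ∀ 𝒮 D, 0 ≤ f 𝒮 D := fun 𝒮 D =>
    labelAverage_nonneg hw0 (fun v => voteProb_nonneg 𝒮 (fun _ => g0 _) fun _ => g1 _) _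
  have hfc : ∀ D, 1 - f (majority R) D = f (majority R)ᶜ D := by
    intro D
    rw [hf]
    beta_reduce
    rw [one_sub_labelAverage w hw1]
    congr 1
    funext v
    rw [← voteProb_add_compl (majority R), add_sub_cancel_left]
  have hf1 : ∀ D, f (majority R) D ≤ 1 := fun D => by
    linarith [hfc D, hf0 (majority R)ᶜ D]
  have hstable : ∀ 𝒮, StableUnderInsertion ε (f 𝒮) :=
    stableUnderInsertion_labelAverage_voteProb hε hw0 hw1 g0 g1 hg hg'
  set M : Mechanism n Verdict := fun D => verdictCoin (f (majority R) D) (hf0 _ D) (hf1 D) with hM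
  -- Both kinds of error are treated together: `u` is the error probability of one group, `g` under
  -- `q` and `1 - g` under a distant `p`.
  have herr : ∀ (p : PMF (Fin n)) (𝒮 : Finset (Fin R → Bool)) (u : (Fin n → ℕ) → ℝ),
      (∀ N, 0 ≤ u N) → (∀ N, u N ≤ 1) → ∫ N, u N ∂countsLaw m₀ p ≤ 1 / 3 →
      (∀ v : Fin R → Fin n → ℕ, voteProb 𝒮 (fun j => g (v j)) ≤
        (√2)⁻¹ ^ R * ∏ j, (1 + u (v j))) →
      ∑ x : Fin m → Fin n, (∏ a, ((p (x a)).toNNReal : ℝ≥0∞)) *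
        ENNReal.ofReal (f 𝒮 (occurrences x)) ≤ ENNReal.ofReal β := by
    intro p 𝒮 u u0 u1 hu hv
    have hui : Integrable u (countsLaw m₀ p) := by
      refine Integrable.of_bound .of_discrete 1 (Filter.Eventually.of_forall fun N => ?_)
      rw [Real.norm_of_nonneg (u0 N)]
      exact u1 N
    have h1 := sum_prod_groupCounts_le hm p s t hst ht2 hs' (h := fun N => 1 + u N)
      (fun N => by linarith [u0 N]) ((integrable_const 1).add hui)
    have h2 : ∫ N, (1 + u N) ∂countsLaw m₀ p ≤ 4 / 3 := by
      rw [integral_add (integrable_const _) hui]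
      simp only [integral_const, probReal_univ, smul_eq_mul, mul_one]
      linarith
    have h20 : 0 ≤ ∫ N, (1 + u N) ∂countsLaw m₀ p :=
      integral_nonneg fun N => add_nonneg zero_le_one (u0 N)
    have h3 : ∀ x : Fin m → Fin n, f 𝒮 (occurrences x) ≤ (√2)⁻¹ ^ R *
        labelAverage w (fun v : Fin R → Fin n → ℕ => ∏ j, (1 + u (v j))) x := by
      intro x
      rw [hf]
      beta_reduce
      rw [← labelAverage_eq_of_occurrences_eq w _ x _ rfl]
      exact labelAverage_le_mul hw0 hv x
    calc _ ≤ ∑ x : Fin m → Fin n, ENNReal.ofReal ((√2)⁻¹ ^ R) *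
          ((∏ a, ((p (x a)).toNNReal : ℝ≥0∞)) * ENNReal.ofReal
            (labelAverage w (fun v : Fin R → Fin n → ℕ => ∏ j, (1 + u (v j))) x)) := by
          refine Finset.sum_le_sum fun x _ => ?_
          rw [mul_left_comm, ← ENNReal.ofReal_mul (by positivity)]
          gcongr
          exact h3 x
      _ ≤ ENNReal.ofReal ((√2)⁻¹ ^ R) *
          ENNReal.ofReal (3 * (∫ N, (1 + u N) ∂countsLaw m₀ p) ^ R) := by
          rw [← Finset.mul_sum]
          gcongr
      _ ≤ ENNReal.ofReal β := by
          rw [← ENNReal.ofReal_mul (by positivity)]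
          refine ENNReal.ofReal_le_ofReal (le_trans ?_ hβ)
          calc _ ≤ (√2)⁻¹ ^ R * (3 * (4 / 3) ^ R) := by gcongr
            _ = _ := by
              rw [mul_left_comm, ← mul_pow]
              congr 2
              field_simp
  have hβ0 : 0 ≤ β := le_trans (by positivity) hβ
  refine ⟨M, differentiallyPrivate_verdictCoin hε _ (hf0 _) hf1 (hstable _) ?_, ?_, ?_⟩
  · simp_rw [hfc]
    exact hstable _
  · have h1 : outputLaw M q m .different ≤ ENNReal.ofReal β := by
      rw [outputLaw_apply]
      exact herr q (majority R) g g0 g1 hq fun v =>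
        voteProb_majority_le (fun _ => g0 _) fun _ => g1 _
    have h2 := ENNReal.toReal_le_of_le_ofReal hβ0 h1
    linarith [toReal_equal_add_toReal_different (outputLaw M q m)]
  · intro p hpq
    have h1 : outputLaw M p m .equal ≤ ENNReal.ofReal β := by
      rw [outputLaw_apply]
      change ∑ x : Fin m → Fin n, _ * ENNReal.ofReal (1 - f (majority R) (occurrences x)) ≤ _
      simp_rw [hfc]
      exact herr p (majority R)ᶜ (fun N => 1 - g N) (fun N => by linarith [g1 N])
        (fun N => by linarith [g0 N]) (hp p hpq) fun v =>
          voteProb_compl_majority_le (fun _ => g0 _) fun _ => g1 _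
    have h2 := ENNReal.toReal_le_of_le_ofReal hβ0 h1
    linarith [toReal_equal_add_toReal_different (outputLaw M p m)]

/-! ### Trivial cases and the choice of the number of groups -/

theorem testsIdentity_mono {out : PMF (Fin n) → PMF Verdict} {q : PMF (Fin n)}
    {α β₁ β₂ β₁' β₂' : ℝ} (h : TestsIdentity out q α β₁ β₂) (h1 : β₁ ≤ β₁') (h2 : β₂ ≤ β₂') :
    TestsIdentity out q α β₁' β₂' :=
  ⟨by linarith [h.1], fun p hp => by linarith [h.2 p hp]⟩

theorem differentiallyPrivate_const {ε : ℝ} (hε : 0 ≤ ε) (P : PMF Verdict) :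
    DifferentiallyPrivate (fun _ : Fin n → ℕ => P) ε 0 := by
  intro D D' _ S
  rw [ENNReal.ofReal_zero, add_zero]
  exact le_mul_of_one_le_left' (ENNReal.one_le_ofReal.mpr (Real.one_le_exp hε))

theorem outputLaw_const (P : PMF Verdict) (p : PMF (Fin n)) (m : ℕ) :
    outputLaw (fun _ => P) p m = P := by
  rw [outputLaw, PMF.bind_const]

theorem verdictCoin_equal {t : ℝ} (h0 : 0 ≤ t) (h1 : t ≤ 1) :
    (verdictCoin t h0 h1 .equal).toReal = 1 - t :=
  ENNReal.toReal_ofReal (by linarith)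

theorem verdictCoin_different {t : ℝ} (h0 : 0 ≤ t) (h1 : t ≤ 1) :
    (verdictCoin t h0 h1 .different).toReal = t :=
  ENNReal.toReal_ofReal h0

/-- A fair coin suffices; this removes the range where log (1/β) is close to 0. -/
theorem exists_tester_of_half_le {ε α β : ℝ} (hε : 0 ≤ ε) (hβ : 1 / 2 ≤ β) (q : PMF (Fin n))
    (m : ℕ) : ∃ M : Mechanism n Verdict, DifferentiallyPrivate M ε 0 ∧
      TestsIdentity (fun p => outputLaw M p m) q α β β := by
  have h0 : (0 : ℝ) ≤ 1 / 2 := by norm_num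
  have h1 : (1 / 2 : ℝ) ≤ 1 := by norm_num
  refine ⟨fun _ => verdictCoin (1 / 2) h0 h1,
    differentiallyPrivate_const hε _, ?_, fun p _ => ?_⟩
  · beta_reduce
    rw [outputLaw_const, verdictCoin_equal]
    linarith
  · beta_reduce
    rw [outputLaw_const, verdictCoin_different]
    linarith

theorem exists_tester_of_unique {ε α β : ℝ} (hε : 0 ≤ ε) (hα : 0 < α) (hβ : 0 ≤ β)
    (q : PMF (Fin 1)) (m : ℕ) : ∃ M : Mechanism 1 Verdict, DifferentiallyPrivate M ε 0 ∧
      TestsIdentity (fun p => outputLaw M p m) q α β β := by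
  refine ⟨fun _ => verdictCoin 0 le_rfl zero_le_one,
    differentiallyPrivate_const hε _, ?_, fun p hp => ?_⟩
  · beta_reduce
    rw [outputLaw_const, verdictCoin_equal]
    linarith
  · have h1 := sum_toReal_pmf p
    have h2 := sum_toReal_pmf q
    rw [Fin.sum_univ_one] at h1 h2
    rw [tvDist, Fin.sum_univ_one, h1, h2] at hp
    norm_num at hp
    linarith

/-- The square of the base is 8/9 ≤ exp (-1/9), so R ≥ 54 log (1/β) gives 3 β³, and 3 β² ≤ 1 as β ≤
1/2. -/
theorem majority_error_le {β : ℝ} (hβ0 : 0 < β) (hβ : β ≤ 1 / 2)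
    (hR : 54 * Real.log (1 / β) ≤ R) : 3 * (4 / (3 * √2)) ^ R ≤ β := by
  have h1 : 4 / (3 * √2) ≤ Real.exp (-(1 / 18)) := by
    have h2 : (4 / (3 * √2)) ^ 2 ≤ Real.exp (-(1 / 18)) ^ 2 := by
      rw [← Real.exp_nat_mul, div_pow, mul_pow, Real.sq_sqrt zero_le_two]
      have := Real.add_one_le_exp (((2 : ℕ) : ℝ) * -(1 / 18))
      norm_num at this ⊢
      linarith
    exact le_of_sq_le_sq h2 (Real.exp_pos _).le
  have hlog2 : Real.log 2 ≤ Real.log (1 / β) := by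
    refine Real.log_le_log two_pos ?_
    rw [le_div_iff₀ hβ0]
    linarith
  have hlog3 : Real.log 3 ≤ 2 * Real.log 2 := by
    rw [show 2 * Real.log 2 = Real.log 4 by
      rw [show (4 : ℝ) = 2 ^ 2 by norm_num, Real.log_pow]; norm_num]
    exact Real.log_le_log (by norm_num) (by norm_num)
  calc 3 * (4 / (3 * √2)) ^ R ≤ Real.exp (Real.log 3) * Real.exp (-(1 / 18)) ^ R := by
        rw [Real.exp_log (by norm_num)]
        gcongr
    _ = Real.exp (Real.log 3 + R * -(1 / 18)) := by rw [← Real.exp_nat_mul, ← Real.exp_add]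
    _ ≤ Real.exp (Real.log β) := by
        rw [one_div, Real.log_inv] at hR hlog2
        gcongr
        linarith
    _ = β := Real.exp_log hβ0

theorem exists_tester {C ε α β : ℝ} (hC : 20000000 ≤ C) (q : PMF (Fin n)) (hε : 0 < ε)
    (hα : 0 < α) (hα1 : α ≤ 1) (hβ : 0 < β) {m : ℕ}
    (hm : C * (1 + Real.log n) * sampleBound n α ε * Real.log (1 / β) ≤ m) :
    ∃ M : Mechanism n Verdict, DifferentiallyPrivate M ε 0 ∧
      TestsIdentity (fun p => outputLaw M p m) q α β β := by
  obtain hn | hn : n = 1 ∨ 2 ≤ n := by have := pos_of_pmf q; lia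
  · subst hn
    exact exists_tester_of_unique hε.le hα hβ.le q m
  rcases le_or_gt (1 / 2) β with hβ2 | hβ2
  · exact exists_tester_of_half_le hε.le hβ2 q m
  set Λ := Real.log (1 / β) with hΛ
  have hΛ2 : 1 / 2 ≤ Λ := by
    have : Real.log 2 ≤ Λ := Real.log_le_log two_pos (by rw [le_div_iff₀ hβ]; linarith)
    linarith [Real.log_two_gt_d9]
  set R := ⌈54 * Λ⌉₊ with hRdef
  have hR1 : 54 * Λ ≤ R := Nat.le_ceil _
  have hR2 : R ≤ 56 * Λ := by linarith [Nat.ceil_lt_add_one (a := 54 * Λ) (by linarith)]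
  have hR0 : 0 < R := by
    have : (0 : ℝ) < R := by linarith
    exact_mod_cast this
  have hX : 1 ≤ (1 + Real.log n) * sampleBound n α ε := by
    refine one_le_mul_of_one_le_of_one_le ?_ (one_le_sampleBound (by lia) hα hα1)
    linarith [Real.log_natCast_nonneg n]
  set X := (1 + Real.log n) * sampleBound n α ε with hXdef
  have hm1 : 20000000 * X * Λ ≤ m := by
    refine le_trans ?_ hm
    rw [mul_assoc C, ← hXdef]
    gcongr
  have hm2 : 2 ≤ m := by
    have : (2 : ℝ) ≤ m := by nlinarith
    exact_mod_cast this
  have hdiv : 2 * R * (m / (2 * R)) ≤ m := Nat.mul_div_le _ _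
  -- Since 2R ≤ 112 Λ, a group keeps at least 20000000/112 times X samples minus 1 for rounding,
  -- still enough for the constant 100000.
  have hm0 : 100000 * (1 + Real.log n) * sampleBound n α ε ≤ ((m / (2 * R) : ℕ) : ℝ) := by
    have h1 : m < 2 * R * (m / (2 * R) + 1) := by
      rw [mul_add, mul_one]
      exact Nat.lt_mul_div_succ m (by lia)
    have h2 : (m : ℝ) < 2 * R * (((m / (2 * R) : ℕ) : ℝ) + 1) := by exact_mod_cast h1
    set y := ((m / (2 * R) : ℕ) : ℝ)
    have hy : 0 ≤ y := Nat.cast_nonneg _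
    have h3 : 20000000 * X * Λ < 112 * (y + 1) * Λ := by nlinarith
    have h4 := lt_of_mul_lt_mul_right h3 (by linarith)
    rw [mul_assoc, ← hXdef]
    linarith
  have hst := stableUnderInsertion_rejectProb (C := 100000) (by norm_num) q hε hα hα1 hm0
  exact exists_amplified hε.le hm2 hdiv (majority_error_le hβ hβ2.le hR1) q
    (rejectProb_nonneg ε α _ q) (rejectProb_le_one ε α _ q) hst.1 hst.2
    (integral_rejectProb_le le_rfl hn hε hα hα1 hm0)
    fun p hp => integral_one_sub_rejectProb_le le_rfl hε hα hα1 hm0 hp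

end Amplification

end PrivIT

end

theorem theorem5p1 :
    ∃ (C : ℝ) (k : ℕ), 0 < C ∧
      -- the sample complexity of private identity testing, for arbitrary error probabilities
      (∀ (n : ℕ) (q : PMF (Fin n)) (ε α β₁ β₂ : ℝ),
        0 < ε → 0 < α → α ≤ 1 → 0 < β₁ → β₁ < 1 → 0 < β₂ → β₂ < 1 →
        ∀ m : ℕ,
          C * (1 + Real.log n) ^ k * PrivIT.sampleBound n α ε * Real.log (1 / min β₁ β₂) ≤ m →
          ∃ M : PrivIT.Mechanism n PrivIT.Verdict,
            PrivIT.DifferentiallyPrivate M ε 0 ∧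
            PrivIT.TestsIdentity (fun p => PrivIT.outputLaw M p m) q α β₁ β₂) ∧
      -- the basic algorithm Priv'IT on `Poisson(m)` samples, with error probabilities `1 / 3`
      (∀ (n : ℕ) (q : PMF (Fin n)) (ε α : ℝ),
        2 ≤ n → 0 < ε → 0 < α → α ≤ 1 →
        ∀ m : ℕ,
          C * (1 + Real.log n) ^ k * PrivIT.sampleBound n α ε ≤ m →
          PrivIT.DifferentiallyPrivate (PrivIT.privIT ε α m q) ε 0 ∧
          PrivIT.TestsIdentity (fun p => PrivIT.poissonOutputLaw (PrivIT.privIT ε α m q) p m)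
            q α (1 / 3) (1 / 3)) := by
  -- A single factor 1 + log n pays for both the noise threshold and the allowed deviation, hence k
  -- = 1.
  refine ⟨20000000, 1, by norm_num, ?_, ?_⟩
  · intro n q ε α β₁ β₂ hε hα hα1 hβ₁ _ hβ₂ _ m hm
    rw [pow_one] at hm
    obtain ⟨M, hM, hT⟩ := PrivIT.exists_tester le_rfl q hε hα hα1 (lt_min hβ₁ hβ₂) hm
    exact ⟨M, hM, PrivIT.testsIdentity_mono hT (min_le_left _ _) (min_le_right _ _)⟩
  · intro n q ε α hn hε hα hα1 m hm
    rw [pow_one] at hm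
    exact ⟨PrivIT.differentiallyPrivate_privIT (by norm_num) q hε hα hα1 hm,
      PrivIT.testsIdentity_poissonOutputLaw_privIT q (by norm_num) hn hε hα hα1 hm⟩
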